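/- Consider a chain of $n\ge 2$ particles of dimension $d$ with a nearest-neighbour Hamiltonian $H=\sum_{i=1}^{n-1}H_i$ on $(\mathbb C^d)^{\otimes n}$, where $H_i$ acts on particles $i,i+1$ only and $0\le H_i\le \mathbb 1$. Suppose that $H$ has a unique ground state, spanned by a unit vector $|\Gamma\rangle$, with energy $E_0$, and let $E_1>E_0$ be the next lowest eigenvalue and $\epsilon=E_1-E_0$ the spectral gap. A matrix product state (MPS) of bond dimension at most $B$ is a vector with components $\psi(\sigma_1,\dots,\sigma_n)=l^{T}A_1(\sigma_1)A_2(\sigma_2)\cdots A_n(\sigma_n)\,r$, where the $A_i(\cdot)$ are complex $B\times B$ matrices and $l,r\in\mathbb C^B$. For constant $d$, the ground state is approximated to within $1/\mathrm{poly}(n)$ by an MPS of bond dimension $B=\exp\big(\tilde O(\log^{3/4}n/\epsilon^{1/4})\big)$, in the regime $\log n=\Omega(1/\epsilon^2)$. Precisely: for all $d,p\in\mathbb N$ and every real $a>0$ there are $C>0$ and $k\in\mathbb N$, depending only on $d,p,a$, such that for all $n\ge2$ and all $H$, $|\Gamma\rangle$, $\epsilon$ as above with $\log n\ge a/\epsilon^2$,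 there is a unit vector $|\psi\rangle$ with $\big\||\psi\rangle-|\Gamma\rangle\big\|\le n^{-p}$ which is an MPS of bond dimension at most some $$B\le\exp\!\big(C\,X\,\log^k(2+X)\big),\qquad X=\frac{\log^{3/4}n}{\epsilon^{1/4}} .$$ (In particular, for each fixed $\epsilon_*>0$ this covers all $n\ge 2$ and all $H$ with gap $\epsilon\ge\epsilon_*$, by taking $a=\epsilon_*^2\log 2$, with constants depending on $d,p,\epsilon_*$; with $a=1$ the constants do not depend on the gap, for all $n\ge e^{1/\epsilon^2}$.) -/

import Mathlib

open scoped Matrix ComplexOrder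

/-- The Hilbert space of a chain of `n` spins of dimension `d`, with the standard basis indexed by
configurations `σ : Fin n → Fin d`. -/
abbrev SpinChain (n d : ℕ) : Type := EuclideanSpace ℂ (Fin n → Fin d)

/-- The operator on the chain that acts as `h` on the neighbouring particles `i` and `i + 1` and as
the identity on all others, as a matrix in the standard basis. -/
def nearestNeighborTerm {n d : ℕ} (i : Fin (n - 1))
    (h : Matrix (Fin d × Fin d) (Fin d × Fin d) ℂ) :
    Matrix (Fin n → Fin d) (Fin n → Fin d) ℂ :=
  Matrix.of fun σ τ =>
    if ∀ j : Fin n, j.val ≠ i.val → j.val ≠ i.val + 1 → σ j = τ j then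
      h (σ ⟨i.val, by omega⟩, σ ⟨i.val + 1, by omega⟩)
        (τ ⟨i.val, by omega⟩, τ ⟨i.val + 1, by omega⟩)
    else 0

/-- The nearest-neighbour Hamiltonian `∑ i, Hᵢ` of an open chain, as a linear operator. -/
noncomputable def chainHamiltonian {n d : ℕ}
    (h : Fin (n - 1) → Matrix (Fin d × Fin d) (Fin d × Fin d) ℂ) :
    SpinChain n d →ₗ[ℂ] SpinChain n d :=
  Matrix.toEuclideanLin (∑ i : Fin (n - 1), nearestNeighborTerm i (h i))

/-- `E₀` is the lowest eigenvalue of `H`, it is simple, `Γ` is a unit vector spanning its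
eigenspace, and `E₁` is the next lowest eigenvalue. -/
structure IsGappedGroundState {n d : ℕ} (H : SpinChain n d →ₗ[ℂ] SpinChain n d)
    (Γ : SpinChain n d) (E₀ E₁ : ℝ) : Prop where
  isLeast_ground : IsLeast {E : ℝ | Module.End.HasEigenvalue H (E : ℂ)} E₀
  simple : Module.finrank ℂ (Module.End.eigenspace H (E₀ : ℂ)) = 1
  mem_eigenspace : Γ ∈ Module.End.eigenspace H (E₀ : ℂ)
  norm_eq_one : ‖Γ‖ = 1
  isLeast_excited : IsLeast {E : ℝ | Module.End.HasEigenvalue H (E : ℂ) ∧ E ≠ E₀} E₁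

/-- `ψ` is a matrix product state (with open boundary) of bond dimension at most `B`:
`ψ(σ) = l ⬝ A₀(σ₀) A₁(σ₁) ⋯ Aₙ₋₁(σₙ₋₁) r` with `B × B` matrices `Aᵢ(a)` and boundary vectors
`l`, `r`. -/
def IsMatrixProductState {n d : ℕ} (B : ℕ) (ψ : SpinChain n d) : Prop :=
  ∃ (A : Fin n → Fin d → Matrix (Fin B) (Fin B) ℂ) (l r : Fin B → ℂ),
    ∀ σ : Fin n → Fin d,
      ψ σ = l ⬝ᵥ ((List.ofFn fun i => A i (σ i)).prod *ᵥ r)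

/-!
The bond dimension of a matrix product state is governed by its Schmidt ranks across the cuts of the
chain, so the ground state `Γ` has to be approximated, for every cut, by a vector of Schmidt rank at
most `B`. These approximations are then merged into one vector by projecting, cut after cut, onto
the left Schmidt spaces (`exists_matrixProductState_approx`), and a vector of Schmidt rank at most
`B` across all cuts is a matrix product state (`isMatrixProductState_of_schmidtLE`).

For a single cut, an approximate ground state projection is used: an operator `K` which fixes the
ground state, maps its orthogonal complement to itself with norm `δ`, and maps product vectors to
vectors of Schmidt rank at most `D`. If `D * δ ^ 2 ≤ 1 / 4`, some product vector has an overlap of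
order `1 / √D` with the ground state, and applying `K` to it gives an approximation of rank `D`
and error `O(√D * δ)` (`exists_schmidtLE_approx`).

The operator `K` is a Chebyshev polynomial of degree `l` in a Hamiltonian `T`, of order
`δ = exp (-l * √(ε / ‖T‖))` (`exists_polynomial_small_on_Icc`). For a good `δ` the norm of `T` must
be small. Therefore a window of `s` terms, starting with the one across the cut, is kept, and the
two remaining parts of the chain are replaced by their truncations at energy `t = O(log n)` above their ground
state energies. The truncation hardly affects the low energy states: conjugating a local term with
`exp (A / 12)`, where `A` is one of the two parts, leaves it bounded (`norm_exp_conj_chainTerm_le`),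
hence the eigenvectors of `T` of low energy carry only an exponentially small weight on energies of
`A` above `t` (`energy_sub_energyTrunc_le`). Consequently `T` has a gap of at least `ε / 2` and a
ground state close to `Γ` (`ground_of_le`).

For the Schmidt rank, expand `T ^ m` with `m ≤ l` into words whose letters are the `s` window terms
and the sum of the two truncated parts. In each word some window term occurs at most `r = l / s`
times. Sorting the words by the first such term `j` and moving the cut to this place, the words are
collected into few products of a left and a right operator: only the at most `r` occurrences of the
term `j` have to be split, and everything that is built from letters on one side is summed up in a
single operator (`exists_weightedWords_eq`, with the recursion `weightedWords`). Moving the cut costs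
a factor `d ^ s` in either direction. Altogether `log D = O((s + l / s) * log l)`
(`SchmidtLE.aeval_apply`).

With `t` of order `log n`, `s` of order `X` and `l` of order `X ^ 2`, where `X ^ 4 * ε = (log n) ^ 3`,
one has `l * √(ε / log n) ≈ log n`, which makes `δ` an arbitrary power of `1 / n`, while `log D` is of
order `X * log X` (`exists_parameters`). The regime `log n ≥ a / ε ^ 2` gives
`X = O((log n) ^ (7 / 8))`, so that `D ≤ n` for large `n`, as is needed for `D * δ ^ 2 ≤ 1 / 4`.
Chains of bounded length are covered by the exact representation of bond dimension `d ^ n`, since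
`ε ≤ 1` (`IsGappedGroundState.le_add_one`) bounds `X` from below.
-/

set_option linter.unusedSectionVars false

/-! ### Conjugation by exponentials -/

section ConjExp
open NormedSpace
variable {𝔸 : Type*} [NormedRing 𝔸] [NormedAlgebra ℂ 𝔸] [CompleteSpace 𝔸]

/-- The inner derivation `x ↦ a * x - x * a`. -/
noncomputable def adCLM (a : 𝔸) : 𝔸 →L[ℂ] 𝔸 :=
  ContinuousLinearMap.mul ℂ 𝔸 a - (ContinuousLinearMap.mul ℂ 𝔸).flip a

omit [CompleteSpace 𝔸] in
theorem adCLM_apply (a x : 𝔸) : adCLM a x = a * x - x * a := rfl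

/-- Left and right multiplication by `a` commute, so the exponential of their difference is
conjugation by `exp a`. -/
theorem exp_mul_mul_exp_neg (a v : 𝔸) : exp a * v * exp (-a) = exp (adCLM a) v := by
  let : NormedAlgebra ℚ 𝔸 := NormedAlgebra.restrictScalars ℚ ℂ 𝔸
  let : NormedAlgebra ℚ (𝔸 →L[ℂ] 𝔸) := NormedAlgebra.restrictScalars ℚ ℂ _
  have h1 : exp (ContinuousLinearMap.mul ℂ 𝔸 a) = ContinuousLinearMap.mul ℂ 𝔸 (exp a) := by
    let f : 𝔸 →+* (𝔸 →L[ℂ] 𝔸) :=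
      { toFun := fun x => ContinuousLinearMap.mul ℂ 𝔸 x
        map_one' := by ext; simp
        map_mul' := fun x y => by ext; simp [mul_assoc]
        map_zero' := by simp
        map_add' := fun x y => by simp }
    exact (map_exp f (ContinuousLinearMap.mul ℂ 𝔸).continuous a).symm
  have h2 : exp (-(ContinuousLinearMap.mul ℂ 𝔸).flip a)
      = (ContinuousLinearMap.mul ℂ 𝔸).flip (exp (-a)) := by
    rw [exp_eq_tsum ℂ, exp_eq_tsum ℂ, ContinuousLinearMap.map_tsum _ (expSeries_summable' (𝕂 := ℂ) (-a))]
    rw [← map_neg]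
    refine tsum_congr fun n => ?_
    ext x
    have : ∀ n : ℕ, (((ContinuousLinearMap.mul ℂ 𝔸).flip (-a)) ^ n) x = x * (-a) ^ n := by
      intro n
      induction n with
      | zero => simp
      | succ k ih =>
        rw [pow_succ']
        change (ContinuousLinearMap.mul ℂ 𝔸).flip (-a)
          (((ContinuousLinearMap.mul ℂ 𝔸).flip (-a) ^ k) x) = _
        rw [ih, pow_succ]; simp [mul_assoc]
    change (n.factorial : ℂ)⁻¹ • ((ContinuousLinearMap.mul ℂ 𝔸).flip (-a) ^ n) x
      = x * ((n.factorial : ℂ)⁻¹ • (-a) ^ n)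
    rw [this, mul_smul_comm]
  have hc : Commute (ContinuousLinearMap.mul ℂ 𝔸 a) (-(ContinuousLinearMap.mul ℂ 𝔸).flip a) := by
    ext x; simp [mul_assoc]
  rw [adCLM, sub_eq_add_neg, exp_add_of_commute hc, h1, h2]
  simp [mul_assoc]

/-- If the iterated commutators of `a` with `v` grow at most like `k! c ^ k`, conjugation of `v` by
`exp (s a)` with `c s ≤ 1 / 2` gives norm at most `2`: the exponential series is dominated by the geometric one. -/
theorem norm_exp_conj_le {a v : 𝔸} {c s : ℝ} (hc : 0 ≤ c) (hs : 0 ≤ s) (hcs : c * s ≤ 1 / 2)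
    (h : ∀ k : ℕ, ‖(adCLM a)^[k] v‖ ≤ c ^ k * k.factorial) :
    ‖exp ((s : ℂ) • a) * v * exp (-((s : ℂ) • a))‖ ≤ 2 := by
  rw [exp_mul_mul_exp_neg]
  have had : adCLM ((s : ℂ) • a) = (s : ℂ) • adCLM a := by
    ext x; simp [adCLM_apply, smul_sub]
  have hpow : ∀ k : ℕ, ((adCLM ((s : ℂ) • a)) ^ k) v = (s : ℂ) ^ k • (adCLM a)^[k] v := by
    intro k
    rw [had]
    induction k with
    | zero => simp
    | succ k ih =>
      rw [pow_succ', Function.iterate_succ_apply']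
      change (s : ℂ) • adCLM a ((((s : ℂ) • adCLM a) ^ k) v) = _
      rw [ih, map_smul, smul_smul, pow_succ']
  rw [exp_eq_tsum ℂ]
  have hsum : Summable fun n : ℕ => ((n.factorial : ℂ)⁻¹) • (adCLM ((s : ℂ) • a)) ^ n :=
    expSeries_summable' (𝕂 := ℂ) _
  have : (∑' n : ℕ, ((n.factorial : ℂ)⁻¹) • (adCLM ((s : ℂ) • a)) ^ n) v
      = ∑' n : ℕ, (((n.factorial : ℂ)⁻¹) • (adCLM ((s : ℂ) • a)) ^ n) v :=
    (ContinuousLinearMap.apply ℂ 𝔸 v).map_tsum hsum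
  rw [this]
  refine tsum_of_norm_bounded (g := fun n : ℕ => ((1 : ℝ) / 2) ^ n) ?_ ?_
  · simpa using hasSum_geometric_two
  · intro k
    rw [smul_apply, hpow, norm_smul, norm_smul, norm_inv, norm_pow]
    simp only [Complex.norm_natCast, Complex.norm_real, Real.norm_eq_abs, abs_of_nonneg hs]
    have hk : (0 : ℝ) < k.factorial := by positivity
    calc ((k.factorial : ℝ))⁻¹ * (s ^ k * ‖(adCLM a)^[k] v‖)
        ≤ ((k.factorial : ℝ))⁻¹ * (s ^ k * (c ^ k * k.factorial)) := by gcongr; exact h k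
      _ = (c * s) ^ k := by field_simp; rw [mul_pow]; ring
      _ ≤ (1 / 2) ^ k := by gcongr

end ConjExp

/-! ### Energies and their truncation -/

section Energy
open ContinuousLinearMap
variable {E : Type*} [NormedAddCommGroup E] [InnerProductSpace ℂ E] [FiniteDimensional ℂ E]

/-- The expectation value `⟨x, T x⟩` as a real number, not normalised by `‖x‖ ^ 2`. -/
noncomputable def energy (T : E →L[ℂ] E) (x : E) : ℝ := (inner ℂ x (T x)).re

theorem energy_mono {S T : E →L[ℂ] E} (h : S ≤ T) (x : E) : energy S x ≤ energy T x := by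
  have h1 := ((ContinuousLinearMap.le_def S T).1 h).re_inner_nonneg_right x
  simp only [energy]
  rw [_root_.sub_apply, inner_sub_right] at h1
  simpa using h1

theorem energy_add (S T : E →L[ℂ] E) (x : E) : energy (S + T) x = energy S x + energy T x := by
  simp [energy]

theorem energy_smul (r : ℝ) (T : E →L[ℂ] E) (x : E) : energy (r • T) x = r * energy T x := by
  simp [energy]

theorem energy_algebraMap (r : ℝ) (x : E) : energy (algebraMap ℝ (E →L[ℂ] E) r) x = r * ‖x‖ ^ 2 := by
  rw [Algebra.algebraMap_eq_smul_one, energy_smul]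
  simp [energy, inner_self_eq_norm_sq_to_K, ← Complex.ofReal_pow]

theorem isSelfAdjoint_inner_comm {T : E →L[ℂ] E} (hT : IsSelfAdjoint T) (x y : E) :
    inner ℂ (T x) y = inner ℂ x (T y) := by
  conv_lhs => rw [← hT.adjoint_eq]
  exact ContinuousLinearMap.adjoint_inner_left T y x

theorem energy_le_norm (T : E →L[ℂ] E) (x : E) : |energy T x| ≤ ‖T‖ * ‖x‖ ^ 2 := by
  calc |energy T x| ≤ ‖inner ℂ x (T x)‖ := Complex.abs_re_le_norm _
    _ ≤ ‖x‖ * ‖T x‖ := norm_inner_le_norm _ _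
    _ ≤ ‖x‖ * (‖T‖ * ‖x‖) := by gcongr; exact T.le_opNorm x
    _ = _ := by ring

/-- The truncation of the self-adjoint operator `A` at energy `t`, that is `min (A, t)` in the
functional calculus. -/
noncomputable def energyTrunc (A : E →L[ℂ] E) (t : ℝ) : E →L[ℂ] E := cfc (fun x : ℝ => min x t) A

/-- A bound for conjugation by `exp (s A)` carries over to conjugation by `exp (s min (A, t))`, at the
cost of an additive constant. -/
theorem norm_weight_conj_le {A V : E →L[ℂ] E} (hA : IsSelfAdjoint A) {s t : ℝ} (hs : 0 ≤ s)
    (hV : ‖V‖ ≤ 1)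
    (hconj : ‖NormedSpace.exp ((s : ℂ) • A) * V * NormedSpace.exp (-((s : ℂ) • A))‖ ≤ 2) :
    ‖cfc (fun x : ℝ => Real.exp (s * min x t)) A * V *
      cfc (fun x : ℝ => Real.exp (-(s * min x t))) A‖ ≤ 3 := by
  have hexp : NormedSpace.exp ((s : ℂ) • A) = cfc (fun x : ℝ => Real.exp (s * x)) A := by
    have h1 : (s : ℂ) • A = s • A := by ext; simp
    rw [h1, ← CFC.real_exp_eq_normedSpace_exp ((IsSelfAdjoint.all _).smul hA), ← cfc_comp_smul s Real.exp A]
    rfl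
  have hexp' : NormedSpace.exp (-((s : ℂ) • A)) = cfc (fun x : ℝ => Real.exp (-(s * x))) A := by
    have h1 : -((s : ℂ) • A) = (-s) • A := by ext; simp
    rw [h1, ← CFC.real_exp_eq_normedSpace_exp ((IsSelfAdjoint.all _).smul hA), ← cfc_comp_smul (-s) Real.exp A]
    simp
  have hW : cfc (fun x : ℝ => Real.exp (s * min x t)) A
      = cfc (fun x : ℝ => Real.exp (s * min x t - s * x)) A * cfc (fun x : ℝ => Real.exp (s * x)) A := by
    rw [← cfc_mul ..]
    congr 1; ext x; rw [← Real.exp_add]; ring_nf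
  have hW' : cfc (fun x : ℝ => Real.exp (-(s * min x t))) A
      = cfc (fun x : ℝ => Real.exp (-(s * x))) A +
        cfc (fun x : ℝ => Real.exp (-(s * min x t)) - Real.exp (-(s * x))) A := by
    rw [← cfc_add ..]
    congr 1; ext x; ring
  -- the inverse of `W` is `exp (-s A) + Z` with `‖W‖ ‖Z‖ ≤ 1`, and `W = Y exp (s A)` with `‖Y‖ ≤ 1`
  set Y := cfc (fun x : ℝ => Real.exp (s * min x t - s * x)) A
  set W := cfc (fun x : ℝ => Real.exp (s * min x t)) A
  set Z := cfc (fun x : ℝ => Real.exp (-(s * min x t)) - Real.exp (-(s * x))) A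
  have hY : ‖Y‖ ≤ 1 := norm_cfc_le zero_le_one fun x _ => by
    rw [Real.norm_eq_abs, abs_of_pos (Real.exp_pos _), Real.exp_le_one_iff]
    nlinarith [min_le_left x t]
  have hWn : ‖W‖ ≤ Real.exp (s * t) := norm_cfc_le (Real.exp_pos _).le fun x _ => by
    rw [Real.norm_eq_abs, abs_of_pos (Real.exp_pos _), Real.exp_le_exp]
    nlinarith [min_le_right x t]
  have hZ : ‖Z‖ ≤ Real.exp (-(s * t)) := norm_cfc_le (Real.exp_pos _).le fun x hx => by
    rw [Real.norm_eq_abs]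
    rcases le_total x t with h | h
    · rw [min_eq_left h]; simp [Real.exp_nonneg]
    · rw [min_eq_right h, abs_of_nonneg]
      · linarith [Real.exp_pos (-(s * x))]
      · rw [sub_nonneg, Real.exp_le_exp]; nlinarith
  have key : W * V * (cfc (fun x : ℝ => Real.exp (-(s * x))) A + Z)
      = Y * (NormedSpace.exp ((s : ℂ) • A) * V * NormedSpace.exp (-((s : ℂ) • A))) + W * V * Z := by
    rw [hexp, hexp', mul_add]
    congr 1
    rw [hW]; simp only [mul_assoc]
  rw [hW', key]
  have e1 : ‖Y * (NormedSpace.exp ((s : ℂ) • A) * V * NormedSpace.exp (-((s : ℂ) • A)))‖ ≤ 1 * 2 :=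
    (norm_mul_le _ _).trans (by gcongr)
  have e2 : ‖W * V * Z‖ ≤ Real.exp (s * t) * 1 * Real.exp (-(s * t)) :=
    (norm_mul_le _ _).trans (by gcongr; exact (norm_mul_le _ _).trans (by gcongr))
  have e3 : Real.exp (s * t) * 1 * Real.exp (-(s * t)) = 1 := by
    rw [mul_one, ← Real.exp_add]; simp
  linarith [norm_add_le (Y * (NormedSpace.exp ((s : ℂ) • A) * V * NormedSpace.exp (-((s : ℂ) • A)))) (W * V * Z)]

/-- Eigenvectors `φ` of a truncated Hamiltonian `min (A, t) + V + C` with eigenvalue `lam` see little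
of the truncation, if `V` behaves well under conjugation by `exp (s A)` and `C ≥ c₀` commutes with
`A`. For `y = exp (s min (A, t)) φ` the eigenvalue equation holds with the conjugate of `V` in the
place of `V`, and bounds the energy of `min (A, t)` in the state `y` by `G`; hence
`⟨φ, exp (2 s min (A, t)) (min (A, t) - G) φ⟩ ≤ 0`, in which the energies above `t` have the weight
`exp (2 s t)`. -/
theorem energy_sub_energyTrunc_le {A V C : E →L[ℂ] E} {s t N c₀ G lam : ℝ} {φ : E}
    (hA0 : 0 ≤ A) (hAN : A ≤ algebraMap ℝ _ N) (hN : 0 < N) (hs : 0 ≤ s)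
    (hV : ‖V‖ ≤ 1)
    (hconj : ‖NormedSpace.exp ((s : ℂ) • A) * V * NormedSpace.exp (-((s : ℂ) • A))‖ ≤ 2)
    (hAC : Commute A C) (hC : algebraMap ℝ _ c₀ ≤ C)
    (hφ : (energyTrunc A t + V + C) φ = (lam : ℂ) • φ) (hφ1 : ‖φ‖ = 1)
    (hG : lam - c₀ + 3 ≤ G) (hG0 : 0 < G) (ht : 2 * G ≤ t) :
    energy (A - energyTrunc A t) φ ≤ N * Real.exp (2 * s * (G - t)) := by
  have hA : IsSelfAdjoint A := IsSelfAdjoint.of_nonneg hA0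
  set W := cfc (fun x : ℝ => Real.exp (s * min x t)) A with hWdef
  set W' := cfc (fun x : ℝ => Real.exp (-(s * min x t))) A with hW'def
  have hWsa : IsSelfAdjoint W := cfc_predicate _ _
  have hinv : W' * W = 1 := by
    rw [hWdef, hW'def, ← cfc_mul ..]
    simp only [← Real.exp_add, neg_add_cancel, Real.exp_zero]
    exact cfc_const_one ℝ A
  have hU := norm_weight_conj_le (t := t) hA hs hV hconj
  set U := W * V * W'
  set y := W φ with hy
  have hWC : Commute W C := hAC.cfc_real _
  have hWA : Commute W (energyTrunc A t) := cfc_commute_cfc _ _ _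
  have hUy : U y = W (V φ) := by
    have : U * W = W * V := by rw [mul_assoc, hinv, mul_one]
    exact congrArg (fun T : E →L[ℂ] E => T φ) this
  have hev : (energyTrunc A t) y + U y + C y = (lam : ℂ) • y := by
    have h1 : (energyTrunc A t) y = W (energyTrunc A t φ) :=
      congrArg (fun T : E →L[ℂ] E => T φ) hWA.eq.symm
    have h2 : C y = W (C φ) := congrArg (fun T : E →L[ℂ] E => T φ) hWC.eq.symm
    rw [h1, h2, hUy, hy, ← map_smul, ← hφ, ← map_add, ← map_add]; rfl
  have hen : energy (energyTrunc A t) y + energy U y + energy C y = lam * ‖y‖ ^ 2 := by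
    rw [← energy_algebraMap, ← energy_add, ← energy_add]
    simp only [energy]
    congr 2
  have hUe : -(3 * ‖y‖ ^ 2) ≤ energy U y := by
    have := energy_le_norm U y
    have h3 : ‖U‖ * ‖y‖ ^ 2 ≤ 3 * ‖y‖ ^ 2 := by gcongr
    linarith [neg_abs_le (energy U y)]
  have hCe : c₀ * ‖y‖ ^ 2 ≤ energy C y := by
    rw [← energy_algebraMap]; exact energy_mono hC y
  have hAe : energy (energyTrunc A t) y ≤ G * ‖y‖ ^ 2 := by
    have : (lam - c₀ + 3) * ‖y‖ ^ 2 ≤ G * ‖y‖ ^ 2 := by gcongr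
    linarith
  -- transport the inequality back to `φ`
  have hback : energy (cfc (fun x : ℝ => Real.exp (2 * s * min x t) * (min x t - G)) A) φ
      = energy (energyTrunc A t) y - G * ‖y‖ ^ 2 := by
    have h1 : cfc (fun x : ℝ => Real.exp (2 * s * min x t) * (min x t - G)) A
        = W * (energyTrunc A t - algebraMap ℝ _ G) * W := by
      rw [energyTrunc, ← cfc_const G A, ← cfc_sub .., hWdef, ← cfc_mul .., ← cfc_mul ..]
      congr 1; ext x
      rw [show 2 * s * min x t = s * min x t + s * min x t by ring, Real.exp_add]; ring
    rw [h1, ← energy_algebraMap]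
    have : energy (energyTrunc A t) y - energy (algebraMap ℝ _ G) y
        = energy (energyTrunc A t - algebraMap ℝ _ G) y := by
      simp [energy]
    rw [this]
    simp only [energy]
    congr 1
    exact (isSelfAdjoint_inner_comm hWsa φ _).symm
  have hNspec : ∀ x ∈ spectrum ℝ A, x ≤ N := (le_algebraMap_iff_spectrum_le hA).1 hAN
  have h0spec : ∀ x ∈ spectrum ℝ A, 0 ≤ x := fun x hx => spectrum_nonneg_of_nonneg hA0 hx
  have hmono : cfc (fun x : ℝ => (Real.exp (2 * s * t) * G / N) * (x - min x t)) A
      ≤ cfc (fun x : ℝ => Real.exp (2 * s * min x t) * (min x t - G) + G * Real.exp (2 * s * G)) A := by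
    refine cfc_mono fun x hx => ?_
    have hx0 := h0spec x hx
    have hxN := hNspec x hx
    rcases le_total x t with h | h
    · rw [min_eq_left h, sub_self, mul_zero]
      rcases le_total x G with h' | h'
      · have h1 : Real.exp (2 * s * x) ≤ Real.exp (2 * s * G) := Real.exp_le_exp.2 (by gcongr)
        have h2 : Real.exp (2 * s * x) * (G - x) ≤ Real.exp (2 * s * G) * G :=
          mul_le_mul h1 (by linarith) (by linarith) (Real.exp_pos _).le
        linarith
      · have := mul_nonneg (Real.exp_pos (2 * s * x)).le (sub_nonneg.2 h')
        have := mul_pos hG0 (Real.exp_pos (2 * s * G))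
        linarith
    · rw [min_eq_right h]
      have h1 : Real.exp (2 * s * t) * G / N * (x - t) ≤ Real.exp (2 * s * t) * G := by
        rw [div_mul_eq_mul_div, div_le_iff₀ hN]
        gcongr; linarith
      have h2 : Real.exp (2 * s * t) * G ≤ Real.exp (2 * s * t) * (t - G) := by
        gcongr; linarith
      have := mul_pos hG0 (Real.exp_pos (2 * s * G))
      linarith
  have hfin := energy_mono hmono φ
  have hL : cfc (fun x : ℝ => (Real.exp (2 * s * t) * G / N) * (x - min x t)) A
      = (Real.exp (2 * s * t) * G / N) • (A - energyTrunc A t) := by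
    rw [cfc_const_mul .., cfc_sub .., cfc_id' ..]; rfl
  have hR : cfc (fun x : ℝ => Real.exp (2 * s * min x t) * (min x t - G) + G * Real.exp (2 * s * G)) A
      = cfc (fun x : ℝ => Real.exp (2 * s * min x t) * (min x t - G)) A
        + algebraMap ℝ _ (G * Real.exp (2 * s * G)) := by
    rw [cfc_add .., cfc_const ..]
  rw [hL, hR, energy_add, hback, energy_smul, energy_algebraMap, hφ1] at hfin
  have h4 : (Real.exp (2 * s * t) * G / N) * energy (A - energyTrunc A t) φ
      ≤ G * Real.exp (2 * s * G) := by linarith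
  have h5 : Real.exp (2 * s * (G - t)) = Real.exp (2 * s * G) / Real.exp (2 * s * t) := by
    rw [← Real.exp_sub]; ring_nf
  have hκ : 0 < Real.exp (2 * s * t) * G / N := by positivity
  rw [h5]
  calc energy (A - energyTrunc A t) φ
      = ((Real.exp (2 * s * t) * G / N) * energy (A - energyTrunc A t) φ)
        / (Real.exp (2 * s * t) * G / N) := by field_simp
    _ ≤ (G * Real.exp (2 * s * G)) / (Real.exp (2 * s * t) * G / N) := by gcongr
    _ = _ := by field_simp

end Energy

/-! ### Chebyshev polynomials -/

section Chebyshev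
open Polynomial

/-- The Chebyshev polynomial of degree `l`, rescaled to the interval `[e + g, b]` and normalised at
`e`, decays there at the rate `√(g / b)` in `l`. -/
theorem exists_polynomial_small_on_Icc (l : ℕ) {e g b : ℝ} (hg : 0 < g) (he : 0 ≤ e)
    (hb : e + g < b) :
    ∃ p : ℝ[X], p.natDegree ≤ l ∧ p.eval e = 1 ∧
      ∀ x, e + g ≤ x → x ≤ b → |p.eval x| ≤ 2 * Real.exp (-(l * √(g / b))) := by
  have hb0 : 0 < b := by linarith
  set w := b - (e + g) with hw
  have hw0 : 0 < w := by linarith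
  -- the affine map sending `[e + g, b]` onto `[-1, 1]` and reversing orientation
  set q : ℝ[X] := C (-(2 / w)) * X + C ((b + (e + g)) / w) with hq
  have hqe : ∀ x, q.eval x = (b + (e + g) - 2 * x) / w := by
    intro x; simp [hq]; ring
  set T := Chebyshev.T ℝ (l : ℤ) with hT
  set y := q.eval e with hy
  have hy1 : 1 + 2 * (g / b) ≤ y := by
    rw [hy, hqe]
    have h1 : (b + (e + g) - 2 * e) / w = 1 + 2 * (g / w) := by field_simp; rw [hw]; ring
    rw [h1]
    have : g / b ≤ g / w := by gcongr; linarith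
    linarith
  have hgb : 0 < g / b := by positivity
  have hgb1 : g / b ≤ 1 := by rw [div_le_one hb0]; linarith
  have hy1' : 1 ≤ y := by linarith
  set u := √(g / b) with hu
  have hu0 : 0 ≤ u := Real.sqrt_nonneg _
  have hu2 : u ^ 2 = g / b := Real.sq_sqrt hgb.le
  have hu1 : u ≤ 1 := by nlinarith
  -- growth outside of `[-1, 1]`
  have hgrow : Real.exp (l * u) / 2 ≤ T.eval y := by
    rw [hT, ← Real.cosh_arcosh hy1', Chebyshev.T_real_cosh]
    have hexp : Real.exp u ≤ Real.exp (Real.arcosh y) := by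
      rw [Real.exp_arcosh hy1']
      have h1 := Real.abs_exp_sub_one_le (x := u) (by rw [abs_of_nonneg hu0]; exact hu1)
      rw [abs_of_nonneg hu0] at h1
      have h2 := le_abs_self (Real.exp u - 1)
      have h3 : 2 * u ≤ √(y ^ 2 - 1) := by
        apply Real.le_sqrt_of_sq_le
        nlinarith
      linarith
    have h4 : u ≤ Real.arcosh y := Real.exp_le_exp.1 hexp
    have h5 : Real.exp (l * u) ≤ Real.exp (l * Real.arcosh y) := by gcongr
    rw [Real.cosh_eq]
    have := Real.exp_pos (-(((l : ℤ) : ℝ) * Real.arcosh y))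
    push_cast at *
    linarith
  have hTy : 0 < T.eval y := lt_of_lt_of_le (by positivity) hgrow
  refine ⟨C (T.eval y)⁻¹ * T.comp q, ?_, ?_, ?_⟩
  · refine (natDegree_C_mul_le _ _).trans (natDegree_comp_le.trans ?_)
    have h1 : T.natDegree ≤ l := by simp [hT, Chebyshev.natDegree_T]
    have h2 : q.natDegree ≤ 1 := natDegree_linear_le
    calc T.natDegree * q.natDegree ≤ l * 1 := Nat.mul_le_mul h1 h2
      _ = l := mul_one l
  · rw [eval_mul, eval_C, eval_comp, ← hy, inv_mul_cancel₀ hTy.ne']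
  · intro x hx1 hx2
    rw [eval_mul, eval_C, eval_comp, abs_mul, abs_inv, abs_of_pos hTy]
    have h1 : |T.eval (q.eval x)| ≤ 1 := by
      apply Chebyshev.abs_eval_T_real_le_one
      rw [hqe, abs_div, abs_of_pos hw0, div_le_one hw0, abs_le]
      constructor <;> linarith
    have h2 : (T.eval y)⁻¹ ≤ 2 * Real.exp (-(l * u)) := by
      rw [Real.exp_neg, ← div_eq_mul_inv, ← inv_div]
      gcongr
    calc _ ≤ (2 * Real.exp (-(l * u))) * 1 := by gcongr
      _ = _ := mul_one _

end Chebyshev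

/-! ### Spectral gaps under truncation -/

section Spectral
open Polynomial
variable {E : Type*} [NormedAddCommGroup E] [InnerProductSpace ℂ E] [FiniteDimensional ℂ E]

theorem exists_eigenbasis {T : E →L[ℂ] E} (hT : IsSelfAdjoint T) :
    ∃ (b : OrthonormalBasis (Fin (Module.finrank ℂ E)) ℂ E) (lam : Fin (Module.finrank ℂ E) → ℝ),
      ∀ i, T (b i) = (lam i : ℂ) • b i := by
  have hs : (T : E →ₗ[ℂ] E).IsSymmetric := hT.isSymmetric
  exact ⟨hs.eigenvectorBasis rfl, hs.eigenvalues rfl, hs.apply_eigenvectorBasis rfl⟩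

section
variable {ι : Type*} [Fintype ι] {T : E →L[ℂ] E} {b : OrthonormalBasis ι ℂ E} {lam : ι → ℝ}

theorem inner_eigenbasis_apply (hT : IsSelfAdjoint T) (hb : ∀ i, T (b i) = (lam i : ℂ) • b i)
    (x : E) (i : ι) : inner ℂ (b i) (T x) = (lam i : ℂ) * inner ℂ (b i) x := by
  rw [← isSelfAdjoint_inner_comm hT, hb, inner_smul_left]; simp

theorem energy_eq_sum (hT : IsSelfAdjoint T) (hb : ∀ i, T (b i) = (lam i : ℂ) • b i) (x : E) :
    energy T x = ∑ i, lam i * ‖inner ℂ (b i) x‖ ^ 2 := by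
  rw [energy, ← b.sum_inner_mul_inner x (T x), Complex.re_sum]
  refine Finset.sum_congr rfl fun i _ => ?_
  rw [inner_eigenbasis_apply hT hb, ← inner_conj_symm x (b i), mul_left_comm,
    mul_comm ((starRingEnd ℂ) _), Complex.mul_conj, ← Complex.ofReal_mul, Complex.ofReal_re,
    Complex.normSq_eq_norm_sq]

theorem norm_sq_eq_sum (b : OrthonormalBasis ι ℂ E) (x : E) : ‖x‖ ^ 2 = ∑ i, ‖inner ℂ (b i) x‖ ^ 2 :=
  (b.sum_sq_norm_inner_right x).symm

theorem le_energy_of_forall (hT : IsSelfAdjoint T) (hb : ∀ i, T (b i) = (lam i : ℂ) • b i) {c : ℝ}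
    {x : E} (h : ∀ i, inner ℂ (b i) x ≠ 0 → c ≤ lam i) : c * ‖x‖ ^ 2 ≤ energy T x := by
  rw [energy_eq_sum hT hb, norm_sq_eq_sum b, Finset.mul_sum]
  refine Finset.sum_le_sum fun i _ => ?_
  by_cases hi : inner ℂ (b i) x = 0
  · simp [hi]
  · gcongr; exact h i hi

end

theorem algebraMap_le_of_energy {T : E →L[ℂ] E} (hT : IsSelfAdjoint T) {c : ℝ}
    (h : ∀ x, c * ‖x‖ ^ 2 ≤ energy T x) : algebraMap ℝ _ c ≤ T := by
  rw [ContinuousLinearMap.le_def, ContinuousLinearMap.isPositive_iff_complex]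
  intro x
  have hsa : IsSelfAdjoint (T - algebraMap ℝ (E →L[ℂ] E) c) :=
    hT.sub ((IsSelfAdjoint.all c).algebraMap _)
  have h1 : (RCLike.re (inner ℂ ((T - algebraMap ℝ (E →L[ℂ] E) c) x) x) : ℝ)
      = energy T x - c * ‖x‖ ^ 2 := by
    rw [← energy_algebraMap, isSelfAdjoint_inner_comm hsa]
    simp [energy]
  refine ⟨?_, by rw [h1]; linarith [h x]⟩
  have h2 := hsa.isSymmetric.coe_re_inner_apply_self x
  simpa using h2

theorem energy_smul_vec (T : E →L[ℂ] E) (c : ℂ) (x : E) : energy T (c • x) = ‖c‖ ^ 2 * energy T x := by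
  rw [energy, map_smul, inner_smul_left, inner_smul_right, ← mul_assoc, mul_comm _ c, Complex.mul_conj,
    Complex.normSq_eq_norm_sq, Complex.re_ofReal_mul]; rfl

/-- A lowest eigenvalue with an eigenvector. -/
theorem exists_ground [Nontrivial E] {T : E →L[ℂ] E} (hT : IsSelfAdjoint T) :
    ∃ (e : ℝ) (u : E), ‖u‖ = 1 ∧ T u = (e : ℂ) • u ∧ algebraMap ℝ _ e ≤ T := by
  obtain ⟨b, lam, hb⟩ := exists_eigenbasis hT
  have : Nonempty (Fin (Module.finrank ℂ E)) := ⟨⟨0, Module.finrank_pos⟩⟩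
  obtain ⟨i, hi⟩ := Finite.exists_min lam
  exact ⟨lam i, b i, b.norm_eq_one i, hb i,
    algebraMap_le_of_energy hT fun x => le_energy_of_forall hT hb fun j _ => hi j⟩

theorem energy_eigenvector {T : E →L[ℂ] E} {u : E} {e : ℝ} (h : T u = (e : ℂ) • u) :
    energy T u = e * ‖u‖ ^ 2 := by
  rw [energy, h, inner_smul_right, Complex.re_ofReal_mul, inner_self_eq_norm_sq_to_K]
  simp [← Complex.ofReal_pow]

theorem energy_add_le {S : E →L[ℂ] E} (hS : 0 ≤ S) (u v : E) :
    energy S (u + v) ≤ 2 * energy S u + 2 * energy S v := by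
  have h := energy_mono hS (u - v)
  have h0 : energy (0 : E →L[ℂ] E) (u - v) = 0 := by simp [energy]
  have : energy S (u + v) + energy S (u - v) = 2 * energy S u + 2 * energy S v := by
    simp only [energy, map_add, map_sub, inner_add_left, inner_add_right, inner_sub_left,
      inner_sub_right, Complex.add_re, Complex.sub_re]
    ring
  linarith

/-- Let `T ≤ H` be such that `H - T` has energy at most `η` in all eigenvectors of `T` below
`E₀ + ε / 2`. Then `T` has exactly one eigenvalue below `E₀ + ε / 2`, since a combination of two
eigenvectors that is orthogonal to `Γ` would violate the gap of `H`; its eigenvector `Γ'` is close to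
`Γ`, and polynomials of `T` that are small above the gap are approximate projections onto `Γ'`. -/
theorem ground_of_le {H T : E →L[ℂ] E} (hH : IsSelfAdjoint H) (hT : IsSelfAdjoint T) (hTH : T ≤ H)
    {Γ : E} {E₀ ε η : ℝ} (hΓ1 : ‖Γ‖ = 1) (hΓ : H Γ = (E₀ : ℂ) • Γ) (hε : 0 < ε)
    (hgap : ∀ x, inner ℂ Γ x = 0 → (E₀ + ε) * ‖x‖ ^ 2 ≤ energy H x)
    (hη : ∀ (φ : E) (lam : ℝ), ‖φ‖ = 1 → T φ = (lam : ℂ) • φ → lam ≤ E₀ + ε / 2 →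
      energy (H - T) φ ≤ η)
    (hηε : 4 * η < ε) :
    ∃ (e : ℝ) (Γ' : E), ‖Γ'‖ = 1 ∧ T Γ' = (e : ℂ) • Γ' ∧
      ‖Γ - inner ℂ Γ' Γ • Γ'‖ ^ 2 ≤ η / ε ∧
      ∀ (p : ℝ[X]) (δ B : ℝ), 0 ≤ δ → p.eval e = 1 → T ≤ algebraMap ℝ _ B →
        (∀ x, e + ε / 2 ≤ x → x ≤ B → |p.eval x| ≤ δ) →
        aeval T p Γ' = Γ' ∧
        ∀ x, inner ℂ Γ' x = 0 → inner ℂ Γ' (aeval T p x) = 0 ∧ ‖aeval T p x‖ ≤ δ * ‖x‖ := by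
  obtain ⟨b, lam, hb⟩ := exists_eigenbasis hT
  have hΓ0 : Γ ≠ 0 := by rintro rfl; simp at hΓ1
  have : Nontrivial E := ⟨Γ, 0, hΓ0⟩
  have : Nonempty (Fin (Module.finrank ℂ E)) := ⟨⟨0, Module.finrank_pos⟩⟩
  obtain ⟨i₀, hi₀⟩ := Finite.exists_min lam
  have hsub : ∀ x, energy H x = energy T x + energy (H - T) x := fun x => by
    rw [← energy_add]; congr 1; abel
  have he : lam i₀ ≤ E₀ := by
    have h1 : lam i₀ * ‖Γ‖ ^ 2 ≤ energy T Γ := le_energy_of_forall hT hb fun j _ => hi₀ j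
    have h2 := energy_mono hTH Γ
    rw [energy_eigenvector hΓ] at h2
    simp only [hΓ1] at h1 h2
    linarith
  -- all the other eigenvalues of `T` are well above the lowest one
  have hother : ∀ j, j ≠ i₀ → E₀ + ε / 2 ≤ lam j := by
    intro j hj
    by_contra! hlt
    obtain ⟨c₀, c₁, hc, hperp⟩ : ∃ c₀ c₁ : ℂ, (c₀ ≠ 0 ∨ c₁ ≠ 0) ∧
        inner ℂ Γ (c₀ • b i₀ + c₁ • b j) = 0 := by
      by_cases h0 : inner ℂ Γ (b i₀) = 0
      · exact ⟨1, 0, by simp, by simp [h0]⟩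
      · exact ⟨inner ℂ Γ (b j), -inner ℂ Γ (b i₀), Or.inr (by simpa using h0), by
          rw [inner_add_right, inner_smul_right, inner_smul_right]; ring⟩
    set x := c₀ • b i₀ + c₁ • b j with hx
    have hin : ∀ i, inner ℂ (b i) x = c₀ * (if i = i₀ then 1 else 0) + c₁ * (if i = j then 1 else 0) := by
      intro i
      rw [hx, inner_add_right, inner_smul_right, inner_smul_right, b.inner_eq_ite, b.inner_eq_ite]
    have hx2 : ‖x‖ ^ 2 = ‖c₀‖ ^ 2 + ‖c₁‖ ^ 2 := by
      have h1 : inner ℂ (b i₀) (b j) = 0 := by rw [b.inner_eq_ite, if_neg hj.symm]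
      have h2 := norm_add_sq_eq_norm_sq_add_norm_sq_of_inner_eq_zero (𝕜 := ℂ) (c₀ • b i₀) (c₁ • b j)
        (by rw [inner_smul_left, inner_smul_right, h1]; simp)
      rw [← hx] at h2
      simp only [norm_smul, b.norm_eq_one, mul_one] at h2
      nlinarith
    have hxpos : 0 < ‖x‖ ^ 2 := by
      rw [hx2]
      rcases hc with h | h
      · have := norm_pos_iff.2 h; positivity
      · have := norm_pos_iff.2 h; positivity
    have hTx : energy T x ≤ (E₀ + ε / 2) * ‖x‖ ^ 2 := by
      rw [energy_eq_sum hT hb, norm_sq_eq_sum b, Finset.mul_sum]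
      refine Finset.sum_le_sum fun i _ => ?_
      by_cases h1 : i = i₀
      · gcongr; rw [h1]; linarith
      by_cases h2 : i = j
      · gcongr; rw [h2]; exact hlt.le
      · simp [hin, h1, h2]
    have hSx : energy (H - T) x ≤ 2 * η * ‖x‖ ^ 2 := by
      have h1 := energy_add_le (sub_nonneg.2 hTH) (c₀ • b i₀) (c₁ • b j)
      rw [energy_smul_vec, energy_smul_vec, ← hx] at h1
      have h2 := hη (b i₀) _ (b.norm_eq_one _) (hb _) (by linarith)
      have h3 := hη (b j) _ (b.norm_eq_one _) (hb _) hlt.le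
      rw [hx2]
      have h4 : ‖c₀‖ ^ 2 * energy (H - T) (b i₀) ≤ ‖c₀‖ ^ 2 * η := by gcongr
      have h5 : ‖c₁‖ ^ 2 * energy (H - T) (b j) ≤ ‖c₁‖ ^ 2 * η := by gcongr
      linarith
    have h6 := hgap x hperp
    rw [hsub] at h6
    nlinarith
  refine ⟨lam i₀, b i₀, b.norm_eq_one _, hb _, ?_, ?_⟩
  · -- overlap of the two ground states
    set α := inner ℂ Γ (b i₀) with hα
    set w := b i₀ - α • Γ with hw
    have hΓΓ : inner ℂ Γ Γ = (1 : ℂ) := by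
      rw [inner_self_eq_norm_sq_to_K, hΓ1]; simp
    have hbb : inner ℂ (b i₀) (b i₀) = (1 : ℂ) := by
      rw [inner_self_eq_norm_sq_to_K, b.norm_eq_one]; simp
    have hwΓ : inner ℂ Γ w = 0 := by
      rw [hw, inner_sub_right, inner_smul_right, hΓΓ, ← hα]; ring
    have hdec : b i₀ = α • Γ + w := by rw [hw]; abel
    have hn1 : ‖w‖ ^ 2 = 1 - ‖α‖ ^ 2 := by
      have h2 := norm_add_sq_eq_norm_sq_add_norm_sq_of_inner_eq_zero (𝕜 := ℂ) (α • Γ) w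
        (by rw [inner_smul_left, hwΓ]; simp)
      rw [← hdec, b.norm_eq_one, norm_smul, hΓ1] at h2
      nlinarith
    have hn2 : ‖Γ - inner ℂ (b i₀) Γ • b i₀‖ ^ 2 = 1 - ‖α‖ ^ 2 := by
      set v := Γ - inner ℂ (b i₀) Γ • b i₀ with hv
      have hv0 : inner ℂ (b i₀) v = 0 := by
        rw [hv, inner_sub_right, inner_smul_right, hbb]; ring
      have h2 := norm_add_sq_eq_norm_sq_add_norm_sq_of_inner_eq_zero (𝕜 := ℂ)
        (inner ℂ (b i₀) Γ • b i₀) v (by rw [inner_smul_left, hv0]; simp)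
      have hd : inner ℂ (b i₀) Γ • b i₀ + v = Γ := by rw [hv]; abel
      rw [hd, norm_smul, b.norm_eq_one, hΓ1, ← inner_conj_symm, ← hα, RCLike.norm_conj] at h2
      nlinarith
    have hcross : energy H (b i₀) = ‖α‖ ^ 2 * E₀ + energy H w := by
      have h1 : inner ℂ Γ (H w) = 0 := by
        rw [← isSelfAdjoint_inner_comm hH, hΓ, inner_smul_left, hwΓ, mul_zero]
      have h2 : inner ℂ w (H Γ) = 0 := by
        rw [hΓ, inner_smul_right, ← inner_conj_symm, hwΓ]; simp
      have h3 : energy H (α • Γ) = ‖α‖ ^ 2 * E₀ := by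
        rw [energy_smul_vec, energy_eigenvector hΓ, hΓ1]; ring
      rw [← h3]
      nth_rewrite 1 [hdec]
      simp only [energy, map_add, inner_add_left, inner_add_right, Complex.add_re, map_smul,
        inner_smul_left, inner_smul_right, h1, h2, mul_zero, Complex.zero_re]
      ring_nf
    have h4 := hgap w hwΓ
    have h5 := hη (b i₀) _ (b.norm_eq_one _) (hb _) (by linarith)
    have h6 := hsub (b i₀)
    rw [energy_eigenvector (hb i₀), b.norm_eq_one, hcross] at h6
    rw [hn2, ← hn1, le_div_iff₀ hε]
    have h7 : ‖α‖ ^ 2 * E₀ = E₀ - ‖w‖ ^ 2 * E₀ := by rw [hn1]; ring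
    linarith
  · intro p δ B hδ hp hTB hpδ
    have hev : ∀ i, aeval T p (b i) = ((p.eval (lam i) : ℝ) : ℂ) • b i := by
      intro i
      have hpow : ∀ k : ℕ, (T ^ k) (b i) = ((lam i ^ k : ℝ) : ℂ) • b i := by
        intro k
        induction k with
        | zero => simp
        | succ k ih =>
          rw [pow_succ]
          change (T ^ k) (T (b i)) = _
          rw [hb, map_smul, ih, smul_smul]; push_cast; ring_nf
      rw [aeval_eq_sum_range, eval_eq_sum_range, _root_.sum_apply, Complex.ofReal_sum,
        Finset.sum_smul]
      refine Finset.sum_congr rfl fun k _ => ?_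
      rw [_root_.smul_apply, hpow, Complex.ofReal_mul, mul_smul]
      exact (Complex.coe_smul _ _).symm
    have hsa : IsSelfAdjoint (aeval T p) := by
      rw [aeval_eq_sum_range]
      exact isSelfAdjoint_sum _ fun k _ => (IsSelfAdjoint.all _).smul (hT.pow k)
    have hlamB : ∀ i, lam i ≤ B := fun i => by
      have := energy_mono hTB (b i)
      rw [energy_eigenvector (hb i), energy_algebraMap, b.norm_eq_one] at this
      linarith
    refine ⟨by rw [hev, hp]; simp, fun x hx => ?_⟩
    refine ⟨by rw [inner_eigenbasis_apply hsa hev, hx, mul_zero], ?_⟩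
    have : ‖aeval T p x‖ ^ 2 ≤ (δ * ‖x‖) ^ 2 := by
      rw [mul_pow, norm_sq_eq_sum b, norm_sq_eq_sum b x, Finset.mul_sum]
      refine Finset.sum_le_sum fun i _ => ?_
      rw [inner_eigenbasis_apply hsa hev, norm_mul, mul_pow, Complex.norm_real, Real.norm_eq_abs]
      by_cases h1 : i = i₀
      · rw [h1, hx]; simp
      · gcongr
        exact hpδ _ (by linarith [hother i h1]) (hlamB i)
    exact le_of_sq_le_sq this (by positivity)

end Spectral

/-! ### Operators acting on some of the particles -/

section LocalAlgebra
variable {n d : ℕ}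

/-- Multiplication of a vector by a function of the configuration. -/
noncomputable def mulOp (G : (Fin n → Fin d) → ℂ) : SpinChain n d →L[ℂ] SpinChain n d :=
  LinearMap.toContinuousLinearMap
    { toFun := fun x => WithLp.toLp 2 fun σ => G σ * x σ
      map_add' := fun x y => by ext σ; simp [mul_add]
      map_smul' := fun c x => by ext σ; simp; ring }

/-- Substitution of the value `b` for the spin at site `j`. -/
noncomputable def substOp (j : Fin n) (b : Fin d) : SpinChain n d →L[ℂ] SpinChain n d :=
  LinearMap.toContinuousLinearMap
    { toFun := fun x => WithLp.toLp 2 fun σ => x (Function.update σ j b)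
      map_add' := fun x y => by ext σ; simp
      map_smul' := fun c x => by ext σ; simp }

@[simp] theorem mulOp_apply (G : (Fin n → Fin d) → ℂ) (x : SpinChain n d) (σ : Fin n → Fin d) :
    mulOp G x σ = G σ * x σ := rfl

@[simp] theorem substOp_apply (j : Fin n) (b : Fin d) (x : SpinChain n d) (σ : Fin n → Fin d) :
    substOp j b x σ = x (Function.update σ j b) := rfl

/-- `f` depends only on the spins at the sites in `S`. -/
def DepOn (S : Set ℕ) (f : (Fin n → Fin d) → ℂ) : Prop :=
  ∀ σ τ : Fin n → Fin d, (∀ j : Fin n, (j : ℕ) ∈ S → σ j = τ j) → f σ = f τ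

theorem DepOn.mono {S T : Set ℕ} (h : S ⊆ T) {f : (Fin n → Fin d) → ℂ} (hf : DepOn S f) :
    DepOn T f := fun σ τ hστ => hf σ τ fun j hj => hστ j (h hj)

theorem DepOn.update {S : Set ℕ} {f : (Fin n → Fin d) → ℂ} (hf : DepOn S f) {j : Fin n}
    (hj : (j : ℕ) ∉ S) (b : Fin d) (σ : Fin n → Fin d) : f (Function.update σ j b) = f σ :=
  hf _ _ fun k hk => Function.update_of_ne (by rintro rfl; exact hj hk) _ _

/-- Operators that act only on the sites in `S`, encoded as the commutant of the multiplications
by functions of the other spins and of the substitutions at the other sites. The set `S` consists of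
natural numbers, so that it can be given by inequalities; elements `≥ n` are irrelevant. -/
noncomputable def localAlg (n d : ℕ) (S : Set ℕ) :
    Subalgebra ℂ (SpinChain n d →L[ℂ] SpinChain n d) :=
  Subalgebra.centralizer ℂ
    ({T | ∃ G, DepOn Sᶜ G ∧ T = mulOp G} ∪ {T | ∃ (j : Fin n) (b : Fin d), (j : ℕ) ∉ S ∧ T = substOp j b})

theorem mem_localAlg_iff {S : Set ℕ} {L : SpinChain n d →L[ℂ] SpinChain n d} :
    L ∈ localAlg n d S ↔ (∀ G, DepOn Sᶜ G → Commute L (mulOp G)) ∧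
      ∀ (j : Fin n) (b : Fin d), (j : ℕ) ∉ S → Commute L (substOp j b) := by
  rw [localAlg, Subalgebra.mem_centralizer_iff]
  constructor
  · intro h
    exact ⟨fun G hG => (h _ (Or.inl ⟨G, hG, rfl⟩)).symm, fun j b hj => (h _ (Or.inr ⟨j, b, hj, rfl⟩)).symm⟩
  · rintro ⟨h1, h2⟩ T (⟨G, hG, rfl⟩ | ⟨j, b, hj, rfl⟩)
    · exact (h1 G hG).symm
    · exact (h2 j b hj).symm

theorem localAlg_mono {S T : Set ℕ} (h : S ⊆ T) : localAlg n d S ≤ localAlg n d T := by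
  intro L hL
  rw [mem_localAlg_iff] at hL ⊢
  exact ⟨fun G hG => hL.1 G (hG.mono (Set.compl_subset_compl.2 h)),
    fun j b hj => hL.2 j b fun hj' => hj (h hj')⟩

theorem cfc_mem_localAlg {S : Set ℕ} {A : SpinChain n d →L[ℂ] SpinChain n d}
    (hA : A ∈ localAlg n d S) (f : ℝ → ℝ) : cfc f A ∈ localAlg n d S := by
  rw [mem_localAlg_iff] at hA ⊢
  exact ⟨fun G hG => (hA.1 G hG).cfc_real f, fun j b hj => (hA.2 j b hj).cfc_real f⟩

section
variable {S : Set ℕ} {L : SpinChain n d →L[ℂ] SpinChain n d}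

theorem localAlg_apply_mulOp (hL : L ∈ localAlg n d S) {G : (Fin n → Fin d) → ℂ} (hG : DepOn Sᶜ G)
    (x : SpinChain n d) : L (mulOp G x) = mulOp G (L x) :=
  congrArg (fun T : SpinChain n d →L[ℂ] SpinChain n d => T x) ((mem_localAlg_iff.1 hL).1 G hG).eq

theorem localAlg_apply_substOp (hL : L ∈ localAlg n d S) {j : Fin n} (hj : (j : ℕ) ∉ S) (b : Fin d)
    (x : SpinChain n d) : L (substOp j b x) = substOp j b (L x) :=
  congrArg (fun T : SpinChain n d →L[ℂ] SpinChain n d => T x) ((mem_localAlg_iff.1 hL).2 j b hj).eq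

/-- Fixing the spins in `J` to their values in `σ₀`. -/
noncomputable def freeze (J : Finset (Fin n)) (σ₀ : Fin n → Fin d) (x : SpinChain n d) :
    SpinChain n d := WithLp.toLp 2 fun σ => x (J.piecewise σ₀ σ)

@[simp] theorem freeze_apply (J : Finset (Fin n)) (σ₀ : Fin n → Fin d) (x : SpinChain n d)
    (σ : Fin n → Fin d) : freeze J σ₀ x σ = x (J.piecewise σ₀ σ) := rfl

theorem freeze_insert {J : Finset (Fin n)} {j : Fin n} (hj : j ∉ J) (σ₀ : Fin n → Fin d)
    (x : SpinChain n d) : freeze (insert j J) σ₀ x = substOp j (σ₀ j) (freeze J σ₀ x) := by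
  ext σ
  rw [freeze_apply, substOp_apply, freeze_apply, Finset.piecewise_insert]
  refine congrArg x.ofLp (funext fun k => ?_)
  rcases eq_or_ne k j with rfl | hk
  · simp [hj]
  · simp [Function.update_of_ne hk, Finset.piecewise]

theorem localAlg_apply_freeze (hL : L ∈ localAlg n d S) {J : Finset (Fin n)}
    (hJ : ∀ j ∈ J, (j : ℕ) ∉ S) (σ₀ : Fin n → Fin d) (x : SpinChain n d) :
    L (freeze J σ₀ x) = freeze J σ₀ (L x) := by
  induction J using Finset.induction_on with
  | empty => simp [freeze]
  | insert j J hj ih =>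
    rw [freeze_insert hj, freeze_insert hj,
      localAlg_apply_substOp hL (hJ j (Finset.mem_insert_self _ _)),
      ih fun k hk => hJ k (Finset.mem_insert_of_mem hk)]

open Classical in
theorem depOn_of_substOp {x : SpinChain n d}
    (h : ∀ (j : Fin n) (b : Fin d), (j : ℕ) ∉ S → substOp j b x = x) : DepOn S x := by
  intro σ τ hστ
  have key : ∀ J : Finset (Fin n), (∀ j ∈ J, (j : ℕ) ∉ S) → freeze J τ x = x := by
    intro J
    induction J using Finset.induction_on with
    | empty => intro _; ext; simp
    | insert j J hj ih =>
      intro hJ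
      rw [freeze_insert hj, ih fun k hk => hJ k (Finset.mem_insert_of_mem hk),
        h j _ (hJ j (Finset.mem_insert_self _ _))]
  have h1 := congrArg (fun y : SpinChain n d => y σ)
    (key (Finset.univ.filter fun j => (j : ℕ) ∉ S) (by simp))
  rw [← h1]
  simp only [freeze_apply]
  refine congrArg x.ofLp (funext fun j => ?_)
  by_cases hj : (j : ℕ) ∈ S
  · simp [Finset.piecewise, hj, hστ j hj]
  · simp [Finset.piecewise, hj]

theorem DepOn.substOp_eq {x : SpinChain n d} (hx : DepOn S x) {j : Fin n} (hj : (j : ℕ) ∉ S)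
    (b : Fin d) : substOp j b x = x := by
  ext σ; exact hx.update hj b σ

theorem DepOn.localAlg_apply {T : Set ℕ} (hL : L ∈ localAlg n d S) (hST : S ⊆ T)
    {x : SpinChain n d} (hx : DepOn T x) : DepOn T (L x) :=
  depOn_of_substOp fun j b hj => by
    rw [← localAlg_apply_substOp hL (fun h => hj (hST h)), hx.substOp_eq hj]

end

open Classical in
/-- Operators on disjoint sets of sites commute: a basis vector is the product of functions `F` and
`G` of the spins inside and outside of `S`, and each operator acts on one of the factors only. -/
theorem localAlg_commute {S T : Set ℕ} (hST : Disjoint S T) {L M : SpinChain n d →L[ℂ] SpinChain n d}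
    (hL : L ∈ localAlg n d S) (hM : M ∈ localAlg n d T) : Commute L M := by
  replace hM := localAlg_mono (hST.subset_compl_left) hM
  suffices h : (L * M : SpinChain n d →L[ℂ] SpinChain n d).toLinearMap = (M * L).toLinearMap from
    ContinuousLinearMap.coe_injective h
  refine (EuclideanSpace.basisFun (Fin n → Fin d) ℂ).toBasis.ext fun κ => ?_
  let F : SpinChain n d := WithLp.toLp 2 fun σ => if ∀ j : Fin n, (j : ℕ) ∈ S → σ j = κ j then 1 else 0
  let G : SpinChain n d := WithLp.toLp 2 fun σ => if ∀ j : Fin n, (j : ℕ) ∉ S → σ j = κ j then 1 else 0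
  have hF : DepOn S F := by
    intro σ τ h
    have : (∀ j : Fin n, (j : ℕ) ∈ S → σ j = κ j) ↔ ∀ j : Fin n, (j : ℕ) ∈ S → τ j = κ j :=
      forall₂_congr fun j hj => by rw [h j hj]
    simp only [F, this]
  have hG : DepOn Sᶜ G := by
    intro σ τ h
    have : (∀ j : Fin n, (j : ℕ) ∉ S → σ j = κ j) ↔ ∀ j : Fin n, (j : ℕ) ∉ S → τ j = κ j :=
      forall₂_congr fun j hj => by rw [h j hj]
    simp only [G, this]
  have hκ : (EuclideanSpace.basisFun (Fin n → Fin d) ℂ).toBasis κ = mulOp G F := by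
    ext σ
    have h1 : (∀ j : Fin n, (j : ℕ) ∉ S → σ j = κ j) ∧ (∀ j : Fin n, (j : ℕ) ∈ S → σ j = κ j)
        ↔ σ = κ := by
      constructor
      · rintro ⟨ha, hb⟩
        ext1 j
        by_cases hj : (j : ℕ) ∈ S
        exacts [hb j hj, ha j hj]
      · rintro rfl; simp
    simp only [OrthonormalBasis.coe_toBasis, EuclideanSpace.basisFun_apply, mulOp_apply, F, G,
      ← ite_and, ite_mul, one_mul, zero_mul, h1]
    simp
  have comm : ∀ x y : SpinChain n d, mulOp x y = mulOp y x := fun x y => by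
    ext σ; simp [mul_comm]
  rw [hκ]
  change L (M (mulOp G F)) = M (L (mulOp G F))
  rw [localAlg_apply_mulOp hL hG, comm G F, localAlg_apply_mulOp hM (by rwa [compl_compl]),
    comm F, localAlg_apply_mulOp hL (hG.localAlg_apply hM subset_rfl), comm G,
    localAlg_apply_mulOp hM (by rw [compl_compl]; exact hF.localAlg_apply hL subset_rfl), comm]

open Classical in
/-- Eigenvectors of an operator on `S` and of operators off `S` can be combined: freezing the spins off
`S` in `u` and those in `S` in `x` leaves functions of complementary sets of spins, and their product
is the joint eigenvector. -/
theorem exists_joint_eigenvector {S : Set ℕ} {A : SpinChain n d →L[ℂ] SpinChain n d}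
    (hA : A ∈ localAlg n d S) {α : ℂ} {u x : SpinChain n d} (hu : u ≠ 0) (hAu : A u = α • u)
    (hx : x ≠ 0) :
    ∃ v : SpinChain n d, v ≠ 0 ∧ A v = α • v ∧
      ∀ C ∈ localAlg n d Sᶜ, ∀ γ : ℂ, C x = γ • x → C v = γ • v := by
  obtain ⟨σ₀, hσ₀⟩ : ∃ σ, u σ ≠ 0 := by
    by_contra! h; exact hu (by ext σ; simpa using h σ)
  obtain ⟨σ₁, hσ₁⟩ : ∃ σ, x σ ≠ 0 := by
    by_contra! h; exact hx (by ext σ; simpa using h σ)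
  set J : Finset (Fin n) := Finset.univ.filter fun j => (j : ℕ) ∉ S with hJ
  set J' : Finset (Fin n) := Finset.univ.filter fun j => (j : ℕ) ∈ S with hJ'
  set u' := freeze J σ₀ u with hu'
  set x' := freeze J' σ₁ x with hx'
  have hfs : ∀ (c : ℂ) (K : Finset (Fin n)) σ (y : SpinChain n d),
      freeze K σ (c • y) = c • freeze K σ y := fun c K σ y => by ext; simp
  have hdu : DepOn S u' := by
    intro σ τ h
    simp only [hu', freeze_apply]
    refine congrArg u.ofLp (funext fun j => ?_)
    by_cases hj : (j : ℕ) ∈ S <;> simp [Finset.piecewise, hJ, hj, h]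
  have hdx : DepOn Sᶜ x' := by
    intro σ τ h
    simp only [hx', freeze_apply]
    refine congrArg x.ofLp (funext fun j => ?_)
    by_cases hj : (j : ℕ) ∈ S <;> simp [Finset.piecewise, hJ', hj]
    exact h j hj
  have comm : ∀ x y : SpinChain n d, mulOp x y = mulOp y x := fun x y => by
    ext σ; simp [mul_comm]
  refine ⟨mulOp x' u', ?_, ?_, ?_⟩
  · intro h0
    have h1 := congrArg (fun y : SpinChain n d => y (J'.piecewise σ₀ σ₁)) h0
    simp only [mulOp_apply, hu', hx', freeze_apply, PiLp.zero_apply, mul_eq_zero] at h1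
    have e1 : J'.piecewise σ₁ (J'.piecewise σ₀ σ₁) = σ₁ := by
      ext1 j; by_cases hj : (j : ℕ) ∈ S <;> simp [Finset.piecewise, hJ', hj]
    have e2 : J.piecewise σ₀ (J'.piecewise σ₀ σ₁) = σ₀ := by
      ext1 j; by_cases hj : (j : ℕ) ∈ S <;> simp [Finset.piecewise, hJ, hJ', hj]
    rw [e1, e2] at h1
    tauto
  · rw [localAlg_apply_mulOp hA hdx, hu', localAlg_apply_freeze hA (by simp [hJ]), hAu, hfs, map_smul]
  · intro C hC γ hCx
    rw [comm, localAlg_apply_mulOp hC (by rwa [compl_compl]), hx',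
      localAlg_apply_freeze hC (by simp [hJ']), hCx, hfs, map_smul]

end LocalAlgebra

/-! ### The terms of the Hamiltonian -/

section Terms
variable {n d : ℕ}

/-- The operator of a two-site matrix `m` on the sites `i`, `i + 1`. -/
noncomputable def pairOp (i : Fin (n - 1)) (m : Matrix (Fin d × Fin d) (Fin d × Fin d) ℂ) :
    SpinChain n d →L[ℂ] SpinChain n d :=
  Matrix.toEuclideanCLM (𝕜 := ℂ) (nearestNeighborTerm i m)

/-- The left one of the sites on which the term `i` acts. -/
def siteL (i : Fin (n - 1)) : Fin n := ⟨i.val, by omega⟩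

/-- The right one of the sites on which the term `i` acts. -/
def siteR (i : Fin (n - 1)) : Fin n := ⟨i.val + 1, by omega⟩

theorem siteL_ne_siteR (i : Fin (n - 1)) : siteL i ≠ siteR i := by
  simp [siteL, siteR]

theorem pairOp_apply (i : Fin (n - 1)) (m : Matrix (Fin d × Fin d) (Fin d × Fin d) ℂ)
    (x : SpinChain n d) (σ : Fin n → Fin d) :
    pairOp i m x σ = ∑ b : Fin d × Fin d, m (σ (siteL i), σ (siteR i)) b *
      x (Function.update (Function.update σ (siteL i) b.1) (siteR i) b.2) := by
  have h0 : pairOp i m x σ = ∑ τ, nearestNeighborTerm i m σ τ * x τ := rfl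
  rw [h0]
  have hne := siteL_ne_siteR i
  symm
  refine Finset.sum_of_injOn
    (fun b : Fin d × Fin d => Function.update (Function.update σ (siteL i) b.1) (siteR i) b.2)
    ?_ (by simp) ?_ ?_
  · rintro ⟨b, b'⟩ _ ⟨c, c'⟩ _ hbc
    have h1 := congrFun hbc (siteL i)
    have h2 := congrFun hbc (siteR i)
    simp [hne] at h1 h2
    simp [h1, h2]
  · intro τ _ hτ
    simp only [nearestNeighborTerm, Matrix.of_apply]
    rw [if_neg, zero_mul]
    intro hag
    apply hτ
    refine ⟨(τ (siteL i), τ (siteR i)), by simp, ?_⟩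
    ext1 j
    by_cases hR : j = siteR i
    · subst hR; simp
    by_cases hL : j = siteL i
    · subst hL; simp [hne]
    · simp only [Function.update_of_ne hR, Function.update_of_ne hL]
      exact hag j (fun h => hL (Fin.ext h)) (fun h => hR (Fin.ext h))
  · rintro ⟨b, b'⟩ _
    simp only [nearestNeighborTerm, Matrix.of_apply]
    rw [if_pos]
    · congr 2
      change (b, b') = (Function.update (Function.update σ (siteL i) b) (siteR i) b' (siteL i),
        Function.update (Function.update σ (siteL i) b) (siteR i) b' (siteR i))
      simp [hne]
    · intro j hj1 hj2
      have hR : j ≠ siteR i := fun h => hj2 (by rw [h]; rfl)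
      have hL : j ≠ siteL i := fun h => hj1 (by rw [h]; rfl)
      simp only [Function.update_of_ne hR, Function.update_of_ne hL]

theorem pairOp_one (i : Fin (n - 1)) : pairOp (d := d) i 1 = 1 := by
  ext x σ
  rw [pairOp_apply, Finset.sum_eq_single (σ (siteL i), σ (siteR i))]
  · simp
  · intro b _ hb; rw [Matrix.one_apply_ne hb.symm, zero_mul]
  · simp

theorem pairOp_mul (i : Fin (n - 1)) (a b : Matrix (Fin d × Fin d) (Fin d × Fin d) ℂ) :
    pairOp i (a * b) = pairOp i a * pairOp i b := by
  ext x σ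
  have hne := siteL_ne_siteR i
  change _ = pairOp i a (pairOp i b x) σ
  simp only [pairOp_apply, Matrix.mul_apply, Finset.sum_mul, Finset.mul_sum]
  rw [Finset.sum_comm]
  refine Finset.sum_congr rfl fun c _ => Finset.sum_congr rfl fun e _ => ?_
  have hτ : Function.update (Function.update (Function.update (Function.update σ (siteL i) c.1)
      (siteR i) c.2) (siteL i) e.1) (siteR i) e.2
      = Function.update (Function.update σ (siteL i) e.1) (siteR i) e.2 := by
    ext1 j
    by_cases hR : j = siteR i
    · subst hR; simp
    by_cases hL : j = siteL i
    · subst hL; simp [hne]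
    · simp only [Function.update_of_ne hR, Function.update_of_ne hL]
  simp only [Function.update_self, Function.update_of_ne hne, mul_assoc, hτ]

theorem pairOp_star (i : Fin (n - 1)) (a : Matrix (Fin d × Fin d) (Fin d × Fin d) ℂ) :
    pairOp i aᴴ = star (pairOp i a) := by
  rw [pairOp, pairOp, ← map_star]
  congr 1
  ext σ τ
  rw [Matrix.star_apply]
  simp only [nearestNeighborTerm, Matrix.of_apply, Matrix.conjTranspose_apply]
  have : (∀ j : Fin n, j.val ≠ i.val → j.val ≠ i.val + 1 → σ j = τ j) ↔
      (∀ j : Fin n, j.val ≠ i.val → j.val ≠ i.val + 1 → τ j = σ j) :=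
    ⟨fun h j h1 h2 => (h j h1 h2).symm, fun h j h1 h2 => (h j h1 h2).symm⟩
  simp only [this]
  split_ifs <;> simp

open scoped MatrixOrder Matrix.Norms.L2Operator in
theorem pairOp_nonneg (i : Fin (n - 1)) {a : Matrix (Fin d × Fin d) (Fin d × Fin d) ℂ}
    (ha : a.PosSemidef) : 0 ≤ pairOp i a := by
  obtain ⟨b, rfl⟩ := CStarAlgebra.nonneg_iff_eq_star_mul_self.mp ha.nonneg
  rw [Matrix.star_eq_conjTranspose, pairOp_mul, pairOp_star]
  exact star_mul_self_nonneg _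

theorem pairOp_sub (i : Fin (n - 1)) (a b : Matrix (Fin d × Fin d) (Fin d × Fin d) ℂ) :
    pairOp i (a - b) = pairOp i a - pairOp i b := by
  ext x σ
  change _ = pairOp i a x σ - pairOp i b x σ
  simp only [pairOp_apply, Matrix.sub_apply, sub_mul, Finset.sum_sub_distrib]

theorem mulOp_mem_localAlg {S : Set ℕ} {g : (Fin n → Fin d) → ℂ} (hg : DepOn S g) :
    mulOp g ∈ localAlg n d S := by
  rw [mem_localAlg_iff]
  refine ⟨fun G _ => ?_, fun j b hj => ?_⟩
  · ext x σ
    change g σ * (G σ * x σ) = G σ * (g σ * x σ)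
    ring
  · ext x σ
    change g σ * x (Function.update σ j b) = g (Function.update σ j b) * x (Function.update σ j b)
    rw [hg.update hj]

theorem substOp_mem_localAlg {S : Set ℕ} {j : Fin n} (hj : (j : ℕ) ∈ S) (b : Fin d) :
    substOp j b ∈ localAlg n d S := by
  rw [mem_localAlg_iff]
  refine ⟨fun G hG => ?_, fun k c hk => ?_⟩
  · ext x σ
    change G (Function.update σ j b) * x (Function.update σ j b) = G σ * x (Function.update σ j b)
    rw [hG.update (by simpa using hj)]
  · ext x σ
    have : k ≠ j := by rintro rfl; exact hk hj
    change x (Function.update (Function.update σ j b) k c)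
      = x (Function.update (Function.update σ k c) j b)
    rw [Function.update_comm this]

/-- The matrix unit `|a⟩⟨b|` at site `j`. -/
noncomputable def unitOp (j : Fin n) (a b : Fin d) : SpinChain n d →L[ℂ] SpinChain n d :=
  mulOp (fun σ => if σ j = a then 1 else 0) * substOp j b

/-- The operator at the site `i + 1` whose matrix is the block of `m` with the entries `a`, `b` of the
particle `i`. -/
noncomputable def blockOp (i : Fin (n - 1)) (m : Matrix (Fin d × Fin d) (Fin d × Fin d) ℂ)
    (a b : Fin d) : SpinChain n d →L[ℂ] SpinChain n d :=
  ∑ b' : Fin d, mulOp (fun σ => m (a, σ (siteR i)) (b, b')) * substOp (siteR i) b'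

theorem unitOp_mem_localAlg {S : Set ℕ} {j : Fin n} (hj : (j : ℕ) ∈ S) (a b : Fin d) :
    unitOp j a b ∈ localAlg n d S :=
  mul_mem (mulOp_mem_localAlg fun σ τ h => by simp only [h j hj]) (substOp_mem_localAlg hj b)

theorem blockOp_mem_localAlg {S : Set ℕ} {i : Fin (n - 1)} (hi : (i : ℕ) + 1 ∈ S)
    (m : Matrix (Fin d × Fin d) (Fin d × Fin d) ℂ) (a b : Fin d) :
    blockOp i m a b ∈ localAlg n d S :=
  sum_mem fun b' _ => mul_mem (mulOp_mem_localAlg fun σ τ h => by simp only [h (siteR i) hi])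
    (substOp_mem_localAlg hi b')

theorem pairOp_eq_sum (i : Fin (n - 1)) (m : Matrix (Fin d × Fin d) (Fin d × Fin d) ℂ) :
    pairOp i m = ∑ ab : Fin d × Fin d, unitOp (siteL i) ab.1 ab.2 * blockOp i m ab.1 ab.2 := by
  ext x σ
  have hne := siteL_ne_siteR i
  have h1 : ∀ a b : Fin d, (unitOp (siteL i) a b * blockOp i m a b) x σ
      = if σ (siteL i) = a then ∑ b', m (a, σ (siteR i)) (b, b') *
          x (Function.update (Function.update σ (siteL i) b) (siteR i) b') else 0 := by
    intro a b
    change (if σ (siteL i) = a then (1 : ℂ) else 0) * (blockOp i m a b x)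
      (Function.update σ (siteL i) b) = _
    rw [ite_mul, one_mul, zero_mul]
    congr 1
    rw [blockOp, sum_apply, WithLp.ofLp_sum, Finset.sum_apply]
    refine Finset.sum_congr rfl fun b' _ => ?_
    change m (a, (Function.update σ (siteL i) b) (siteR i)) (b, b') * _ = _
    rw [Function.update_of_ne hne.symm]; rfl
  rw [sum_apply, WithLp.ofLp_sum, Finset.sum_apply, pairOp_apply]
  simp only [h1]
  rw [Fintype.sum_prod_type, Fintype.sum_prod_type, eq_comm, Finset.sum_eq_single (σ (siteL i))]
  · simp
  · intro a _ ha
    simp [ha.symm]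
  · simp

theorem pairOp_mem_localAlg {S : Set ℕ} {i : Fin (n - 1)} (hi : (i : ℕ) ∈ S) (hi' : (i : ℕ) + 1 ∈ S)
    (m : Matrix (Fin d × Fin d) (Fin d × Fin d) ℂ) : pairOp i m ∈ localAlg n d S := by
  rw [pairOp_eq_sum]
  exact sum_mem fun ab _ => mul_mem (unitOp_mem_localAlg (j := siteL i) hi _ _) (blockOp_mem_localAlg hi' _ _ _)

/-- The term of the Hamiltonian which acts on the sites `i`, `i + 1`. It is zero for `i ≥ n - 1`, so
that windows of terms may extend over the end of the chain. -/
noncomputable def chainTerm (h : Fin (n - 1) → Matrix (Fin d × Fin d) (Fin d × Fin d) ℂ) (i : ℕ) :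
    SpinChain n d →L[ℂ] SpinChain n d :=
  if hi : i < n - 1 then pairOp ⟨i, hi⟩ (h ⟨i, hi⟩) else 0

variable {h : Fin (n - 1) → Matrix (Fin d × Fin d) (Fin d × Fin d) ℂ}

theorem chainTerm_mem_localAlg {S : Set ℕ} {i : ℕ} (hi : i ∈ S) (hi' : i + 1 ∈ S) :
    chainTerm h i ∈ localAlg n d S := by
  rw [chainTerm]
  split_ifs with h1
  · exact pairOp_mem_localAlg hi hi' _
  · exact zero_mem _

theorem chainTerm_nonneg (hh : ∀ i, (h i).PosSemidef ∧ (1 - h i).PosSemidef) (i : ℕ) :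
    0 ≤ chainTerm h i := by
  rw [chainTerm]
  split_ifs with h1
  · exact pairOp_nonneg _ (hh _).1
  · exact le_rfl

theorem chainTerm_le_one (hh : ∀ i, (h i).PosSemidef ∧ (1 - h i).PosSemidef) (i : ℕ) :
    chainTerm h i ≤ 1 := by
  rw [chainTerm]
  split_ifs with h1
  · rw [← pairOp_one ⟨i, h1⟩, ← sub_nonneg, ← pairOp_sub]
    exact pairOp_nonneg _ (hh _).2
  · exact zero_le_one

theorem norm_chainTerm_le (hh : ∀ i, (h i).PosSemidef ∧ (1 - h i).PosSemidef) (i : ℕ) :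
    ‖chainTerm h i‖ ≤ 1 :=
  (CStarAlgebra.norm_le_one_iff_of_nonneg _ (chainTerm_nonneg hh i)).2 (chainTerm_le_one hh i)

theorem chainHamiltonian_eq (h : Fin (n - 1) → Matrix (Fin d × Fin d) (Fin d × Fin d) ℂ) :
    chainHamiltonian h = (∑ i ∈ Finset.range (n - 1), chainTerm h i).toLinearMap := by
  have h1 : ∑ i ∈ Finset.range (n - 1), chainTerm h i
      = Matrix.toEuclideanCLM (𝕜 := ℂ) (∑ i : Fin (n - 1), nearestNeighborTerm i (h i)) := by
    rw [map_sum, Finset.sum_range]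
    refine Finset.sum_congr rfl fun i _ => ?_
    rw [chainTerm, dif_pos i.2]; rfl
  rw [h1, chainHamiltonian]; rfl

theorem adCLM_sum {ι : Type*} (I : Finset ι) {𝔸 : Type*} [NormedRing 𝔸] [NormedAlgebra ℂ 𝔸]
    (f : ι → 𝔸) (x : 𝔸) :
    adCLM (∑ i ∈ I, f i) x = ∑ i ∈ I, adCLM (f i) x := by
  simp [adCLM_apply, Finset.sum_mul, Finset.mul_sum]

/-- Iterated commutators of a chain Hamiltonian with one term: the `k`-th one is supported on the sites
at distance at most `k`, so that only `2 k + 3` terms contribute to the next one. -/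
theorem norm_iterate_ad_le (hh : ∀ i, (h i).PosSemidef ∧ (1 - h i).PosSemidef) (I : Finset ℕ)
    (m k : ℕ) :
    ‖(adCLM (∑ i ∈ I, chainTerm h i))^[k] (chainTerm h m)‖ ≤ 6 ^ k * k.factorial := by
  suffices H : (adCLM (∑ i ∈ I, chainTerm h i))^[k] (chainTerm h m)
      ∈ localAlg n d {j | m ≤ j + k ∧ j ≤ m + 1 + k} ∧
      ‖(adCLM (∑ i ∈ I, chainTerm h i))^[k] (chainTerm h m)‖ ≤ 6 ^ k * k.factorial from H.2
  induction k with
  | zero =>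
    refine ⟨chainTerm_mem_localAlg ?_ ?_, ?_⟩
    · simp
    · simp
    · simpa using norm_chainTerm_le hh m
  | succ k ih =>
    rw [Function.iterate_succ_apply']
    set X := (adCLM (∑ i ∈ I, chainTerm h i))^[k] (chainTerm h m)
    obtain ⟨hX, hXn⟩ := ih
    have h1 : adCLM (∑ i ∈ I, chainTerm h i) X
        = ∑ i ∈ I.filter (fun i => m ≤ i + 1 + k ∧ i ≤ m + 1 + k), adCLM (chainTerm h i) X := by
      rw [adCLM_sum, Finset.sum_filter]
      refine Finset.sum_congr rfl fun i _ => ?_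
      split_ifs with hi
      · rfl
      · have hc : Commute (chainTerm h i) X := by
          refine localAlg_commute (S := {i, i + 1}) ?_
            (chainTerm_mem_localAlg (by simp) (by simp)) hX
          rw [Set.disjoint_left]
          rintro j (rfl | rfl) ⟨h2, h3⟩
          · exact hi ⟨by omega, by omega⟩
          · exact hi ⟨by omega, by omega⟩
        rw [adCLM_apply, hc.eq, sub_self]
    have hcard : (I.filter (fun i => m ≤ i + 1 + k ∧ i ≤ m + 1 + k)).card ≤ 2 * k + 3 := by
      have : I.filter (fun i => m ≤ i + 1 + k ∧ i ≤ m + 1 + k) ⊆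
          Finset.Icc (m - 1 - k) (m + 1 + k) := by
        intro i; simp only [Finset.mem_filter, Finset.mem_Icc]; omega
      refine (Finset.card_le_card this).trans ?_
      rw [Nat.card_Icc]; omega
    rw [h1]
    constructor
    · refine sum_mem fun i hi => ?_
      rw [Finset.mem_filter] at hi
      have hX' : X ∈ localAlg n d {j | m ≤ j + (k + 1) ∧ j ≤ m + 1 + (k + 1)} :=
        localAlg_mono (fun j hj => by
          rw [Set.mem_ofPred] at hj ⊢; omega) hX
      have hi' : chainTerm h i ∈ localAlg n d {j | m ≤ j + (k + 1) ∧ j ≤ m + 1 + (k + 1)} :=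
        chainTerm_mem_localAlg (Set.mem_ofPred.2 (by omega)) (Set.mem_ofPred.2 (by omega))
      rw [adCLM_apply]
      exact sub_mem (mul_mem hi' hX') (mul_mem hX' hi')
    · calc ‖∑ i ∈ I.filter (fun i => m ≤ i + 1 + k ∧ i ≤ m + 1 + k), adCLM (chainTerm h i) X‖
          ≤ ∑ i ∈ I.filter (fun i => m ≤ i + 1 + k ∧ i ≤ m + 1 + k), 2 * ‖X‖ := by
            refine norm_sum_le_of_le _ fun i _ => ?_
            rw [adCLM_apply]
            have := norm_chainTerm_le hh i
            have a1 := norm_mul_le (chainTerm h i) X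
            have a2 := norm_mul_le X (chainTerm h i)
            have a3 := norm_sub_le (chainTerm h i * X) (X * chainTerm h i)
            nlinarith [norm_nonneg X]
        _ ≤ (2 * k + 3 : ℕ) * (2 * ‖X‖) := by
            rw [Finset.sum_const, nsmul_eq_mul]; gcongr
        _ ≤ (3 * (k + 1) : ℕ) * (2 * (6 ^ k * k.factorial)) := by
            gcongr; omega
        _ = 6 ^ (k + 1) * (k + 1).factorial := by
            rw [Nat.factorial_succ]; push_cast; ring

/-- The constant `1 / 12` comes from `norm_iterate_ad_le`, as `6 * (1 / 12) = 1 / 2`; the shift by `e`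
is irrelevant for commutators. -/
theorem norm_exp_conj_chainTerm_le (hh : ∀ i, (h i).PosSemidef ∧ (1 - h i).PosSemidef)
    (I : Finset ℕ) (m : ℕ) (e : ℝ) :
    ‖NormedSpace.exp (((1 / 12 : ℝ) : ℂ) • (∑ i ∈ I, chainTerm h i - algebraMap ℝ _ e)) * chainTerm h m *
      NormedSpace.exp (-(((1 / 12 : ℝ) : ℂ) • (∑ i ∈ I, chainTerm h i - algebraMap ℝ _ e)))‖ ≤ 2 := by
  refine norm_exp_conj_le (c := 6) (by norm_num) (by norm_num) (by norm_num) fun k => ?_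
  have : adCLM (∑ i ∈ I, chainTerm h i - algebraMap ℝ _ e) = adCLM (∑ i ∈ I, chainTerm h i) := by
    ext1 x
    rw [adCLM_apply, adCLM_apply, sub_mul, mul_sub, (Algebra.commutes e x)]
    abel
  rw [this]
  exact norm_iterate_ad_le hh I m k

end Terms

/-! ### Schmidt ranks -/

section Schmidt
variable {n d : ℕ}

/-- `x` has Schmidt rank at most `N` across the cut between the sites `< c` and the sites `≥ c`. -/
def SchmidtLE (c N : ℕ) (x : SpinChain n d) : Prop :=
  ∃ F G : Fin N → (Fin n → Fin d) → ℂ, (∀ i, DepOn (Set.Iio c) (F i)) ∧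
    (∀ i, DepOn (Set.Ici c) (G i)) ∧ ∀ σ, x σ = ∑ i, F i σ * G i σ

theorem DepOn.const (S : Set ℕ) (a : ℂ) : DepOn S (fun _ : Fin n → Fin d => a) := fun _ _ _ => rfl

theorem DepOn.mul {S : Set ℕ} {f g : (Fin n → Fin d) → ℂ} (hf : DepOn S f) (hg : DepOn S g) :
    DepOn S (fun σ => f σ * g σ) := fun σ τ h => by simp only [hf σ τ h, hg σ τ h]

theorem DepOn.sum {ι : Type*} {s : Finset ι} {S : Set ℕ} {f : ι → (Fin n → Fin d) → ℂ}
    (hf : ∀ i ∈ s, DepOn S (f i)) : DepOn S (fun σ => ∑ i ∈ s, f i σ) := fun σ τ h =>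
  Finset.sum_congr rfl fun i hi => hf i hi σ τ h

theorem SchmidtLE.of_sum {c N : ℕ} {ι : Type*} [Fintype ι] (hN : Fintype.card ι ≤ N)
    {x : SpinChain n d} (F G : ι → (Fin n → Fin d) → ℂ) (hF : ∀ i, DepOn (Set.Iio c) (F i))
    (hG : ∀ i, DepOn (Set.Ici c) (G i)) (hx : ∀ σ, x σ = ∑ i, F i σ * G i σ) : SchmidtLE c N x := by
  classical
  let e : ι ↪ Fin N := (Fintype.equivFin ι).toEmbedding.trans (Fin.castLEEmb hN)
  refine ⟨Function.extend e F 0, Function.extend e G 0, ?_, ?_, ?_⟩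
  · intro i
    by_cases hi : ∃ k, e k = i
    · obtain ⟨k, rfl⟩ := hi; rw [e.injective.extend_apply]; exact hF k
    · rw [Function.extend_apply' _ _ _ hi]; exact DepOn.const _ 0
  · intro i
    by_cases hi : ∃ k, e k = i
    · obtain ⟨k, rfl⟩ := hi; rw [e.injective.extend_apply]; exact hG k
    · rw [Function.extend_apply' _ _ _ hi]; exact DepOn.const _ 0
  · intro σ
    rw [hx]
    refine Finset.sum_of_injOn e e.injective.injOn (by simp) ?_ ?_
    · intro i _ hi
      have hi' : ¬ ∃ k, e k = i := by simpa using hi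
      rw [Function.extend_apply' _ _ _ hi']; simp
    · intro k _
      rw [e.injective.extend_apply, e.injective.extend_apply]

theorem SchmidtLE.mono {c N M : ℕ} (h : N ≤ M) {x : SpinChain n d} (hx : SchmidtLE c N x) :
    SchmidtLE c M x := by
  obtain ⟨F, G, hF, hG, hFG⟩ := hx
  exact SchmidtLE.of_sum (by simpa using h) F G hF hG hFG

theorem SchmidtLE.sum {c N : ℕ} {ι : Type*} (s : Finset ι) {x : ι → SpinChain n d}
    (hx : ∀ i ∈ s, SchmidtLE c N (x i)) : SchmidtLE c (s.card * N) (∑ i ∈ s, x i) := by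
  classical
  choose! F G hF hG hFG using hx
  refine SchmidtLE.of_sum (ι := s × Fin N) (by simp) (fun p => F p.1 p.2) (fun p => G p.1 p.2)
    (fun p => hF _ p.1.2 _) (fun p => hG _ p.1.2 _) fun σ => ?_
  rw [Fintype.sum_prod_type, WithLp.ofLp_sum, Finset.sum_apply, ← Finset.sum_coe_sort]
  exact Finset.sum_congr rfl fun i _ => hFG i i.2 σ

theorem SchmidtLE.smul {c N : ℕ} (a : ℂ) {x : SpinChain n d} (hx : SchmidtLE c N x) :
    SchmidtLE c N (a • x) := by
  obtain ⟨F, G, hF, hG, hFG⟩ := hx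
  refine ⟨fun i σ => a * F i σ, G, fun i => (DepOn.const _ a).mul (hF i), hG, fun σ => ?_⟩
  change a * x σ = _
  rw [hFG, Finset.mul_sum]
  exact Finset.sum_congr rfl fun i _ => by ring

theorem eq_sum_mulOp {N : ℕ} {x : SpinChain n d} {F G : Fin N → (Fin n → Fin d) → ℂ}
    (h : ∀ σ, x σ = ∑ i, F i σ * G i σ) : x = ∑ i, mulOp (F i) (WithLp.toLp 2 (G i)) := by
  ext σ
  rw [h, WithLp.ofLp_sum, Finset.sum_apply]
  rfl

/-- Operators on either side of the cut do not increase the Schmidt rank. -/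
theorem SchmidtLE.apply_left {c N : ℕ} {x : SpinChain n d} (hx : SchmidtLE c N x)
    {L : SpinChain n d →L[ℂ] SpinChain n d} (hL : L ∈ localAlg n d (Set.Iio c)) :
    SchmidtLE c N (L x) := by
  obtain ⟨F, G, hF, hG, hFG⟩ := hx
  refine ⟨fun i => L (WithLp.toLp 2 (F i)), G, fun i => DepOn.localAlg_apply hL subset_rfl (hF i), hG,
    fun σ => ?_⟩
  have h1 : x = ∑ i, mulOp (G i) (WithLp.toLp 2 (F i)) :=
    eq_sum_mulOp fun σ => by rw [hFG]; exact Finset.sum_congr rfl fun i _ => mul_comm _ _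
  rw [h1, map_sum, WithLp.ofLp_sum, Finset.sum_apply]
  refine Finset.sum_congr rfl fun i _ => ?_
  rw [localAlg_apply_mulOp hL (by rw [Set.compl_Iio]; exact hG i), mulOp_apply, mul_comm]

theorem SchmidtLE.apply_right {c N : ℕ} {x : SpinChain n d} (hx : SchmidtLE c N x)
    {R : SpinChain n d →L[ℂ] SpinChain n d} (hR : R ∈ localAlg n d (Set.Ici c)) :
    SchmidtLE c N (R x) := by
  obtain ⟨F, G, hF, hG, hFG⟩ := hx
  refine ⟨F, fun i => R (WithLp.toLp 2 (G i)), hF, fun i => DepOn.localAlg_apply hR subset_rfl (hG i),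
    fun σ => ?_⟩
  rw [eq_sum_mulOp hFG, map_sum, WithLp.ofLp_sum, Finset.sum_apply]
  refine Finset.sum_congr rfl fun i _ => ?_
  rw [localAlg_apply_mulOp hR (by rw [Set.compl_Ici]; exact hF i), mulOp_apply]

theorem SchmidtLE.succ {c N : ℕ} (hd : 0 < d) {x : SpinChain n d} (hx : SchmidtLE c N x) :
    SchmidtLE (c + 1) (N * d) x := by
  obtain ⟨F, G, hF, hG, hFG⟩ := hx
  by_cases hc : c < n
  · set j : Fin n := ⟨c, hc⟩
    refine SchmidtLE.of_sum (ι := Fin N × Fin d) (by simp)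
      (fun p σ => F p.1 σ * if σ j = p.2 then 1 else 0)
      (fun p σ => G p.1 (Function.update σ j p.2)) (fun p => ?_) (fun p => ?_) fun σ => ?_
    · refine ((hF p.1).mono fun k hk => ?_).mul fun σ τ h => ?_
      · exact Nat.lt_succ_of_lt hk
      · simp only [h j (Nat.lt_succ_self c)]
    · intro σ τ h
      refine hG p.1 _ _ fun k hk => ?_
      rcases eq_or_ne k j with rfl | hkj
      · simp
      · rw [Function.update_of_ne hkj, Function.update_of_ne hkj]
        refine h k ?_
        have : (k : ℕ) ≠ c := fun h => hkj (Fin.ext h)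
        exact Nat.succ_le_of_lt (lt_of_le_of_ne hk this.symm)
    · rw [hFG, Fintype.sum_prod_type]
      refine Finset.sum_congr rfl fun i _ => ?_
      rw [Finset.sum_eq_single (σ j)]
      · simp
      · intro b _ hb; simp [hb.symm]
      · simp
  · refine SchmidtLE.mono (Nat.le_mul_of_pos_right N hd) ⟨F, G, fun i => ?_, fun i => ?_, hFG⟩
    · exact (hF i).mono fun k hk => Nat.lt_succ_of_lt hk
    · exact fun σ τ h => hG i _ _ fun k hk => absurd (lt_of_le_of_lt hk k.2) hc

theorem SchmidtLE.pred {c N : ℕ} (hd : 0 < d) {x : SpinChain n d} (hx : SchmidtLE (c + 1) N x) :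
    SchmidtLE c (N * d) x := by
  obtain ⟨F, G, hF, hG, hFG⟩ := hx
  by_cases hc : c < n
  · set j : Fin n := ⟨c, hc⟩
    refine SchmidtLE.of_sum (ι := Fin N × Fin d) (by simp)
      (fun p σ => F p.1 (Function.update σ j p.2))
      (fun p σ => (if σ j = p.2 then 1 else 0) * G p.1 σ) (fun p => ?_) (fun p => ?_) fun σ => ?_
    · intro σ τ h
      refine hF p.1 _ _ fun k hk => ?_
      rcases eq_or_ne k j with rfl | hkj
      · simp
      · rw [Function.update_of_ne hkj, Function.update_of_ne hkj]
        refine h k ?_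
        have : (k : ℕ) ≠ c := fun h => hkj (Fin.ext h)
        exact lt_of_le_of_ne (Nat.le_of_lt_succ hk) this
    · refine DepOn.mul (fun σ τ h => ?_) ((hG p.1).mono fun k hk => ?_)
      · simp only [h j (le_refl c)]
      · exact le_trans (Nat.le_succ c) hk
    · rw [hFG, Fintype.sum_prod_type]
      refine Finset.sum_congr rfl fun i _ => ?_
      rw [Finset.sum_eq_single (σ j)]
      · simp
      · intro b _ hb; simp [hb.symm]
      · simp
  · refine SchmidtLE.mono (Nat.le_mul_of_pos_right N hd) ⟨F, G, fun i => ?_, fun i => ?_, hFG⟩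
    · exact fun σ τ h => hF i _ _ fun k _ => h k (lt_of_lt_of_le k.2 (not_lt.1 hc))
    · exact (hG i).mono fun k hk => le_trans (Nat.le_succ c) hk

theorem SchmidtLE.add_cut {c N : ℕ} (hd : 0 < d) {x : SpinChain n d} (hx : SchmidtLE c N x) (q : ℕ) :
    SchmidtLE (c + q) (N * d ^ q) x := by
  induction q with
  | zero => simpa using hx
  | succ q ih => rw [pow_succ, ← mul_assoc]; exact ih.succ hd

theorem SchmidtLE.sub_cut {c N : ℕ} (hd : 0 < d) {x : SpinChain n d} (q : ℕ)
    (hx : SchmidtLE (c + q) N x) : SchmidtLE c (N * d ^ q) x := by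
  induction q generalizing N with
  | zero => simpa using hx
  | succ q ih =>
    have := ih (SchmidtLE.pred hd hx)
    rwa [mul_assoc, ← pow_succ'] at this

theorem schmidtLE_zero_one (x : SpinChain n d) : SchmidtLE 0 1 x :=
  ⟨fun _ _ => 1, fun _ => x, fun _ => DepOn.const _ 1,
    fun _ σ τ h => congrArg x (funext fun j => h j (Nat.zero_le _)), fun σ => by simp⟩

theorem schmidtLE_one_of_le {c : ℕ} (hc : n ≤ c) (x : SpinChain n d) : SchmidtLE c 1 x :=
  ⟨fun _ => x, fun _ _ => 1,
    fun _ σ τ h => congrArg x (funext fun j => h j (lt_of_lt_of_le j.2 hc)),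
    fun _ => DepOn.const _ 1, fun σ => by simp⟩

theorem schmidtLE_pow (hd : 0 < d) (c : ℕ) (x : SpinChain n d) : SchmidtLE c (d ^ c) x := by
  simpa using (schmidtLE_zero_one x).add_cut hd c

open Classical in
/-- Functions of the two sides of a cut are independent under the uniform measure. -/
theorem sum_mul_card_eq {c : ℕ} {f g : (Fin n → Fin d) → ℂ} (hf : DepOn (Set.Iio c) f)
    (hg : DepOn (Set.Ici c) g) :
    (∑ σ, f σ * g σ) * Fintype.card (Fin n → Fin d) = (∑ σ, f σ) * ∑ σ, g σ := by
  let m : (Fin n → Fin d) → (Fin n → Fin d) → (Fin n → Fin d) := fun σ τ j =>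
    if (j : ℕ) < c then σ j else τ j
  -- exchanging the right halves of two configurations is an involution
  let e : ((Fin n → Fin d) × (Fin n → Fin d)) ≃ ((Fin n → Fin d) × (Fin n → Fin d)) :=
    { toFun := fun p => (m p.1 p.2, m p.2 p.1)
      invFun := fun p => (m p.1 p.2, m p.2 p.1)
      left_inv := fun p => by
        ext j <;> by_cases hj : (j : ℕ) < c <;> simp [m, hj]
      right_inv := fun p => by
        ext j <;> by_cases hj : (j : ℕ) < c <;> simp [m, hj] }
  rw [Finset.sum_mul_sum, ← Fintype.sum_prod_type' (f := fun σ τ => f σ * g τ), ← e.sum_comp]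
  have h1 : ∀ p : (Fin n → Fin d) × (Fin n → Fin d), f (e p).1 * g (e p).2 = f p.1 * g p.1 := by
    intro p
    congr 1
    · exact hf _ _ fun j hj => if_pos hj
    · exact hg _ _ fun j hj => if_neg (not_lt.2 hj)
  simp only [h1]
  rw [Fintype.sum_prod_type]
  rw [Finset.sum_mul]
  exact Finset.sum_congr rfl fun σ _ => by
    dsimp only; rw [Finset.sum_const, Finset.card_univ, nsmul_eq_mul, mul_comm]

open Classical in
/-- Decomposition of a vector of Schmidt rank `N` into at most `N` mutually orthogonal product
vectors, from an orthonormal basis of the span of the left factors. -/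
theorem SchmidtLE.exists_orthogonal {c N : ℕ} {x : SpinChain n d} (hx : SchmidtLE c N x) :
    ∃ (m : ℕ) (φ : Fin m → SpinChain n d), m ≤ N ∧ (∀ i, SchmidtLE c 1 (φ i)) ∧ x = ∑ i, φ i ∧
      ∑ i, ‖φ i‖ ^ 2 = ‖x‖ ^ 2 := by
  obtain ⟨F, G, hF, hG, hFG⟩ := hx
  set V : Submodule ℂ (SpinChain n d) :=
    Submodule.span ℂ (Set.range fun i => (WithLp.toLp 2 (F i) : SpinChain n d)) with hV
  set b := stdOrthonormalBasis ℂ V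
  have hVdep : ∀ v ∈ V, DepOn (Set.Iio c) v := by
    intro v hv
    induction hv using Submodule.span_induction with
    | mem v hv => obtain ⟨i, rfl⟩ := hv; exact hF i
    | zero => exact DepOn.const _ 0
    | add v w _ _ hv hw => exact fun σ τ h => congrArg₂ (· + ·) (hv σ τ h) (hw σ τ h)
    | smul a v _ hv => exact fun σ τ h => congrArg (a * ·) (hv σ τ h)
  have hmem : ∀ i, (WithLp.toLp 2 (F i) : SpinChain n d) ∈ V := fun i =>
    Submodule.subset_span ⟨i, rfl⟩
  let G' : Fin (Module.finrank ℂ V) → (Fin n → Fin d) → ℂ := fun k σ =>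
    ∑ i, inner ℂ (b k) (⟨_, hmem i⟩ : V) * G i σ
  have hG' : ∀ k, DepOn (Set.Ici c) (G' k) := fun k =>
    DepOn.sum fun i _ => (DepOn.const _ _).mul (hG i)
  have hcard : Module.finrank ℂ V ≤ N := by
    have := finrank_range_le_card (R := ℂ) (fun i => (WithLp.toLp 2 (F i) : SpinChain n d))
    simpa [Set.finrank] using this
  let φ : Fin (Module.finrank ℂ V) → SpinChain n d := fun k => mulOp (G' k) (b k : SpinChain n d)
  have hxφ : x = ∑ k, φ k := by
    ext σ
    rw [hFG, WithLp.ofLp_sum, Finset.sum_apply]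
    have h1 : ∀ i, F i σ = ∑ k, inner ℂ (b k) (⟨_, hmem i⟩ : V) * (b k : SpinChain n d) σ := by
      intro i
      have h2 := congrArg (fun v : V => (v : SpinChain n d) σ) (b.sum_repr' ⟨_, hmem i⟩)
      simp only [Submodule.coe_sum, Submodule.coe_smul] at h2
      rw [WithLp.ofLp_sum, Finset.sum_apply] at h2
      exact h2.symm
    simp only [h1, φ, mulOp_apply, G', Finset.sum_mul]
    rw [Finset.sum_comm]
    exact Finset.sum_congr rfl fun k _ => Finset.sum_congr rfl fun i _ => by ring
  refine ⟨_, φ, hcard, fun k => ?_, hxφ, ?_⟩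
  · exact ⟨fun _ => (b k : SpinChain n d), fun _ => G' k, fun _ => hVdep _ (b k).2, fun _ => hG' k,
      fun σ => by simp [φ, mul_comm]⟩
  · have horth : ∀ k l, k ≠ l → inner ℂ (φ k) (φ l) = 0 := by
      intro k l hkl
      have h1 : inner ℂ (φ k) (φ l)
          = ∑ σ, ((starRingEnd ℂ ((b k : SpinChain n d) σ) * (b l : SpinChain n d) σ) *
              (starRingEnd ℂ (G' k σ) * G' l σ)) := by
        rw [PiLp.inner_apply]
        refine Finset.sum_congr rfl fun σ _ => ?_
        simp only [φ, mulOp_apply, RCLike.inner_apply, map_mul]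
        ring
      have h2 := sum_mul_card_eq (c := c)
        (f := fun σ => starRingEnd ℂ ((b k : SpinChain n d) σ) * (b l : SpinChain n d) σ)
        (g := fun σ => starRingEnd ℂ (G' k σ) * G' l σ)
        (fun σ τ h => by simp only [hVdep _ (b k).2 σ τ h, hVdep _ (b l).2 σ τ h])
        (fun σ τ h => by simp only [hG' k σ τ h, hG' l σ τ h])
      have h3 : ∑ σ, starRingEnd ℂ ((b k : SpinChain n d) σ) * (b l : SpinChain n d) σ = 0 := by
        have h4 : inner ℂ (b k : SpinChain n d) (b l : SpinChain n d) = 0 := by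
          rw [← Submodule.coe_inner, b.inner_eq_ite, if_neg hkl]
        rw [PiLp.inner_apply] at h4
        rw [← h4]
        exact Finset.sum_congr rfl fun σ _ => by rw [RCLike.inner_apply, mul_comm]
      rw [h3, zero_mul, ← h1] at h2
      rcases mul_eq_zero.1 h2 with h | h
      · exact h
      · rw [h1]
        have : IsEmpty (Fin n → Fin d) := by
          rw [← Fintype.card_eq_zero_iff]; exact_mod_cast h
        simp
    have h5 : (‖x‖ ^ 2 : ℝ) = ((∑ k, ‖φ k‖ ^ 2 : ℝ)) := by
      have h6 : inner ℂ x x = ∑ k, inner ℂ (φ k) (φ k) := by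
        rw [hxφ, sum_inner]
        refine Finset.sum_congr rfl fun k _ => ?_
        rw [inner_sum, Finset.sum_eq_single k]
        · intro l _ hl; exact horth k l hl.symm
        · simp
      simp only [inner_self_eq_norm_sq_to_K] at h6
      exact_mod_cast h6
    exact h5.symm

/-- The overlap with a vector of Schmidt rank `D` exceeds the overlap with product vectors by at most
the factor `√D`, by the Schmidt decomposition and the Cauchy–Schwarz inequality. -/
theorem norm_inner_le_of_schmidtLE {c D : ℕ} {Γ : SpinChain n d} {μ : ℝ} (hμ : 0 ≤ μ)
    (h : ∀ φ, SchmidtLE c 1 φ → ‖inner ℂ Γ φ‖ ≤ μ * ‖φ‖) {ψ : SpinChain n d} (hψ : SchmidtLE c D ψ) :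
    ‖inner ℂ Γ ψ‖ ≤ μ * √D * ‖ψ‖ := by
  obtain ⟨m, φ, hm, hφ, hsum, hnorm⟩ := hψ.exists_orthogonal
  have h1 : (∑ i, ‖φ i‖) ≤ √D * ‖ψ‖ := by
    apply Real.le_sqrt_of_sq_le _ |>.trans_eq
    · rw [Real.sqrt_mul (Nat.cast_nonneg D), Real.sqrt_sq (norm_nonneg ψ)]
    · have := sq_sum_le_card_mul_sum_sq (s := Finset.univ) (f := fun i => ‖φ i‖)
      rw [hnorm, Finset.card_univ, Fintype.card_fin] at this
      refine this.trans ?_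
      gcongr
  calc ‖inner ℂ Γ ψ‖ = ‖∑ i, inner ℂ Γ (φ i)‖ := by rw [← inner_sum, ← hsum]
    _ ≤ ∑ i, μ * ‖φ i‖ := norm_sum_le_of_le _ fun i _ => h _ (hφ i)
    _ = μ * ∑ i, ‖φ i‖ := by rw [Finset.mul_sum]
    _ ≤ μ * (√D * ‖ψ‖) := by gcongr
    _ = _ := by ring

/-- An approximate ground state projection of Schmidt rank `D` and accuracy `δ` with `D δ² ≤ 1 / 4`
yields approximations of the ground state of Schmidt rank `D`. -/
theorem exists_schmidtLE_approx (hd : 0 < d) {c D : ℕ} {δ : ℝ} (hδ : 0 ≤ δ) {Γ : SpinChain n d}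
    (hΓ : ‖Γ‖ = 1) {K : SpinChain n d →L[ℂ] SpinChain n d} (hKΓ : K Γ = Γ)
    (hK : ∀ x, inner ℂ Γ x = 0 → inner ℂ Γ (K x) = 0 ∧ ‖K x‖ ≤ δ * ‖x‖)
    (hrank : ∀ φ, SchmidtLE c 1 φ → SchmidtLE c D (K φ)) (hD : 1 ≤ D) (hDδ : D * δ ^ 2 ≤ 1 / 4) :
    ∃ ψ, SchmidtLE c D ψ ∧ ‖ψ - Γ‖ ≤ 2 * √D * δ := by
  -- `μ` is the supremum of the overlaps of `Γ` with unit product vectors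
  set S : Set ℝ := {r | ∃ φ : SpinChain n d, SchmidtLE c 1 φ ∧ ‖φ‖ ≤ 1 ∧ r = ‖inner ℂ Γ φ‖} with hS
  have hbdd : BddAbove S := by
    refine ⟨1, ?_⟩
    rintro r ⟨φ, -, hφ, rfl⟩
    refine (norm_inner_le_norm Γ φ).trans ?_
    rw [hΓ, one_mul]; exact hφ
  have hzero : SchmidtLE c 1 (0 : SpinChain n d) := by
    refine ⟨fun _ _ => 0, fun _ _ => 0, fun _ => DepOn.const _ 0, fun _ => DepOn.const _ 0, ?_⟩
    intro σ; simp
  have hne : S.Nonempty := ⟨_, 0, hzero, by simp, rfl⟩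
  set μ := sSup S with hμ
  have hle : ∀ φ, SchmidtLE c 1 φ → ‖inner ℂ Γ φ‖ ≤ μ * ‖φ‖ := by
    intro φ hφ
    rcases eq_or_ne φ 0 with rfl | h0
    · simp
    have hn : 0 < ‖φ‖ := norm_pos_iff.2 h0
    have h1 : ‖inner ℂ Γ (((‖φ‖⁻¹ : ℝ) : ℂ) • φ)‖ ≤ μ :=
      le_csSup hbdd ⟨_, hφ.smul _, by rw [norm_smul]; simp [hn.ne'], rfl⟩
    rw [inner_smul_right, norm_mul, Complex.norm_real, norm_inv, norm_norm, inv_mul_le_iff₀ hn] at h1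
    linarith
  have hμ0 : 0 < μ := by
    obtain ⟨m, φ, -, hφ, hsum, -⟩ := (schmidtLE_pow hd c Γ).exists_orthogonal
    by_contra! hneg
    have h1 : ∀ i, inner ℂ Γ (φ i) = 0 := fun i => by
      have := hle _ (hφ i)
      have h2 : μ * ‖φ i‖ ≤ 0 := mul_nonpos_of_nonpos_of_nonneg hneg (norm_nonneg _)
      exact norm_le_zero_iff.1 (this.trans h2)
    have h2 : inner ℂ Γ Γ = 0 := by
      nth_rewrite 2 [hsum]
      rw [inner_sum]; simp [h1]
    rw [inner_self_eq_zero] at h2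
    rw [h2] at hΓ; simp at hΓ
  have hΓΓ : inner ℂ Γ Γ = (1 : ℂ) := by
    rw [inner_self_eq_norm_sq_to_K, hΓ]; simp
  have hdec : ∀ φ : SpinChain n d, ‖φ‖ ≤ 1 → ∃ w : SpinChain n d, K φ = inner ℂ Γ φ • Γ + w ∧
      inner ℂ Γ w = 0 ∧ ‖w‖ ≤ δ := by
    intro φ hφ
    set v := φ - inner ℂ Γ φ • Γ with hv
    have hv0 : inner ℂ Γ v = 0 := by
      rw [hv, inner_sub_right, inner_smul_right, hΓΓ]; ring
    have hφv : φ = inner ℂ Γ φ • Γ + v := by rw [hv]; abel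
    have hvn : ‖v‖ ≤ 1 := by
      have h2 := norm_add_sq_eq_norm_sq_add_norm_sq_of_inner_eq_zero (𝕜 := ℂ)
        (inner ℂ Γ φ • Γ) v (by rw [inner_smul_left, hv0]; simp)
      rw [← hφv] at h2
      nlinarith [norm_nonneg v, norm_nonneg φ, norm_nonneg (inner ℂ Γ φ • Γ)]
    refine ⟨K v, ?_, (hK v hv0).1, ?_⟩
    · conv_lhs => rw [hφv]
      rw [map_add, map_smul, hKΓ]
    · exact (hK v hv0).2.trans (mul_le_of_le_one_right hδ hvn)
  have hDpos : (0 : ℝ) < D := by exact_mod_cast hD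
  -- `K φ` has the same overlap with `Γ` as `φ`, but a norm of at most `√(μ ^ 2 + δ ^ 2)`
  have hμD : 1 ≤ D * (μ ^ 2 + δ ^ 2) := by
    have h1 : μ ≤ μ * √D * √(μ ^ 2 + δ ^ 2) := by
      refine csSup_le hne ?_
      rintro r ⟨φ, hφ, hφ1, rfl⟩
      obtain ⟨w, hw, hw0, hwn⟩ := hdec φ hφ1
      have hin : inner ℂ Γ (K φ) = inner ℂ Γ φ := by
        rw [hw, inner_add_right, inner_smul_right, hΓΓ, hw0]; ring
      have h2 := norm_inner_le_of_schmidtLE hμ0.le hle (hrank φ hφ)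
      rw [hin] at h2
      refine h2.trans ?_
      gcongr
      apply Real.le_sqrt_of_sq_le
      have h3 := norm_add_sq_eq_norm_sq_add_norm_sq_of_inner_eq_zero (𝕜 := ℂ)
        (inner ℂ Γ φ • Γ) w (by rw [inner_smul_left, hw0]; simp)
      rw [← hw, norm_smul, hΓ, mul_one] at h3
      have h4 : ‖inner ℂ Γ φ‖ ≤ μ := le_csSup hbdd ⟨φ, hφ, hφ1, rfl⟩
      nlinarith [norm_nonneg (inner ℂ Γ φ), norm_nonneg w]
    have h2 : 1 ≤ √D * √(μ ^ 2 + δ ^ 2) := by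
      by_contra! hlt
      nlinarith
    have h3 : 1 ≤ (√D * √(μ ^ 2 + δ ^ 2)) ^ 2 := by nlinarith
    rwa [mul_pow, Real.sq_sqrt hDpos.le, Real.sq_sqrt (by positivity)] at h3
  have hlt : 1 / (2 * √D) < μ := by
    have hsD : 0 < √D := Real.sqrt_pos.2 hDpos
    rw [div_lt_iff₀ (by positivity)]
    by_contra! hcon
    have h1 : (μ * (2 * √D)) ^ 2 ≤ 1 := by
      have : 0 ≤ μ * (2 * √D) := by positivity
      nlinarith
    rw [mul_pow, mul_pow, Real.sq_sqrt hDpos.le] at h1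
    nlinarith
  obtain ⟨r, ⟨φ, hφ, hφ1, rfl⟩, hr⟩ := exists_lt_of_lt_csSup hne hlt
  obtain ⟨w, hw, hw0, hwn⟩ := hdec φ hφ1
  have hpos : 0 < ‖inner ℂ Γ φ‖ := lt_of_le_of_lt (by positivity) hr
  have hin0 : inner ℂ Γ φ ≠ 0 := norm_pos_iff.1 hpos
  refine ⟨(inner ℂ Γ φ)⁻¹ • K φ, (hrank φ hφ).smul _, ?_⟩
  have h1 : (inner ℂ Γ φ)⁻¹ • K φ - Γ = (inner ℂ Γ φ)⁻¹ • w := by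
    rw [hw, smul_add, smul_smul, inv_mul_cancel₀ hin0, one_smul]; abel
  rw [h1, norm_smul, norm_inv]
  have h2 : ‖inner ℂ Γ φ‖⁻¹ ≤ 2 * √D := by
    have := inv_anti₀ (by positivity) hr.le
    simpa using this
  gcongr

end Schmidt

/-! ### Matrix product states -/

section MPS
variable {n d : ℕ}

/-- A spanning family of prescribed size, padded by zeros. -/
theorem exists_family_of_finrank_le {E : Type*} [AddCommGroup E] [Module ℂ E]
    (V : Submodule ℂ E) [FiniteDimensional ℂ V] {B : ℕ} (hB : Module.finrank ℂ V ≤ B) :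
    ∃ w : Fin B → E, (∀ i, w i ∈ V) ∧ ∀ v ∈ V, ∃ a : Fin B → ℂ, v = ∑ i, a i • w i := by
  let b := Module.finBasis ℂ V
  let e := Fin.castLE hB
  have he : Function.Injective e := Fin.castLE_injective hB
  refine ⟨Function.extend e (fun k => (b k : E)) 0, fun i => ?_, fun v hv => ?_⟩
  · by_cases hi : ∃ k, e k = i
    · obtain ⟨k, rfl⟩ := hi; rw [he.extend_apply]; exact (b k).2
    · rw [Function.extend_apply' _ _ _ hi]; exact V.zero_mem
  · refine ⟨Function.extend e (b.repr ⟨v, hv⟩) 0, ?_⟩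
    have h1 := congrArg (Subtype.val) (b.sum_repr ⟨v, hv⟩)
    simp only [Submodule.coe_sum, Submodule.coe_smul] at h1
    refine h1.symm.trans (Finset.sum_of_injOn e he.injOn (by simp) ?_ ?_)
    · intro i _ hi
      have hi' : ¬ ∃ k, e k = i := by simpa using hi
      rw [Function.extend_apply' _ _ _ hi']; simp
    · intro k _
      rw [he.extend_apply, he.extend_apply]

/-- The sites to the right of the cut `c`. -/
def rightSites (n c : ℕ) : Finset (Fin n) := Finset.univ.filter fun j => c ≤ (j : ℕ)

/-- The left Schmidt space of `ψ` at the cut `c`: the span of the functions of the spins left of the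
cut that arise from `ψ` when the other spins are fixed. -/
noncomputable def sliceSpan (ψ : SpinChain n d) (c : ℕ) : Submodule ℂ (SpinChain n d) :=
  Submodule.span ℂ (Set.range fun ρ => freeze (rightSites n c) ρ ψ)

theorem finrank_sliceSpan_le {ψ : SpinChain n d} {c B : ℕ} (h : SchmidtLE c B ψ) :
    Module.finrank ℂ (sliceSpan ψ c) ≤ B := by
  obtain ⟨F, G, hF, hG, hFG⟩ := h
  have hle : sliceSpan ψ c ≤
      Submodule.span ℂ (Set.range fun i => (WithLp.toLp 2 (F i) : SpinChain n d)) := by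
    rw [sliceSpan, Submodule.span_le]
    rintro _ ⟨ρ, rfl⟩
    have : freeze (rightSites n c) ρ ψ = ∑ i, G i ρ • (WithLp.toLp 2 (F i) : SpinChain n d) := by
      ext σ
      rw [freeze_apply, hFG, WithLp.ofLp_sum, Finset.sum_apply]
      refine Finset.sum_congr rfl fun i _ => ?_
      have h1 : F i ((rightSites n c).piecewise ρ σ) = F i σ := hF i _ _ fun j hj => by
        have : j ∉ rightSites n c := by simpa [rightSites] using hj
        simp [this]
      have h2 : G i ((rightSites n c).piecewise ρ σ) = G i ρ := hG i _ _ fun j hj => by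
        have : j ∈ rightSites n c := by simpa [rightSites] using hj
        simp [this]
      rw [h1, h2, mul_comm]; rfl
    change freeze (rightSites n c) ρ ψ ∈ _
    rw [this]
    exact Submodule.sum_mem _ fun i _ => Submodule.smul_mem _ _ (Submodule.subset_span ⟨i, rfl⟩)
  refine (Submodule.finrank_mono hle).trans ?_
  have := finrank_range_le_card (R := ℂ) (fun i => (WithLp.toLp 2 (F i) : SpinChain n d))
  simpa [Set.finrank] using this

theorem substOp_mem_sliceSpan {ψ v : SpinChain n d} {c : Fin n} (hv : v ∈ sliceSpan ψ (c + 1))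
    (a : Fin d) : substOp c a v ∈ sliceSpan ψ c := by
  have hle : (sliceSpan ψ (c + 1)).map (substOp c a).toLinearMap ≤ sliceSpan ψ c := by
    rw [sliceSpan, Submodule.map_span_le]
    rintro _ ⟨ρ, rfl⟩
    refine Submodule.subset_span ⟨Function.update ρ c a, ?_⟩
    ext σ
    change ψ _ = ψ _
    refine congrArg ψ.ofLp (funext fun j => ?_)
    rcases eq_or_ne j c with rfl | hj
    · simp [Finset.piecewise, rightSites]
    · have : (j : ℕ) ≠ c := fun h => hj (Fin.ext h)
      have e1 : c ≤ j ↔ c < j := by rw [Fin.le_def, Fin.lt_def]; omega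
      simp [Finset.piecewise, rightSites, hj, e1]
  exact hle (Submodule.mem_map_of_mem hv)

/-- A vector of Schmidt rank at most `B` across every cut is a matrix product state. The matrix
`A c a` expresses the spanning family `w (c + 1)` of the left Schmidt space at the cut `c + 1`, with
the spin at the site `c` fixed to `a`, by the family `w c`. -/
theorem isMatrixProductState_of_schmidtLE (hd : 0 < d) {B : ℕ} {ψ : SpinChain n d}
    (h : ∀ c, SchmidtLE c B ψ) : IsMatrixProductState B ψ := by
  have hfam := fun c => exists_family_of_finrank_le (sliceSpan ψ c) (finrank_sliceSpan_le (h c))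
  choose w hw hspan using hfam
  have hA : ∀ (c : Fin n) (a : Fin d) (β : Fin B), ∃ m : Fin B → ℂ,
      substOp c a (w (c + 1) β) = ∑ α, m α • w c α := fun c a β =>
    hspan c _ (substOp_mem_sliceSpan (hw (c + 1) β) a)
  choose M hM using hA
  obtain ⟨r, hr⟩ := hspan n ψ (Submodule.subset_span ⟨fun _ => ⟨0, hd⟩, by
    ext σ
    have : rightSites n n = ∅ := by
      ext j; simp [rightSites]
    simp [this]⟩)
  let A : Fin n → Fin d → Matrix (Fin B) (Fin B) ℂ := fun c a => Matrix.of fun α β => M c a β α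
  let σ₀ : Fin n → Fin d := fun _ => ⟨0, hd⟩
  let l : Fin B → ℂ := fun α => w 0 α σ₀
  refine ⟨A, l, r, fun σ => ?_⟩
  have hconst : ∀ α, w 0 α σ = l α := by
    intro α
    have : ∀ v ∈ sliceSpan ψ 0, v σ = v σ₀ := by
      intro v hv
      induction hv using Submodule.span_induction with
      | mem v hv =>
        obtain ⟨ρ, rfl⟩ := hv
        change ψ _ = ψ _
        refine congrArg ψ.ofLp (funext fun j => ?_)
        simp [Finset.piecewise, rightSites]
      | zero => rfl
      | add v w _ _ hv hw => exact congrArg₂ (· + ·) hv hw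
      | smul a v _ hv => exact congrArg (a * ·) hv
    exact this _ (hw 0 α)
  set L := List.ofFn fun i => A i (σ i) with hL
  have hLlen : L.length = n := by simp [hL]
  have key : ∀ c ≤ n, ∀ β, w c β σ = (l ᵥ* (L.take c).prod) β := by
    intro c
    induction c with
    | zero => intro _ β; simpa using hconst β
    | succ c ih =>
      intro hc β
      have hc' : c < L.length := by omega
      have h1 : w (c + 1) β σ = substOp ⟨c, hc⟩ (σ ⟨c, hc⟩) (w (c + 1) β) σ := by simp
      have h2 := hM ⟨c, hc⟩ (σ ⟨c, hc⟩) β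
      rw [h1, h2, WithLp.ofLp_sum, Finset.sum_apply, List.prod_take_succ L c hc',
        ← Matrix.vecMul_vecMul]
      have h3 : L[c] = A ⟨c, hc⟩ (σ ⟨c, hc⟩) := by simp [hL]
      rw [h3, Matrix.vecMul, dotProduct]
      refine Finset.sum_congr rfl fun α _ => ?_
      rw [← ih (by omega) α]
      change M ⟨c, hc⟩ (σ ⟨c, hc⟩) β α * w c α σ = w c α σ * M ⟨c, hc⟩ (σ ⟨c, hc⟩) β α
      ring
  have hn := key n le_rfl
  rw [List.take_of_length_le hLlen.le] at hn
  rw [Matrix.dotProduct_mulVec]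
  conv_lhs => rw [hr]
  rw [WithLp.ofLp_sum, Finset.sum_apply, dotProduct]
  refine Finset.sum_congr rfl fun β _ => ?_
  rw [← hn β]
  change r β * w n β σ = w n β σ * r β
  ring

theorem commute_starProjection {E : Type*} [NormedAddCommGroup E] [InnerProductSpace ℂ E]
    [FiniteDimensional ℂ E] {V : Submodule ℂ E} {T T' : E →L[ℂ] E}
    (hadj : ∀ x y, inner ℂ (T' x) y = inner ℂ x (T y)) (hV : ∀ x ∈ V, T x ∈ V)
    (hV' : ∀ x ∈ V, T' x ∈ V) : Commute V.starProjection T := by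
  ext y
  change V.starProjection (T y) = T (V.starProjection y)
  refine Submodule.eq_starProjection_of_mem_orthogonal (hV _ (V.starProjection_apply_mem y)) ?_
  rw [← map_sub]
  intro v hv
  rw [← hadj]
  exact Submodule.sub_starProjection_mem_orthogonal (K := V) y _ (hV' v hv)

theorem inner_mulOp (G : (Fin n → Fin d) → ℂ) (x y : SpinChain n d) :
    inner ℂ (mulOp (fun σ => starRingEnd ℂ (G σ)) x) y = inner ℂ x (mulOp G y) := by
  rw [PiLp.inner_apply, PiLp.inner_apply]
  refine Finset.sum_congr rfl fun σ _ => ?_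
  simp only [mulOp_apply, RCLike.inner_apply, map_mul, RCLike.conj_conj]
  ring

theorem unitOp_apply (j : Fin n) (a b : Fin d) (x : SpinChain n d) (σ : Fin n → Fin d) :
    unitOp j a b x σ = if σ j = a then x (Function.update σ j b) else 0 := by
  change (if σ j = a then (1 : ℂ) else 0) * x (Function.update σ j b) = _
  rw [ite_mul, one_mul, zero_mul]

theorem inner_unitOp (j : Fin n) (a b : Fin d) (x y : SpinChain n d) :
    inner ℂ (unitOp j b a x) y = inner ℂ x (unitOp j a b y) := by
  rw [PiLp.inner_apply, PiLp.inner_apply]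
  simp only [unitOp_apply, RCLike.inner_apply, apply_ite (starRingEnd ℂ), map_zero, mul_ite, ite_mul,
    mul_zero, zero_mul]
  rw [← Finset.sum_filter, ← Finset.sum_filter]
  refine Finset.sum_nbij' (fun σ => Function.update σ j a) (fun σ => Function.update σ j b)
    ?_ ?_ ?_ ?_ ?_
  · intro σ _; simp
  · intro σ _; simp
  · intro σ hσ
    simp only [Finset.mem_filter, Finset.mem_univ, true_and] at hσ
    simp [← hσ]
  · intro σ hσ
    simp only [Finset.mem_filter, Finset.mem_univ, true_and] at hσ
    simp [← hσ]
  · intro σ hσ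
    simp only [Finset.mem_filter, Finset.mem_univ, true_and] at hσ
    simp [← hσ]

theorem substOp_eq_sum (j : Fin n) (b : Fin d) :
    (substOp j b : SpinChain n d →L[ℂ] SpinChain n d) = ∑ a, unitOp j a b := by
  ext x σ
  rw [sum_apply, WithLp.ofLp_sum, Finset.sum_apply]
  simp [unitOp_apply]

/-- The projection onto the vectors whose left Schmidt space is contained in the span of the left
Schmidt vectors of `φ`. It acts on the left sites only, since the space is invariant under the
operators on the right sites. -/
theorem SchmidtLE.exists_projection {c B : ℕ} {φ : SpinChain n d} (h : SchmidtLE c B φ) :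
    ∃ P ∈ localAlg n d (Set.Iio c), ‖P‖ ≤ 1 ∧ P φ = φ ∧ ∀ x, SchmidtLE c B (P x) := by
  obtain ⟨F, G, hF, hG, hFG⟩ := h
  let V : Submodule ℂ (SpinChain n d) :=
    { carrier := {x | ∃ G : Fin B → (Fin n → Fin d) → ℂ, (∀ i, DepOn (Set.Ici c) (G i)) ∧
        ∀ σ, x σ = ∑ i, F i σ * G i σ}
      zero_mem' := ⟨fun _ _ => 0, fun _ => DepOn.const _ 0, fun σ => by simp⟩
      add_mem' := by
        rintro x y ⟨G, hG, hx⟩ ⟨G', hG', hy⟩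
        refine ⟨fun i σ => G i σ + G' i σ, fun i σ τ h => by simp only [hG i σ τ h, hG' i σ τ h],
          fun σ => ?_⟩
        change x σ + y σ = _
        rw [hx, hy, ← Finset.sum_add_distrib]
        exact Finset.sum_congr rfl fun i _ => by ring
      smul_mem' := by
        rintro a x ⟨G, hG, hx⟩
        refine ⟨fun i σ => a * G i σ, fun i => (DepOn.const _ a).mul (hG i), fun σ => ?_⟩
        change a * x σ = _
        rw [hx, Finset.mul_sum]
        exact Finset.sum_congr rfl fun i _ => by ring }
  have hVmul : ∀ g, DepOn (Set.Ici c) g → ∀ x ∈ V, mulOp g x ∈ V := by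
    rintro g hg x ⟨G, hG, hx⟩
    refine ⟨fun i σ => g σ * G i σ, fun i => hg.mul (hG i), fun σ => ?_⟩
    rw [mulOp_apply, hx, Finset.mul_sum]
    exact Finset.sum_congr rfl fun i _ => by ring
  have hVunit : ∀ (j : Fin n) (a b : Fin d), c ≤ (j : ℕ) → ∀ x ∈ V, unitOp j a b x ∈ V := by
    rintro j a b hj x ⟨G, hG, hx⟩
    refine ⟨fun i => unitOp j a b (WithLp.toLp 2 (G i)), fun i => DepOn.localAlg_apply
      (unitOp_mem_localAlg (S := Set.Ici c) hj a b) subset_rfl (hG i), fun σ => ?_⟩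
    simp only [unitOp_apply, hx]
    split_ifs
    · refine Finset.sum_congr rfl fun i _ => ?_
      rw [(hF i).update (by simpa using hj)]
    · simp
  refine ⟨V.starProjection, ?_, V.starProjection_norm_le, ?_, fun x => ?_⟩
  · rw [mem_localAlg_iff]
    constructor
    · intro g hg
      rw [Set.compl_Iio] at hg
      refine commute_starProjection (inner_mulOp g) (hVmul g hg) (hVmul _ ?_)
      intro σ τ hστ
      simp only [hg σ τ hστ]
    · intro j b hj
      rw [substOp_eq_sum]
      have hj' : c ≤ (j : ℕ) := by simpa using hj
      exact Commute.sum_right _ _ _ fun a _ => commute_starProjection (inner_unitOp j a b)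
        (hVunit j a b hj') (hVunit j b a hj')
  · exact Submodule.starProjection_eq_self_iff.2 ⟨G, hG, hFG⟩
  · obtain ⟨G', hG', hx⟩ := V.starProjection_apply_mem x
    exact ⟨F, G', hF, hG', hx⟩

/-- Approximability across each single cut yields a simultaneous approximation. The cuts are treated
from right to left, so that the projection for the cut `c`, which acts on the sites left of `c`,
preserves the bounds obtained for the cuts to the right of `c`. -/
theorem exists_matrixProductState_approx {B : ℕ} (hB : 1 ≤ B) {δ : ℝ}
    {Γ : SpinChain n d}
    (h : ∀ c, 1 ≤ c → c < n → ∃ φ, SchmidtLE c B φ ∧ ‖φ - Γ‖ ≤ δ) (hδ : 0 ≤ δ) :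
    ∃ ψ : SpinChain n d, (∀ c, SchmidtLE c B ψ) ∧ ‖ψ - Γ‖ ≤ 2 * n * δ := by
  have key : ∀ k : ℕ, ∃ ψ : SpinChain n d, (∀ c, n ≤ c + k → SchmidtLE c B ψ) ∧
      ‖ψ - Γ‖ ≤ 2 * k * δ := by
    intro k
    induction k with
    | zero => exact ⟨Γ, fun c hc => (schmidtLE_one_of_le (by omega) Γ).mono hB, by simp⟩
    | succ k ih =>
      obtain ⟨ψ, hψ, hψn⟩ := ih
      by_cases hk : 1 ≤ n - (k + 1)
      · obtain ⟨φ, hφ, hφn⟩ := h (n - (k + 1)) hk (by omega)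
        obtain ⟨P, hP, hP1, hPφ, hPr⟩ := hφ.exists_projection
        refine ⟨P ψ, fun c hc => ?_, ?_⟩
        · rcases Nat.lt_or_ge (c + k) n with h1 | h1
          · have : c = n - (k + 1) := by omega
            rw [this]; exact hPr ψ
          · refine (hψ c h1).apply_left (localAlg_mono (fun j hj => ?_) hP)
            simp only [Set.mem_Iio] at hj ⊢
            omega
        · have h1 : P ψ - Γ = P (ψ - Γ) + (P (Γ - φ) + (φ - Γ)) := by
            rw [map_sub, map_sub, hPφ]; abel
          have h2 : ∀ x, ‖P x‖ ≤ ‖x‖ := fun x => (P.le_of_opNorm_le hP1 x).trans_eq (one_mul _)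
          have h3 := norm_add_le (P (ψ - Γ)) (P (Γ - φ) + (φ - Γ))
          have h4 := norm_add_le (P (Γ - φ)) (φ - Γ)
          have h5 := h2 (ψ - Γ)
          have h6 := h2 (Γ - φ)
          rw [norm_sub_rev Γ φ] at h6
          rw [h1]; push_cast
          linarith
      · refine ⟨ψ, fun c hc => ?_, ?_⟩
        · rcases Nat.eq_zero_or_pos c with rfl | h0
          · exact (schmidtLE_zero_one ψ).mono hB
          · exact hψ c (by omega)
        · push_cast; linarith
  obtain ⟨ψ, hψ, hn⟩ := key n
  exact ⟨ψ, fun c => hψ c (by omega), hn⟩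

end MPS

/-! ### Counting words -/

section Counting
variable {R : Type*} [Ring R]

/-- The sum over all words of length `m` in the letters `x₀`, `h 0, …, h (s - 1)` of the product of
the word, weighted by `w (κ + numbers of occurrences of the letters h q)`. -/
def weightedWords (x₀ : R) (h : ℕ → R) (s : ℕ) (w : (ℕ → ℕ) → R) : ℕ → (ℕ → ℕ) → R
  | 0, κ => w κ
  | m + 1, κ => x₀ * weightedWords x₀ h s w m κ +
      ∑ q ∈ Finset.range s, h q * weightedWords x₀ h s w m (κ + Pi.single q 1)

/-- Weights that sum to one recover the power of the sum of the letters. -/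
theorem sum_weightedWords {x₀ : R} {h : ℕ → R} {s l : ℕ} {w : ℕ → (ℕ → ℕ) → R}
    (hw : ∀ κ : ℕ → ℕ, ∑ q ∈ Finset.range s, κ q ≤ l → ∑ j ∈ Finset.range s, w j κ = 1) (m : ℕ)
    (κ : ℕ → ℕ) (hκ : ∑ q ∈ Finset.range s, κ q + m ≤ l) :
    ∑ j ∈ Finset.range s, weightedWords x₀ h s (w j) m κ = (x₀ + ∑ q ∈ Finset.range s, h q) ^ m := by
  induction m generalizing κ with
  | zero => simpa [weightedWords] using hw κ (by simpa using hκ)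
  | succ m ih =>
    simp only [weightedWords]
    rw [Finset.sum_add_distrib, ← Finset.mul_sum, ih κ (by omega), Finset.sum_comm, pow_succ',
      add_mul, Finset.sum_mul]
    congr 1
    refine Finset.sum_congr rfl fun q hq => ?_
    rw [← Finset.mul_sum, ih]
    have : ∑ p ∈ Finset.range s, (κ + Pi.single q 1 : ℕ → ℕ) p
        = ∑ p ∈ Finset.range s, κ p + 1 := by
      simp only [Pi.add_apply, Finset.sum_add_distrib]
      congr 1
      rw [Finset.sum_eq_single q]
      · simp
      · intro p _ hp; simp [hp]
      · intro hq'; exact absurd hq hq'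
    omega

section Words
variable {ι : Type*} [Fintype ι] (a : R) (h : ℕ → R) (j : ℕ) (P : ι → R) (w : (ℕ → ℕ) → R)

/-- Multiplication from the left by `a` or by one of the letters `h q`, `q < j`, whose occurrence is
recorded in the argument of `f`. -/
def leftLetter (f : (ℕ → ℕ) → R) : (ℕ → ℕ) → R := fun κ =>
  a * f κ + ∑ q ∈ Finset.range j, h q * f (κ + Pi.single q 1)

/-- Multiplication from the left by the left factor `P α` of the letter `h j = ∑ α, P α * Q α`. -/
def midLetter (f : (ℕ → ℕ) → R) (α : ι) : (ℕ → ℕ) → R := fun κ => P α * f (κ + Pi.single j 1)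

open Classical in
/-- The left operators that arise from `m` letters of which `k` are middle ones, as functions of the
numbers of occurrences of the letters of a preceding word. Only the positions and the indices of the
middle letters are resolved; all choices of the other letters are summed up in `leftLetter`. -/
noncomputable def leftWords : ℕ → ℕ → Finset ((ℕ → ℕ) → R)
  | 0, 0 => {w}
  | 0, _ + 1 => ∅
  | m + 1, 0 => (leftWords m 0).image (leftLetter a h j)
  | m + 1, k + 1 => (leftWords m (k + 1)).image (leftLetter a h j) ∪
      Finset.univ.biUnion fun α => (leftWords m k).image fun f => midLetter j P f α

theorem card_leftWords_le (m k : ℕ) :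
    (leftWords a h j P w m k).card ≤ m.choose k * Fintype.card ι ^ k := by
  classical
  induction m generalizing k with
  | zero =>
    cases k with
    | zero => simp [leftWords]
    | succ k => simp [leftWords]
  | succ m ih =>
    cases k with
    | zero =>
      rw [leftWords]
      refine Finset.card_image_le.trans ((ih 0).trans ?_)
      simp
    | succ k =>
      rw [leftWords]
      refine (Finset.card_union_le _ _).trans ?_
      have h1 := (Finset.card_image_le (f := leftLetter a h j)).trans (ih (k + 1))
      have h2 : (Finset.univ.biUnion fun α => (leftWords a h j P w m k).image
          fun f => midLetter j P f α).card ≤ Fintype.card ι * (m.choose k * Fintype.card ι ^ k) := by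
        refine Finset.card_biUnion_le.trans ?_
        refine (Finset.sum_le_card_nsmul _ _ _ fun α _ =>
          Finset.card_image_le.trans (ih k)).trans_eq ?_
        simp
      calc _ ≤ m.choose (k + 1) * Fintype.card ι ^ (k + 1)
            + Fintype.card ι * (m.choose k * Fintype.card ι ^ k) := add_le_add h1 h2
        _ = _ := by rw [Nat.choose_succ_succ]; ring

variable {a h j P w}

theorem leftLetter_mem_leftWords {m k : ℕ} {f : (ℕ → ℕ) → R} (hf : f ∈ leftWords a h j P w m k) :
    leftLetter a h j f ∈ leftWords a h j P w (m + 1) k := by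
  classical
  cases k with
  | zero => rw [leftWords]; exact Finset.mem_image_of_mem _ hf
  | succ k => rw [leftWords]; exact Finset.mem_union_left _ (Finset.mem_image_of_mem _ hf)

theorem midLetter_mem_leftWords {m k : ℕ} {f : (ℕ → ℕ) → R} (hf : f ∈ leftWords a h j P w m k)
    (α : ι) : midLetter j P f α ∈ leftWords a h j P w (m + 1) (k + 1) := by
  classical
  rw [leftWords]
  exact Finset.mem_union_right _ (Finset.mem_biUnion.2
    ⟨α, Finset.mem_univ _, Finset.mem_image_of_mem (fun f => midLetter j P f α) hf⟩)

/-- To prove a property of all left operators it suffices to treat the two ways of adding a letter. -/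
theorem leftWords_induction {p : ℕ → ((ℕ → ℕ) → R) → Prop} (h0 : p 0 w)
    (hl : ∀ k f, p k f → p k (leftLetter a h j f))
    (hm : ∀ k f α, p k f → p (k + 1) (midLetter j P f α)) {m k : ℕ} {f : (ℕ → ℕ) → R}
    (hf : f ∈ leftWords a h j P w m k) : p k f := by
  classical
  induction m generalizing k f with
  | zero =>
    cases k with
    | zero => rw [leftWords, Finset.mem_singleton] at hf; rw [hf]; exact h0
    | succ k => simp [leftWords] at hf
  | succ m ih =>
    cases k with
    | zero =>
      rw [leftWords, Finset.mem_image] at hf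
      obtain ⟨g, hg, rfl⟩ := hf
      exact hl _ _ (ih hg)
    | succ k =>
      rw [leftWords, Finset.mem_union, Finset.mem_image, Finset.mem_biUnion] at hf
      rcases hf with ⟨g, hg, rfl⟩ | ⟨α, -, hf⟩
      · exact hl _ _ (ih hg)
      · obtain ⟨g, hg, rfl⟩ := Finset.mem_image.1 hf
        exact hm _ _ _ (ih hg)

variable (𝓡 : Subring R)

/-- `X` is a combination of the functions in `T` with right coefficients in `𝓡`. -/
def IsRightComb (T : Finset ((ℕ → ℕ) → R)) (X : (ℕ → ℕ) → R) : Prop :=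
  ∃ c : ((ℕ → ℕ) → R) → R, (∀ f, c f ∈ 𝓡) ∧ ∀ κ, X κ = ∑ f ∈ T, f κ * c f

variable {𝓡}

theorem IsRightComb.add {T : Finset ((ℕ → ℕ) → R)} {X Y : (ℕ → ℕ) → R} (hX : IsRightComb 𝓡 T X)
    (hY : IsRightComb 𝓡 T Y) : IsRightComb 𝓡 T (X + Y) := by
  obtain ⟨c, hc, h1⟩ := hX
  obtain ⟨e, he, h2⟩ := hY
  refine ⟨c + e, fun f => add_mem (hc f) (he f), fun κ => ?_⟩
  rw [Pi.add_apply, h1, h2, ← Finset.sum_add_distrib]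
  exact Finset.sum_congr rfl fun f _ => by rw [Pi.add_apply, mul_add]

theorem IsRightComb.sum {κ' : Type*} {s : Finset κ'} {T : Finset ((ℕ → ℕ) → R)}
    {X : κ' → (ℕ → ℕ) → R} (hX : ∀ i ∈ s, IsRightComb 𝓡 T (X i)) :
    IsRightComb 𝓡 T (∑ i ∈ s, X i) := by
  classical
  induction s using Finset.induction_on with
  | empty => exact ⟨fun _ => 0, fun _ => zero_mem _, fun κ => by simp⟩
  | insert i s hi ih =>
    rw [Finset.sum_insert hi]
    exact (hX i (Finset.mem_insert_self _ _)).add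
      (ih fun k hk => hX k (Finset.mem_insert_of_mem hk))

theorem IsRightComb.single {T : Finset ((ℕ → ℕ) → R)} {f : (ℕ → ℕ) → R} (hf : f ∈ T) {y : R}
    (hy : y ∈ 𝓡) : IsRightComb 𝓡 T (fun κ => f κ * y) := by
  classical
  refine ⟨fun g => if g = f then y else 0, fun g => ?_, fun κ => ?_⟩
  · dsimp only
    split_ifs
    exacts [hy, zero_mem _]
  · simp [hf]

open Classical in
/-- Let the letters `a`, `h q` for `q < j` and `P α` be left operators, the letters `b`, `h q` for
`j < q` and `Q α` right operators, and let the weight `w` depend on the letters `h q` with `q ≤ j` only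
and vanish if `h j` occurs more than `r` times. Then the weighted sum over words is a combination of
few left operators, with right operators as coefficients. -/
theorem exists_weightedWords_eq {𝓛 : Subring R} (hcomm : ∀ x ∈ 𝓛, ∀ y ∈ 𝓡, x * y = y * x)
    {b : R} {Q : ι → R} {s r : ℕ} (hj : j < s) (ha : a ∈ 𝓛) (hb : b ∈ 𝓡)
    (hl : ∀ q < j, h q ∈ 𝓛) (hr : ∀ q, j < q → h q ∈ 𝓡) (hP : ∀ α, P α ∈ 𝓛) (hQ : ∀ α, Q α ∈ 𝓡)
    (hjPQ : h j = ∑ α, P α * Q α) (hw : ∀ κ, w κ ∈ 𝓛)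
    (hwr : ∀ κ q, j < q → w (κ + Pi.single q 1) = w κ) (hw0 : ∀ κ : ℕ → ℕ, r < κ j → w κ = 0)
    (m : ℕ) :
    ∃ (S : Finset R) (c : R → R), S.card ≤ (m + 1) * ((r + 1) * (m * Fintype.card ι + 1) ^ r) ∧
      (∀ x ∈ S, x ∈ 𝓛) ∧ (∀ x, c x ∈ 𝓡) ∧ weightedWords (a + b) h s w m 0 = ∑ x ∈ S, x * c x := by
  -- the left operators lie in `𝓛`, do not see the letters on the right, and vanish when the letter
  -- `h j` occurs too often
  have hmem : ∀ {m k f}, f ∈ leftWords a h j P w m k → ∀ κ, f κ ∈ 𝓛 := by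
    intro m k f hf
    refine leftWords_induction (p := fun _ f => ∀ κ, f κ ∈ 𝓛) hw ?_ ?_ hf
    · intro _ f hf κ
      exact add_mem (mul_mem ha (hf κ)) (sum_mem fun q hq =>
        mul_mem (hl q (Finset.mem_range.1 hq)) (hf _))
    · intro _ f α hf κ
      exact mul_mem (hP α) (hf _)
  have hshift : ∀ {m k f}, f ∈ leftWords a h j P w m k → ∀ κ q, j < q →
      f (κ + Pi.single q 1) = f κ := by
    intro m k f hf
    refine leftWords_induction (p := fun _ f => ∀ κ q, j < q → f (κ + Pi.single q 1) = f κ) hwr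
      ?_ ?_ hf
    · intro _ f hf κ q hq
      simp only [leftLetter]
      rw [hf κ q hq]
      congr 1
      exact Finset.sum_congr rfl fun q' _ => by rw [add_right_comm, hf _ q hq]
    · intro _ f α hf κ q hq
      simp only [midLetter]
      rw [add_right_comm, hf _ q hq]
  have hvan : ∀ {m k f}, f ∈ leftWords a h j P w m k → ∀ κ : ℕ → ℕ, r < κ j + k → f κ = 0 := by
    intro m k f hf
    refine leftWords_induction (p := fun k f => ∀ κ : ℕ → ℕ, r < κ j + k → f κ = 0)
      (fun κ hκ => hw0 κ (by simpa using hκ)) ?_ ?_ hf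
    · intro k f hf κ hκ
      simp only [leftLetter]
      rw [hf κ hκ, mul_zero, zero_add]
      refine Finset.sum_eq_zero fun q hq => ?_
      rw [hf, mul_zero]
      have : j ≠ q := (Finset.mem_range.1 hq).ne'
      simpa [this] using hκ
    · intro k f α hf κ hκ
      simp only [midLetter]
      rw [hf, mul_zero]
      simp only [Pi.add_apply, Pi.single_eq_same]
      omega
  let T : ℕ → Finset ((ℕ → ℕ) → R) := fun m =>
    (Finset.range (m + 1)).biUnion fun m' => (Finset.range (m + 1)).biUnion fun k =>
      leftWords a h j P w m' k
  have hT : ∀ m f, f ∈ T m ↔ ∃ m' ≤ m, ∃ k ≤ m, f ∈ leftWords a h j P w m' k := by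
    intro m f
    simp only [T, Finset.mem_biUnion, Finset.mem_range, Nat.lt_succ_iff]
  -- a new letter is either absorbed by the left operator or moved past it into the coefficient
  have hrep : ∀ m, IsRightComb 𝓡 (T m) (weightedWords (a + b) h s w m) := by
    intro m
    induction m with
    | zero =>
      have : w ∈ T 0 := (hT 0 w).2 ⟨0, le_rfl, 0, le_rfl, by simp [leftWords]⟩
      have := IsRightComb.single this (one_mem 𝓡)
      simpa [weightedWords] using this
    | succ m ih =>
      obtain ⟨c, hc, hX⟩ := ih
      have hstep : weightedWords (a + b) h s w (m + 1) = ∑ f ∈ T m,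
          ((fun κ => leftLetter a h j f κ * c f) + (fun κ => f κ * (b * c f))
            + (∑ α, fun κ => midLetter j P f α κ * (Q α * c f))
            + ∑ q ∈ Finset.Ico (j + 1) s, fun κ => f κ * (h q * c f)) := by
        funext κ
        simp only [weightedWords, hX, Finset.sum_apply, Pi.add_apply]
        have e1 : ∀ q, h q * ∑ f ∈ T m, f (κ + Pi.single q 1) * c f
            = ∑ f ∈ T m, h q * (f (κ + Pi.single q 1) * c f) := fun q => Finset.mul_sum _ _ _
        simp only [e1]
        rw [Finset.mul_sum, Finset.sum_comm, ← Finset.sum_add_distrib]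
        refine Finset.sum_congr rfl fun f hf => ?_
        obtain ⟨m', -, k, -, hf⟩ := (hT m f).1 hf
        rw [Finset.range_eq_Ico, ← Finset.sum_Ico_consecutive _ (Nat.zero_le (j + 1)) hj,
          ← Finset.range_eq_Ico, Finset.sum_range_succ, hjPQ, Finset.sum_mul]
        have e2 : ∑ q ∈ Finset.Ico (j + 1) s, h q * (f (κ + Pi.single q 1) * c f)
            = ∑ q ∈ Finset.Ico (j + 1) s, f κ * (h q * c f) := by
          refine Finset.sum_congr rfl fun q hq => ?_
          have hq' : j < q := (Finset.mem_Ico.1 hq).1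
          rw [hshift hf κ q hq', ← mul_assoc, ← hcomm _ (hmem hf κ) _ (hr q hq'), mul_assoc]
        have e3 : ∑ α, P α * Q α * (f (κ + Pi.single j 1) * c f)
            = ∑ α, midLetter j P f α κ * (Q α * c f) := by
          refine Finset.sum_congr rfl fun α _ => ?_
          rw [midLetter, mul_assoc, mul_assoc, ← mul_assoc (Q α), ← hcomm _ (hmem hf _) _ (hQ α),
            mul_assoc]
        have e4 : (a + b) * (f κ * c f) + ∑ q ∈ Finset.range j, h q * (f (κ + Pi.single q 1) * c f)
            = leftLetter a h j f κ * c f + f κ * (b * c f) := by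
          rw [leftLetter, add_mul, add_mul, Finset.sum_mul, ← mul_assoc b,
            ← hcomm _ (hmem hf κ) _ hb]
          simp only [mul_assoc]
          abel
        rw [e2, e3, ← e4]
        abel
      rw [hstep]
      refine IsRightComb.sum fun f hf => ?_
      obtain ⟨m', hm', k, hk, hf⟩ := (hT m f).1 hf
      have hfT : f ∈ T (m + 1) := (hT _ _).2 ⟨m', by omega, k, by omega, hf⟩
      refine IsRightComb.add (IsRightComb.add (IsRightComb.add ?_ ?_) ?_) ?_
      · exact IsRightComb.single
          ((hT _ _).2 ⟨m' + 1, by omega, k, by omega, leftLetter_mem_leftWords hf⟩) (hc f)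
      · exact IsRightComb.single hfT (mul_mem hb (hc f))
      · exact IsRightComb.sum fun α _ => IsRightComb.single
          ((hT _ _).2 ⟨m' + 1, by omega, k + 1, by omega, midLetter_mem_leftWords hf α⟩)
          (mul_mem (hQ α) (hc f))
      · exact IsRightComb.sum fun q hq => IsRightComb.single hfT
          (mul_mem (hr q (Finset.mem_Ico.1 hq).1) (hc f))
  obtain ⟨c, hc, hX⟩ := hrep m
  -- at `κ = 0` only the left operators with at most `r` middle letters survive
  let T' : Finset ((ℕ → ℕ) → R) := (Finset.range (m + 1)).biUnion fun m' =>
    (Finset.range (r + 1)).biUnion fun k => leftWords a h j P w m' k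
  have hT'card : T'.card ≤ (m + 1) * ((r + 1) * (m * Fintype.card ι + 1) ^ r) := by
    refine Finset.card_biUnion_le.trans ((Finset.sum_le_card_nsmul _ _
      ((r + 1) * (m * Fintype.card ι + 1) ^ r) fun m' hm' => ?_).trans_eq (by simp))
    refine Finset.card_biUnion_le.trans ((Finset.sum_le_card_nsmul _ _
      ((m * Fintype.card ι + 1) ^ r) fun k hk => ?_).trans_eq (by simp))
    rw [Finset.mem_range] at hm' hk
    calc _ ≤ m'.choose k * Fintype.card ι ^ k := card_leftWords_le a h j P w m' k
      _ ≤ m' ^ k * Fintype.card ι ^ k := by gcongr; exact Nat.choose_le_pow _ _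
      _ = (m' * Fintype.card ι) ^ k := (mul_pow _ _ _).symm
      _ ≤ (m * Fintype.card ι + 1) ^ k := by
          gcongr
          exact (Nat.mul_le_mul_right _ (by omega)).trans (Nat.le_succ _)
      _ ≤ (m * Fintype.card ι + 1) ^ r := Nat.pow_le_pow_right (by omega) (by omega)
  have hX0 : weightedWords (a + b) h s w m 0 = ∑ f ∈ T m ∩ T', f 0 * c f := by
    rw [hX]
    refine (Finset.sum_subset Finset.inter_subset_left fun f hf hf' => ?_).symm
    obtain ⟨m', hm', k, hk, hfw⟩ := (hT m f).1 hf
    rw [hvan hfw 0, zero_mul]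
    by_contra! hkr
    apply hf'
    refine Finset.mem_inter.2 ⟨hf, Finset.mem_biUnion.2 ⟨m', by simpa [Nat.lt_succ_iff] using hm',
      Finset.mem_biUnion.2 ⟨k, ?_, hfw⟩⟩⟩
    simp only [Pi.zero_apply] at hkr
    rw [Finset.mem_range]; omega
  refine ⟨(T m ∩ T').image fun f => f 0,
    fun x => ∑ f ∈ (T m ∩ T').filter (fun f => f 0 = x), c f, ?_, ?_, ?_, ?_⟩
  · exact Finset.card_image_le.trans ((Finset.card_le_card Finset.inter_subset_right).trans hT'card)
  · intro x hx
    obtain ⟨f, hf, rfl⟩ := Finset.mem_image.1 hx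
    obtain ⟨m', -, k, -, hfw⟩ := (hT m f).1 (Finset.mem_inter.1 hf).1
    exact hmem hfw 0
  · exact fun x => sum_mem fun f _ => hc f
  · rw [hX0, ← Finset.sum_fiberwise_of_maps_to (g := fun f => f 0)
      (t := (T m ∩ T').image fun f => f 0) (fun f hf => Finset.mem_image_of_mem _ hf)]
    refine Finset.sum_congr rfl fun x _ => ?_
    rw [Finset.mul_sum]
    refine Finset.sum_congr rfl fun f hf => ?_
    rw [(Finset.mem_filter.1 hf).2]

end Words
end Counting

/-! ### Schmidt ranks of powers -/

section Rank
open Polynomial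
variable {n d : ℕ} {h : Fin (n - 1) → Matrix (Fin d × Fin d) (Fin d × Fin d) ℂ}

/-- A term of the Hamiltonian splits into `d ^ 2` products across the cut between its two sites. -/
theorem exists_chainTerm_eq_sum (h : Fin (n - 1) → Matrix (Fin d × Fin d) (Fin d × Fin d) ℂ)
    (i : ℕ) : ∃ P Q : Fin d × Fin d → (SpinChain n d →L[ℂ] SpinChain n d),
      (∀ α, P α ∈ localAlg n d (Set.Iio (i + 1))) ∧ (∀ α, Q α ∈ localAlg n d (Set.Ici (i + 1))) ∧
        chainTerm h i = ∑ α, P α * Q α := by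
  rw [chainTerm]
  split_ifs with hi
  · exact ⟨fun α => unitOp (siteL ⟨i, hi⟩) α.1 α.2,
      fun α => blockOp ⟨i, hi⟩ (h ⟨i, hi⟩) α.1 α.2,
      fun α => unitOp_mem_localAlg (by simp [siteL]) _ _,
      fun α => blockOp_mem_localAlg (by simp) _ _ _, pairOp_eq_sum _ _⟩
  · exact ⟨0, 0, fun _ => zero_mem _, fun _ => zero_mem _, by simp⟩

/-- If at most `l < s * (r + 1)` letters are distributed among `s` places, there is a first place
which receives at most `r` of them. -/
theorem sum_firstSparse_eq_one {R : Type*} [Ring R] {s r l : ℕ} (hsr : l < s * (r + 1))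
    (κ : ℕ → ℕ) (hκ : ∑ q ∈ Finset.range s, κ q ≤ l) :
    ∑ j ∈ Finset.range s, (if κ j ≤ r ∧ ∀ q < j, r < κ q then 1 else 0 : R) = 1 := by
  have hex : ∃ j, j < s ∧ κ j ≤ r := by
    by_contra! hcon
    have h1 : ∑ q ∈ Finset.range s, (r + 1) ≤ ∑ q ∈ Finset.range s, κ q :=
      Finset.sum_le_sum fun q hq => hcon q (Finset.mem_range.1 hq)
    simp only [Finset.sum_const, Finset.card_range, smul_eq_mul] at h1
    omega
  classical
  have hspec := Nat.find_spec hex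
  rw [Finset.sum_eq_single (Nat.find hex)]
  · rw [if_pos]
    refine ⟨hspec.2, fun q hq => ?_⟩
    have := Nat.find_min hex hq
    by_contra! hq'
    exact this ⟨hq.trans hspec.1, hq'⟩
  · intro j hj hne
    rw [if_neg]
    rintro ⟨hj1, hj2⟩
    rcases lt_or_gt_of_ne hne with hlt | hgt
    · exact Nat.find_min hex hlt ⟨Finset.mem_range.1 hj, hj1⟩
    · exact absurd hspec.2 (not_le.2 (hj2 _ hgt))
  · intro hn
    exact absurd (Finset.mem_range.2 hspec.1) hn

/-- A bound for the Schmidt rank of powers of a sum in which only `s` chain terms act across the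
region where the cut can be placed. The words are sorted by the first window term which occurs at most
`r` times; for these words the cut is moved to that term and back. -/
theorem SchmidtLE.pow_apply (hd : 0 < d) {a b : SpinChain n d →L[ℂ] SpinChain n d} {k s r l m N : ℕ}
    (ha : a ∈ localAlg n d (Set.Iio (k + 1))) (hb : b ∈ localAlg n d (Set.Ici (k + s)))
    (hsr : l < s * (r + 1)) (hm : m ≤ l) {φ : SpinChain n d} (hφ : SchmidtLE (k + 1) N φ) :
    SchmidtLE (k + 1) (s * ((l + 1) * ((r + 1) * (l * (d * d) + 1) ^ r) * (N * d ^ s) * d ^ s))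
      (((a + b + ∑ q ∈ Finset.range s, chainTerm h (k + q)) ^ m) φ) := by
  set w : ℕ → (ℕ → ℕ) → (SpinChain n d →L[ℂ] SpinChain n d) := fun j κ =>
    if κ j ≤ r ∧ ∀ q < j, r < κ q then 1 else 0 with hw
  rw [← sum_weightedWords (h := fun q => chainTerm h (k + q)) (l := l) (w := w)
    (fun κ hκ => sum_firstSparse_eq_one hsr κ hκ) m 0 (by simpa using hm), sum_apply]
  have key : ∀ j ∈ Finset.range s, SchmidtLE (k + 1)
      ((l + 1) * ((r + 1) * (l * (d * d) + 1) ^ r) * (N * d ^ s) * d ^ s)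
      (weightedWords (a + b) (fun q => chainTerm h (k + q)) s (w j) m 0 φ) := by
    intro j hj
    have hj := Finset.mem_range.1 hj
    obtain ⟨P, Q, hP, hQ, hPQ⟩ := exists_chainTerm_eq_sum h (k + j)
    have hcomm : ∀ x ∈ (localAlg n d (Set.Iio (k + j + 1))).toSubring,
        ∀ y ∈ (localAlg n d (Set.Ici (k + j + 1))).toSubring, x * y = y * x := fun x hx y hy =>
      localAlg_commute (Set.Iio_disjoint_Ici le_rfl)
        (Subalgebra.mem_toSubring.1 hx) (Subalgebra.mem_toSubring.1 hy)
    have ha' : a ∈ (localAlg n d (Set.Iio (k + j + 1))).toSubring := Subalgebra.mem_toSubring.2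
      (localAlg_mono (Set.Iio_subset_Iio (by omega)) ha)
    have hb' : b ∈ (localAlg n d (Set.Ici (k + j + 1))).toSubring := Subalgebra.mem_toSubring.2
      (localAlg_mono (Set.Ici_subset_Ici.2 (by omega)) hb)
    have hl : ∀ q < j, chainTerm h (k + q) ∈ (localAlg n d (Set.Iio (k + j + 1))).toSubring :=
      fun q hq => Subalgebra.mem_toSubring.2 (chainTerm_mem_localAlg
        (by simp only [Set.mem_Iio]; omega) (by simp only [Set.mem_Iio]; omega))
    have hr : ∀ q, j < q → chainTerm h (k + q) ∈ (localAlg n d (Set.Ici (k + j + 1))).toSubring :=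
      fun q hq => Subalgebra.mem_toSubring.2 (chainTerm_mem_localAlg
        (by simp only [Set.mem_Ici]; omega) (by simp only [Set.mem_Ici]; omega))
    have hwL : ∀ κ, w j κ ∈ (localAlg n d (Set.Iio (k + j + 1))).toSubring := fun κ => by
      simp only [hw]
      split_ifs
      exacts [one_mem _, zero_mem _]
    have hwr : ∀ κ q, j < q → w j (κ + Pi.single q 1) = w j κ := fun κ q hq => by
      have h1 : ∀ i, i ≤ j → (κ + Pi.single q 1 : ℕ → ℕ) i = κ i := fun i hi => by
        have : i ≠ q := by omega
        simp [this]
      have h2 : ((κ + Pi.single q 1 : ℕ → ℕ) j ≤ r ∧ ∀ i < j, r < (κ + Pi.single q 1 : ℕ → ℕ) i) ↔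
          (κ j ≤ r ∧ ∀ i < j, r < κ i) := by
        rw [h1 j le_rfl]
        exact and_congr_right fun _ => forall₂_congr fun i hi => by rw [h1 i hi.le]
      simp only [hw, h2]
    have hw0 : ∀ κ : ℕ → ℕ, r < κ j → w j κ = 0 := fun κ hκ => by
      simp only [hw]
      rw [if_neg fun h => absurd h.1 (not_le.2 hκ)]
    obtain ⟨S, c, hS, hSL, hcR, heq⟩ := exists_weightedWords_eq (h := fun q => chainTerm h (k + q))
      (s := s) hcomm hj ha' hb' hl hr (fun α => Subalgebra.mem_toSubring.2 (hP α))
      (fun α => Subalgebra.mem_toSubring.2 (hQ α)) hPQ hwL hwr hw0 m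
    rw [heq, sum_apply]
    have hφj : SchmidtLE (k + j + 1) (N * d ^ s) φ := by
      have := (hφ.add_cut hd j).mono (Nat.mul_le_mul_left N (Nat.pow_le_pow_right hd hj.le))
      rwa [show k + 1 + j = k + j + 1 by ring] at this
    have h1 : SchmidtLE (k + j + 1) (S.card * (N * d ^ s)) (∑ x ∈ S, (x * c x) φ) :=
      SchmidtLE.sum S fun x hx => (hφj.apply_right (hcR x)).apply_left (hSL x hx)
    rw [show k + j + 1 = k + 1 + j by ring] at h1
    refine (h1.sub_cut hd j).mono ?_
    have hcard : S.card ≤ (l + 1) * ((r + 1) * (l * (d * d) + 1) ^ r) := by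
      refine hS.trans ?_
      simp only [Fintype.card_prod, Fintype.card_fin]
      gcongr
    gcongr
  have := SchmidtLE.sum (Finset.range s) key
  rwa [Finset.card_range] at this

theorem SchmidtLE.aeval_apply (hd : 0 < d) {a b : SpinChain n d →L[ℂ] SpinChain n d}
    {k s r l N : ℕ} (ha : a ∈ localAlg n d (Set.Iio (k + 1)))
    (hb : b ∈ localAlg n d (Set.Ici (k + s))) (hsr : l < s * (r + 1)) {p : ℝ[X]}
    (hp : p.natDegree ≤ l) {φ : SpinChain n d} (hφ : SchmidtLE (k + 1) N φ) :
    SchmidtLE (k + 1)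
      ((l + 1) * (s * ((l + 1) * ((r + 1) * (l * (d * d) + 1) ^ r) * (N * d ^ s) * d ^ s)))
      (aeval (a + b + ∑ q ∈ Finset.range s, chainTerm h (k + q)) p φ) := by
  rw [aeval_eq_sum_range' (Nat.lt_succ_of_le hp), sum_apply]
  have := SchmidtLE.sum (Finset.range (l + 1)) (c := k + 1)
    (x := fun m => (p.coeff m • (a + b + ∑ q ∈ Finset.range s, chainTerm h (k + q)) ^ m) φ)
    (fun m hm => by
      have h1 := SchmidtLE.pow_apply (h := h) hd ha hb hsr (Nat.lt_succ_iff.1 (Finset.mem_range.1 hm)) hφ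
      have h2 := h1.smul (p.coeff m : ℂ)
      rwa [Complex.coe_smul] at h2)
  rwa [Finset.card_range] at this
end Rank

/-! ### Approximation across one cut -/

section Trunc
variable {E : Type*} [NormedAddCommGroup E] [InnerProductSpace ℂ E] [FiniteDimensional ℂ E]
variable {A : E →L[ℂ] E}

theorem energyTrunc_le (hA : IsSelfAdjoint A) (t : ℝ) : energyTrunc A t ≤ A := by
  conv_rhs => rw [← cfc_id ℝ A hA]
  exact cfc_mono fun x _ => min_le_left x t

theorem energyTrunc_le_algebraMap (hA : IsSelfAdjoint A) (t : ℝ) :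
    energyTrunc A t ≤ algebraMap ℝ _ t :=
  cfc_le_algebraMap _ _ _ fun x _ => min_le_right x t

theorem energyTrunc_nonneg (hA : 0 ≤ A) {t : ℝ} (ht : 0 ≤ t) : 0 ≤ energyTrunc A t :=
  cfc_nonneg fun _ hx => le_min (spectrum_nonneg_of_nonneg hA hx) ht

theorem sub_algebraMap_apply {a : ℝ} {u : E} (h : A u = (a : ℂ) • u) (e : ℝ) :
    (A - algebraMap ℝ _ e) u = ((a - e : ℝ) : ℂ) • u := by
  rw [_root_.sub_apply, h, Algebra.algebraMap_eq_smul_one, ← Complex.coe_smul, Complex.ofReal_sub,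
    sub_smul]
  rfl

end Trunc

section Approx
open Polynomial
variable {n d : ℕ} {h : Fin (n - 1) → Matrix (Fin d × Fin d) (Fin d × Fin d) ℂ}

theorem chainTerm_of_le {i : ℕ} (hi : n - 1 ≤ i) : chainTerm h i = 0 := by
  rw [chainTerm, dif_neg (not_lt.2 hi)]

theorem sum_chainTerm_nonneg (hh : ∀ i, (h i).PosSemidef ∧ (1 - h i).PosSemidef) (I : Finset ℕ) :
    0 ≤ ∑ i ∈ I, chainTerm h i :=
  Finset.sum_nonneg fun i _ => chainTerm_nonneg hh i

theorem sum_chainTerm_le (hh : ∀ i, (h i).PosSemidef ∧ (1 - h i).PosSemidef) (I : Finset ℕ) :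
    ∑ i ∈ I, chainTerm h i ≤ algebraMap ℝ _ (I.card : ℝ) := by
  refine (Finset.sum_le_card_nsmul I _ 1 fun i _ => chainTerm_le_one hh i).trans_eq ?_
  rw [map_natCast, nsmul_one]

theorem energy_chainTerm_le (hh : ∀ i, (h i).PosSemidef ∧ (1 - h i).PosSemidef) (i : ℕ)
    (x : SpinChain n d) : energy (chainTerm h i) x ≤ ‖x‖ ^ 2 := by
  have := energy_mono (chainTerm_le_one hh i) x
  rwa [← map_one (algebraMap ℝ _), energy_algebraMap, one_mul] at this

/-- The two parts of the chain next to a window of terms, and the interior of the window, have a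
common ground state; hence the energies of these three parts, plus the two terms which join them,
bound the ground state energy of the chain. -/
theorem ground_le_of_parts (hh : ∀ i, (h i).PosSemidef ∧ (1 - h i).PosSemidef) {k s : ℕ}
    {E₀ eL eM eR : ℝ} {uL uM uR : SpinChain n d} (hu : uL ≠ 0) (hv : uM ≠ 0) (hw : uR ≠ 0)
    {AL M AR : SpinChain n d →L[ℂ] SpinChain n d}
    (hAL : AL ∈ localAlg n d (Set.Iio (k + 1))) (hM : M ∈ localAlg n d (Set.Ico (k + 1) (k + s)))
    (hAR : AR ∈ localAlg n d (Set.Ici (k + s))) (hL : AL uL = (eL : ℂ) • uL)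
    (hMu : M uM = (eM : ℂ) • uM) (hR : AR uR = (eR : ℂ) • uR) (hs : 1 ≤ s) (i j : ℕ)
    (hE : algebraMap ℝ _ E₀ ≤ AL + M + AR + (chainTerm h i + chainTerm h j)) :
    E₀ ≤ eL + eM + eR + 2 := by
  obtain ⟨y, hy0, hyL, hy⟩ := exists_joint_eigenvector hAL hu hL hw
  have hyR : AR y = (eR : ℂ) • y := hy _ (localAlg_mono (fun q hq => by
    simp only [Set.mem_Ici, Set.mem_compl_iff, Set.mem_Iio] at hq ⊢; omega) hAR) _ hR
  obtain ⟨x, hx0, hxM, hx⟩ := exists_joint_eigenvector hM hv hMu hy0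
  have hxL : AL x = (eL : ℂ) • x := hx _ (localAlg_mono (fun q hq => by
    simp only [Set.mem_compl_iff, Set.mem_Iio, Set.mem_Ico] at hq ⊢; omega) hAL) _ hyL
  have hxR : AR x = (eR : ℂ) • x := hx _ (localAlg_mono (fun q hq => by
    simp only [Set.mem_Ici, Set.mem_compl_iff, Set.mem_Ico] at hq ⊢; omega) hAR) _ hyR
  have h1 := energy_mono hE x
  rw [energy_algebraMap, energy_add, energy_add, energy_add, energy_add, energy_eigenvector hxL,
    energy_eigenvector hxM, energy_eigenvector hxR] at h1
  have h2 := energy_chainTerm_le hh i x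
  have h3 := energy_chainTerm_le hh j x
  have h4 : 0 < ‖x‖ ^ 2 := by positivity
  nlinarith

/-- `energy_sub_energyTrunc_le` for a part of the chain above its ground state energy `e`, with the
constants `s = 1 / 12` and `G = 6`. -/
theorem energy_sub_energyTrunc_chain_le (hh : ∀ i, (h i).PosSemidef ∧ (1 - h i).PosSemidef)
    {I : Finset ℕ} (hI : I.card ≤ n) (hn : 0 < n) {e c₀ lam t : ℝ} (he : 0 ≤ e) (j : ℕ)
    {A C : SpinChain n d →L[ℂ] SpinChain n d} (hA : A = ∑ i ∈ I, chainTerm h i - algebraMap ℝ _ e)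
    (hA0 : 0 ≤ A) (hAC : Commute A C) (hC : algebraMap ℝ _ c₀ ≤ C) {φ : SpinChain n d}
    (hφ : (energyTrunc A t + chainTerm h j + C) φ = (lam : ℂ) • φ) (hφ1 : ‖φ‖ = 1)
    (hlam : lam ≤ c₀ + 3) (ht : 12 ≤ t) :
    energy (A - energyTrunc A t) φ ≤ n * Real.exp ((6 - t) / 6) := by
  have hAN : A ≤ algebraMap ℝ _ (n : ℝ) := by
    rw [hA]
    refine (sub_le_self _ (algebraMap_nonneg _ he)).trans ((sum_chainTerm_le hh I).trans ?_)
    exact algebraMap_mono _ (by exact_mod_cast hI)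
  have hconj := norm_exp_conj_chainTerm_le hh I j e
  rw [← hA] at hconj
  have := energy_sub_energyTrunc_le (t := t) (G := 6) hA0 hAN (by exact_mod_cast hn)
    (by norm_num) (norm_chainTerm_le hh j) hconj hAC hC hφ hφ1
    (by linarith) (by norm_num) (by linarith)
  refine this.trans_eq ?_
  congr 2
  ring

set_option maxHeartbeats 800000 in
/-- The ground state of the chain is close to a vector of bounded Schmidt rank across the cut after
the site `k`: the parts of the chain outside of a window of `s` terms are truncated at energy `t`
above their ground state energies, and a Chebyshev polynomial of degree `l` of the truncated
Hamiltonian is an approximate projection on its ground state. -/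
theorem exists_schmidtLE_near_ground (hd : 0 < d)
    (hh : ∀ i, (h i).PosSemidef ∧ (1 - h i).PosSemidef) {Γ : SpinChain n d} {E₀ ε t : ℝ}
    (hΓ1 : ‖Γ‖ = 1) (hΓ : (∑ i ∈ Finset.range (n - 1), chainTerm h i) Γ = (E₀ : ℂ) • Γ)
    (hE₀ : algebraMap ℝ _ E₀ ≤ ∑ i ∈ Finset.range (n - 1), chainTerm h i)
    (hε : 0 < ε) (hε1 : ε ≤ 1)
    (hgap : ∀ x, inner ℂ Γ x = 0 →
      (E₀ + ε) * ‖x‖ ^ 2 ≤ energy (∑ i ∈ Finset.range (n - 1), chainTerm h i) x)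
    {k s l r D : ℕ} (hk : k < n) (hs : 2 ≤ s) (ht : 12 ≤ t) (hsr : l < s * (r + 1))
    (hD : D = (l + 1) * (s * ((l + 1) * ((r + 1) * (l * (d * d) + 1) ^ r) * (1 * d ^ s) * d ^ s)))
    {η δ : ℝ} (hη : η = 2 * (n * Real.exp ((6 - t) / 6))) (hηε : 4 * η < ε)
    (hδ : δ = 2 * Real.exp (-(l * √(ε / 2 / (2 * t + s + 1))))) (hDδ : D * δ ^ 2 ≤ 1 / 4) :
    ∃ ψ, SchmidtLE (k + 1) D ψ ∧ ‖ψ - Γ‖ ≤ √(η / ε) + 2 * √D * δ := by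
  have hΓ0 : Γ ≠ 0 := by rintro rfl; simp at hΓ1
  have : Nontrivial (SpinChain n d) := ⟨Γ, 0, hΓ0⟩
  set IL := Finset.range k
  set IM := Finset.Ico (k + 1) (k + s - 1)
  set IR := Finset.Ico (k + s) (k + s + n)
  have hsa : ∀ I : Finset ℕ, IsSelfAdjoint (∑ i ∈ I, chainTerm h i) := fun I =>
    (sum_chainTerm_nonneg hh I).isSelfAdjoint
  obtain ⟨eL, uL, huL, hL, hLle⟩ := exists_ground (hsa IL)
  obtain ⟨eM, uM, huM, hM, hMle⟩ := exists_ground (hsa IM)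
  obtain ⟨eR, uR, huR, hR, hRle⟩ := exists_ground (hsa IR)
  have hpos : ∀ {I : Finset ℕ} {u : SpinChain n d} {e : ℝ}, ‖u‖ = 1 →
      (∑ i ∈ I, chainTerm h i) u = (e : ℂ) • u → 0 ≤ e := by
    intro I u e hu he
    have h1 := energy_mono (sum_chainTerm_nonneg hh I) u
    rw [energy_eigenvector he, hu] at h1
    simpa [energy] using h1
  have heL := hpos huL hL
  have heR := hpos huR hR
  have hne : ∀ {u : SpinChain n d}, ‖u‖ = 1 → u ≠ 0 := by rintro u hu rfl; simp at hu
  set VL := chainTerm h k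
  set VR := chainTerm h (k + s - 1)
  set M := ∑ i ∈ IM, chainTerm h i with hMdef
  set W := ∑ q ∈ Finset.range s, chainTerm h (k + q) with hW
  set AL := ∑ i ∈ IL, chainTerm h i - algebraMap ℝ _ eL with hAL
  set AR := ∑ i ∈ IR, chainTerm h i - algebraMap ℝ _ eR with hAR
  -- the terms `VL`, `VR` at the ends of the window are those which do not commute with the parts
  have hWsum : W = VL + M + VR := by
    have h1 := Finset.sum_Ico_consecutive (chainTerm h) (show k ≤ k + 1 by omega)
      (show k + 1 ≤ k + s - 1 by omega)
    have h2 := Finset.sum_Ico_consecutive (chainTerm h) (show k ≤ k + s - 1 by omega)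
      (show k + s - 1 ≤ k + s by omega)
    have h3 := Finset.sum_Ico_eq_sum_range (chainTerm h) k (k + s)
    rw [Nat.Ico_succ_singleton, Finset.sum_singleton] at h1
    rw [show Finset.Ico (k + s - 1) (k + s) = {k + s - 1} by
      rw [← Nat.Ico_succ_singleton]; congr 1; omega, Finset.sum_singleton, ← h1, h3,
      Nat.add_sub_cancel_left] at h2
    exact h2.symm
  have hHsum : ∑ i ∈ Finset.range (n - 1), chainTerm h i
      = AL + W + AR + algebraMap ℝ _ (eL + eR) := by
    have h1 : ∑ i ∈ Finset.range (n - 1), chainTerm h i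
        = ∑ i ∈ Finset.range (k + s + n), chainTerm h i :=
      Finset.sum_subset (Finset.range_subset_range.2 (by omega)) fun i _ hi =>
        chainTerm_of_le (by simpa using hi)
    have h2 := Finset.sum_Ico_consecutive (chainTerm h) (Nat.zero_le k) (show k ≤ k + s by omega)
    have h3 := Finset.sum_Ico_consecutive (chainTerm h) (Nat.zero_le (k + s))
      (show k + s ≤ k + s + n by omega)
    have h4 := Finset.sum_Ico_eq_sum_range (chainTerm h) k (k + s)
    rw [Nat.add_sub_cancel_left] at h4
    rw [h1, Finset.range_eq_Ico, ← h3, ← h2, h4, hAL, hAR, ← Finset.range_eq_Ico, map_add]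
    abel
  set H' := AL + W + AR with hH'
  have hAL0 : 0 ≤ AL := sub_nonneg.2 hLle
  have hAR0 : 0 ≤ AR := sub_nonneg.2 hRle
  have hALmem : AL ∈ localAlg n d (Set.Iio (k + 1)) := by
    refine sub_mem (sum_mem fun i hi => ?_) (by
      rw [IsScalarTower.algebraMap_apply ℝ ℂ]; exact Subalgebra.algebraMap_mem _ _)
    have := Finset.mem_range.1 hi
    exact chainTerm_mem_localAlg (by simp only [Set.mem_Iio]; omega) (by simp only [Set.mem_Iio]; omega)
  have hARmem : AR ∈ localAlg n d (Set.Ici (k + s)) := by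
    refine sub_mem (sum_mem fun i hi => ?_) (by
      rw [IsScalarTower.algebraMap_apply ℝ ℂ]; exact Subalgebra.algebraMap_mem _ _)
    have := Finset.mem_Ico.1 hi
    exact chainTerm_mem_localAlg (by simp only [Set.mem_Ici]; omega) (by simp only [Set.mem_Ici]; omega)
  have hMmem : M ∈ localAlg n d (Set.Ico (k + 1) (k + s)) := by
    refine sum_mem fun i hi => ?_
    have := Finset.mem_Ico.1 hi
    exact chainTerm_mem_localAlg (by simp only [Set.mem_Ico]; omega) (by simp only [Set.mem_Ico]; omega)
  -- thus the low energy eigenvectors have a bounded energy above that of the window interior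
  have hE₀M : E₀ - (eL + eR) ≤ eM + 2 := by
    have hLA := sub_algebraMap_apply hL eL
    have hRA := sub_algebraMap_apply hR eR
    rw [← hAL, sub_self] at hLA
    rw [← hAR, sub_self] at hRA
    have := ground_le_of_parts (E₀ := E₀ - (eL + eR)) hh (hne huL) (hne huM) (hne huR) hALmem hMmem
      hARmem hLA hM hRA (by omega) k (k + s - 1) (by
        rw [map_sub, sub_le_iff_le_add]
        refine hE₀.trans_eq ?_
        rw [hHsum, hH', hWsum]
        abel)
    linarith
  set T := energyTrunc AL t + energyTrunc AR t + W with hT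
  have hTL0 := energyTrunc_nonneg hAL0 (t := t) (by linarith)
  have hTR0 := energyTrunc_nonneg hAR0 (t := t) (by linarith)
  have hW0 : 0 ≤ W := Finset.sum_nonneg fun i _ => chainTerm_nonneg hh _
  have hT0 : 0 ≤ T := add_nonneg (add_nonneg hTL0 hTR0) hW0
  have hVL0 : 0 ≤ VL := chainTerm_nonneg hh _
  have hVR0 : 0 ≤ VR := chainTerm_nonneg hh _
  have hTLmem : energyTrunc AL t ∈ localAlg n d (Set.Iio (k + 1)) := cfc_mem_localAlg hALmem _
  have hTRmem : energyTrunc AR t ∈ localAlg n d (Set.Ici (k + s)) := cfc_mem_localAlg hARmem _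
  have hTH : T ≤ H' := by
    have h1 := add_le_add (add_le_add (energyTrunc_le hAL0.isSelfAdjoint t)
      (energyTrunc_le hAR0.isSelfAdjoint t)) le_rfl (c := W) (d := W)
    refine h1.trans_eq ?_
    rw [hH']; abel
  have hTB : T ≤ algebraMap ℝ _ (2 * t + s) := by
    have h1 : W ≤ algebraMap ℝ _ (s : ℝ) := by
      refine (Finset.sum_le_card_nsmul _ _ 1 fun i _ => chainTerm_le_one hh _).trans_eq ?_
      rw [map_natCast, nsmul_one, Finset.card_range]
    have h2 := add_le_add (add_le_add (energyTrunc_le_algebraMap hAL0.isSelfAdjoint t)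
      (energyTrunc_le_algebraMap hAR0.isSelfAdjoint t)) h1
    refine h2.trans_eq ?_
    rw [← map_add, ← map_add]; congr 1; ring
  have hHE : ∀ x, energy (∑ i ∈ Finset.range (n - 1), chainTerm h i) x
      = energy H' x + (eL + eR) * ‖x‖ ^ 2 := fun x => by
    rw [hHsum, energy_add, energy_algebraMap]
  have hdisj : Disjoint (Set.Iio (k + 1)) (Set.Ici (k + 1)) := Set.Iio_disjoint_Ici le_rfl
  have hdisj2 : Disjoint (Set.Ici (k + s)) (Set.Iio (k + s)) := (Set.Iio_disjoint_Ici le_rfl).symm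
  obtain ⟨e, Γ', hΓ'1, hTΓ', hclose, hK⟩ := ground_of_le (H := H') (T := T) (Γ := Γ)
    (E₀ := E₀ - (eL + eR)) (ε := ε) (η := η)
    (add_nonneg (add_nonneg hAL0 hW0) hAR0).isSelfAdjoint hT0.isSelfAdjoint hTH hΓ1
    (by
      have h1 : H' = ∑ i ∈ Finset.range (n - 1), chainTerm h i - algebraMap ℝ _ (eL + eR) := by
        rw [hHsum]; abel
      rw [h1]; exact sub_algebraMap_apply hΓ _)
    hε
    (fun x hx => by
      have := hgap x hx
      rw [hHE] at this
      linarith)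
    (fun φ lam hφ1 hφ hlam => by
      have h1 : H' - T = (AL - energyTrunc AL t) + (AR - energyTrunc AR t) := by
        rw [hH', hT]; abel
      have hL := energy_sub_energyTrunc_chain_le hh (I := IL) (c₀ := eM) (A := AL) (t := t)
        (C := M + VR + energyTrunc AR t) (φ := φ) (lam := lam) (by simp [IL, hk.le]) (by omega) heL k
        hAL hAL0
        (localAlg_commute hdisj hALmem (add_mem (add_mem (localAlg_mono (fun q hq => by
            simp only [Set.mem_Ico, Set.mem_Ici] at hq ⊢; omega) hMmem)
          (chainTerm_mem_localAlg (by simp only [Set.mem_Ici]; omega)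
            (by simp only [Set.mem_Ici]; omega)))
          (localAlg_mono (Set.Ici_subset_Ici.2 (by omega)) hTRmem)))
        (by rw [add_assoc]; exact hMle.trans (le_add_of_nonneg_right (add_nonneg hVR0 hTR0)))
        (by rw [← hφ, hT, hWsum]; congr 1; abel) hφ1 (by linarith) ht
      have hR := energy_sub_energyTrunc_chain_le hh (I := IR) (c₀ := eM) (A := AR) (t := t)
        (C := M + VL + energyTrunc AL t) (φ := φ) (lam := lam) (by simp [IR]) (by omega) heR
        (k + s - 1) hAR hAR0
        (localAlg_commute hdisj2 hARmem (add_mem (add_mem (localAlg_mono (fun q hq => by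
            simp only [Set.mem_Ico, Set.mem_Iio] at hq ⊢; omega) hMmem)
          (chainTerm_mem_localAlg (by simp only [Set.mem_Iio]; omega)
            (by simp only [Set.mem_Iio]; omega)))
          (localAlg_mono (Set.Iio_subset_Iio (by omega)) hTLmem)))
        (by rw [add_assoc]; exact hMle.trans (le_add_of_nonneg_right (add_nonneg hVL0 hTL0)))
        (by rw [← hφ, hT, hWsum]; congr 1; abel) hφ1 (by linarith) ht
      rw [h1, energy_add, hη]
      linarith)
    hηε
  have he0 : 0 ≤ e := by
    have h1 := energy_mono hT0 Γ'
    rw [energy_eigenvector hTΓ', hΓ'1] at h1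
    simpa [energy] using h1
  have heB : e ≤ 2 * t + s := by
    have h1 := energy_mono hTB Γ'
    rw [energy_eigenvector hTΓ', energy_algebraMap, hΓ'1] at h1
    linarith
  obtain ⟨p, hpdeg, hpe, hpδ⟩ := exists_polynomial_small_on_Icc l (e := e) (g := ε / 2)
    (b := 2 * t + s + 1) (by linarith) he0 (by linarith)
  have hδ0 : 0 ≤ δ := by rw [hδ]; positivity
  obtain ⟨hKΓ, hKx⟩ := hK p δ (2 * t + s) hδ0 hpe hTB fun x h1 h2 => by
    rw [hδ]; exact hpδ x h1 (by linarith)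
  have hD1 : 1 ≤ D := by
    rw [hD]
    exact Nat.succ_le_of_lt (by positivity)
  obtain ⟨ψ, hψ, hψΓ⟩ := exists_schmidtLE_approx hd (c := k + 1) (D := D) hδ0 hΓ'1 hKΓ hKx
    (fun φ hφ => by
      rw [hD, hT]
      exact SchmidtLE.aeval_apply hd hTLmem hTRmem hsr hpdeg hφ) hD1 hDδ
  refine ⟨inner ℂ Γ' Γ • ψ, hψ.smul _, ?_⟩
  have hα : ‖(inner ℂ Γ' Γ : ℂ)‖ ≤ 1 := by
    have := norm_inner_le_norm (𝕜 := ℂ) Γ' Γ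
    rwa [hΓ'1, hΓ1, one_mul] at this
  have h1 : inner ℂ Γ' Γ • ψ - Γ = inner ℂ Γ' Γ • (ψ - Γ') - (Γ - inner ℂ Γ' Γ • Γ') := by
    rw [smul_sub]; abel
  rw [h1]
  refine (norm_sub_le _ _).trans ?_
  rw [add_comm, norm_smul]
  refine add_le_add (Real.le_sqrt_of_sq_le hclose) ?_
  calc _ ≤ 1 * (2 * √D * δ) := mul_le_mul hα hψΓ (norm_nonneg _) zero_le_one
    _ = _ := one_mul _

end Approx

/-! ### The spectral gap -/

section Gap
variable {n d : ℕ} {h : Fin (n - 1) → Matrix (Fin d × Fin d) (Fin d × Fin d) ℂ}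
variable {Γ : SpinChain n d} {E₀ E₁ : ℝ} {H : SpinChain n d →L[ℂ] SpinChain n d}

theorem IsGappedGroundState.lt (hΓ : IsGappedGroundState H.toLinearMap Γ E₀ E₁) : E₀ < E₁ :=
  lt_of_le_of_ne (hΓ.isLeast_ground.2 hΓ.isLeast_excited.1.1) hΓ.isLeast_excited.1.2.symm

theorem IsGappedGroundState.apply_eq (hΓ : IsGappedGroundState H.toLinearMap Γ E₀ E₁) :
    H Γ = (E₀ : ℂ) • Γ := Module.End.mem_eigenspace_iff.1 hΓ.mem_eigenspace

theorem hasEigenvalue_of_apply_eq {b : SpinChain n d} {lam : ℝ} (hb : H b = (lam : ℂ) • b)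
    (hb1 : b ≠ 0) : Module.End.HasEigenvalue H.toLinearMap (lam : ℂ) :=
  Module.End.hasEigenvalue_of_hasEigenvector ⟨Module.End.mem_eigenspace_iff.2 hb, hb1⟩

theorem IsGappedGroundState.algebraMap_le (hΓ : IsGappedGroundState H.toLinearMap Γ E₀ E₁)
    (hH : IsSelfAdjoint H) : algebraMap ℝ _ E₀ ≤ H := by
  obtain ⟨b, lam, hb⟩ := exists_eigenbasis hH
  refine algebraMap_le_of_energy hH fun x => le_energy_of_forall hH hb fun i _ => ?_
  exact hΓ.isLeast_ground.2 (hasEigenvalue_of_apply_eq (hb i) (b.orthonormal.ne_zero i))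

/-- An eigenvector with eigenvalue `E₀` is a multiple of `Γ`, so only the eigenvalues from `E₁` on
contribute to vectors orthogonal to `Γ`. -/
theorem IsGappedGroundState.le_energy (hΓ : IsGappedGroundState H.toLinearMap Γ E₀ E₁)
    (hH : IsSelfAdjoint H) {x : SpinChain n d} (hx : inner ℂ Γ x = 0) :
    E₁ * ‖x‖ ^ 2 ≤ energy H x := by
  obtain ⟨b, lam, hb⟩ := exists_eigenbasis hH
  refine le_energy_of_forall hH hb fun i hi => ?_
  refine hΓ.isLeast_excited.2 ⟨hasEigenvalue_of_apply_eq (hb i) (b.orthonormal.ne_zero i), ?_⟩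
  intro hlam
  have hΓ0 : Γ ≠ 0 := by rintro rfl; simpa using hΓ.norm_eq_one
  obtain ⟨c, hc⟩ := (finrank_eq_one_iff_of_nonzero'
    (⟨Γ, hΓ.mem_eigenspace⟩ : Module.End.eigenspace H.toLinearMap (E₀ : ℂ))
    (by simpa using hΓ0)).1 hΓ.simple ⟨b i, Module.End.mem_eigenspace_iff.2 (hlam ▸ hb i)⟩
  have hc' : c • Γ = b i := congrArg Subtype.val hc
  apply hi
  rw [← hc', inner_smul_left, hx, mul_zero]

theorem IsGappedGroundState.two_le
    (hΓ : IsGappedGroundState H.toLinearMap Γ E₀ E₁) : 2 ≤ d := by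
  by_contra! hd
  have hfin : Module.finrank ℂ (SpinChain n d) ≤ 1 := by
    rw [finrank_euclideanSpace]
    simp only [Fintype.card_pi, Fintype.card_fin, Finset.prod_const, Finset.card_univ]
    exact pow_le_one₀ (Nat.zero_le _) (by omega)
  have htop : Module.End.eigenspace H.toLinearMap (E₀ : ℂ) = ⊤ :=
    Submodule.eq_top_of_finrank_eq (le_antisymm (Submodule.finrank_le _)
      (hfin.trans_eq hΓ.simple.symm))
  obtain ⟨v, hv, hv0⟩ := hΓ.isLeast_excited.1.1.exists_hasEigenvector
  have h1 : v ∈ Module.End.eigenspace H.toLinearMap (E₀ : ℂ) := htop ▸ Submodule.mem_top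
  have h2 := (Module.End.mem_eigenspace_iff.1 hv).symm.trans (Module.End.mem_eigenspace_iff.1 h1)
  exact hΓ.isLeast_excited.1.2 (by exact_mod_cast smul_left_injective ℂ hv0 h2)

/-- The gap is at most one: the ground states of the chain without its first particle form a space
of dimension at least `d ≥ 2`, on which the energy exceeds `E₀` by at most the norm of the first
term. -/
theorem IsGappedGroundState.le_add_one (hn : 2 ≤ n)
    (hh : ∀ i, (h i).PosSemidef ∧ (1 - h i).PosSemidef)
    (hΓ : IsGappedGroundState
      (∑ i ∈ Finset.range (n - 1), chainTerm h i).toLinearMap Γ E₀ E₁) : E₁ ≤ E₀ + 1 := by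
  have hd := hΓ.two_le
  have hΓ0 : Γ ≠ 0 := by rintro rfl; simpa using hΓ.norm_eq_one
  have : Nontrivial (SpinChain n d) := ⟨Γ, 0, hΓ0⟩
  set R := ∑ i ∈ Finset.Ico 1 (n - 1), chainTerm h i with hR
  have hsum : ∑ i ∈ Finset.range (n - 1), chainTerm h i = chainTerm h 0 + R := by
    rw [hR, Finset.range_eq_Ico, Finset.sum_eq_sum_Ico_succ_bot (by omega)]
  obtain ⟨e, u, hu1, hu, heR⟩ := exists_ground (sum_chainTerm_nonneg hh (Finset.Ico 1 (n - 1))).isSelfAdjoint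
  rw [← hR] at hu heR
  have heE : e ≤ E₀ := by
    have h1 := energy_mono (heR.trans (le_add_of_nonneg_left (chainTerm_nonneg hh 0))) Γ
    rw [← hsum, energy_eigenvector hΓ.apply_eq, energy_algebraMap, hΓ.norm_eq_one] at h1
    linarith
  have hmain : ∀ x, R x = (e : ℂ) • x → x ≠ 0 → inner ℂ Γ x = 0 → E₁ ≤ E₀ + 1 := by
    intro x hx hx0 hxΓ
    have h1 := hΓ.le_energy (sum_chainTerm_nonneg hh _).isSelfAdjoint hxΓ
    rw [hsum, energy_add, energy_eigenvector hx] at h1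
    have h2 := energy_chainTerm_le hh 0 x
    have h3 : 0 < ‖x‖ ^ 2 := by positivity
    nlinarith
  obtain ⟨σ, hσ⟩ : ∃ σ, u σ ≠ 0 := by
    by_contra! hcon
    have : u = 0 := by ext σ; simpa using hcon σ
    rw [this] at hu1; simp at hu1
  let j : Fin n := ⟨0, by omega⟩
  let x : Fin d → SpinChain n d := fun a => unitOp j a (σ j) u
  have hxR : ∀ a, R (x a) = (e : ℂ) • x a := by
    intro a
    have hcomm : Commute R (unitOp j a (σ j)) :=
      localAlg_commute (S := Set.Ici 1) (T := Set.Iio 1) (Set.Iio_disjoint_Ici le_rfl).symm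
        (sum_mem fun i hi => by
          have := Finset.mem_Ico.1 hi
          exact chainTerm_mem_localAlg (by simp only [Set.mem_Ici]; omega)
            (by simp only [Set.mem_Ici]; omega))
        (unitOp_mem_localAlg (by simp [j]) _ _)
    have h1 : R (unitOp j a (σ j) u) = unitOp j a (σ j) (R u) := congrArg (fun L => L u) hcomm.eq
    change R (unitOp j a (σ j) u) = _
    rw [h1, hu, map_smul]
  have hxval : ∀ a a', x a (Function.update σ j a') = if a' = a then u σ else 0 := by
    intro a a'
    change unitOp j a (σ j) u _ = _
    rw [unitOp_apply]
    simp
  let a₀ : Fin d := ⟨0, by omega⟩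
  let a₁ : Fin d := ⟨1, by omega⟩
  have hne : a₁ ≠ a₀ := by simp [a₀, a₁]
  by_cases hin : inner ℂ Γ (x a₀) = 0
  · refine hmain (x a₀) (hxR _) (fun h0 => hσ ?_) hin
    have := hxval a₀ a₀
    rw [h0, if_pos rfl] at this
    simpa using this.symm
  · refine hmain (inner ℂ Γ (x a₀) • x a₁ - inner ℂ Γ (x a₁) • x a₀) ?_ (fun h0 => ?_) ?_
    · rw [map_sub, map_smul, map_smul, hxR, hxR, smul_sub]
      congr 1 <;> exact smul_comm _ _ _
    · have h1 := congrArg (fun y : SpinChain n d => y (Function.update σ j a₁)) h0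
      change inner ℂ Γ (x a₀) * x a₁ (Function.update σ j a₁)
        - inner ℂ Γ (x a₁) * x a₀ (Function.update σ j a₁) = 0 at h1
      rw [hxval, hxval, if_pos rfl, if_neg hne, mul_zero, sub_zero] at h1
      exact (mul_ne_zero hin hσ) h1
    · rw [inner_sub_right, inner_smul_right, inner_smul_right]; ring

end Gap

/-! ### Choice of parameters -/

section Parameters

theorem pow_four_mul_eq {L ε X : ℝ} (hL : 0 ≤ L) (hε : 0 < ε)
    (hX : X = L ^ (3 / 4 : ℝ) / ε ^ (1 / 4 : ℝ)) : X ^ 4 * ε = L ^ 3 := by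
  have h1 : (L ^ (3 / 4 : ℝ)) ^ 4 = L ^ 3 := by
    rw [← Real.rpow_natCast, ← Real.rpow_mul hL, ← Real.rpow_natCast]; norm_num
  have h2 : (ε ^ (1 / 4 : ℝ)) ^ 4 = ε := by
    rw [← Real.rpow_natCast, ← Real.rpow_mul hε.le]; norm_num
  rw [hX, div_pow, h1, h2, div_mul_cancel₀ _ hε.ne']

/-- The number of left operators, and hence the Schmidt rank, which arises from `l` letters in a
window of `s` terms is `exp (O(X log X))` when `s` and `l / s` are `O(X)`. -/
theorem exists_rank_le_exp (d : ℕ) {K : ℝ} (hK : 1 ≤ K) : ∃ C : ℝ, 0 < C ∧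
    ∀ (X : ℝ) (l s r : ℕ), 1 ≤ X → (l : ℝ) ≤ K * X ^ 2 → (s : ℝ) ≤ 3 * X → (r : ℝ) ≤ K * X →
      (((l + 1) * (s * ((l + 1) * ((r + 1) * (l * (d * d) + 1) ^ r) * (1 * d ^ s) * d ^ s)) : ℕ) : ℝ)
        ≤ Real.exp (C * X * Real.log (2 + X)) := by
  set c₁ : ℝ := K + 1 + 2
  set c₂ : ℝ := K * (d * d) + 1 + 2
  refine ⟨c₁ + (3 + 1) + c₁ + (K + 1 + 1) + c₂ * K + 6 * d, by positivity, ?_⟩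
  intro X l s r hX hl hs hr
  set Z := 2 + X with hZ
  set w := Real.log Z with hw
  have hZ0 : 0 < Z := by positivity
  have hw1 : 1 ≤ w := by
    rw [hw, Real.le_log_iff_exp_le hZ0]
    linarith [Real.exp_one_lt_d9]
  have hXw : 1 * 1 ≤ X * w := mul_le_mul hX hw1 zero_le_one (by linarith)
  have hZ1 : 1 ≤ Z := by linarith
  -- a polynomial bound in `Z = 2 + X` becomes an exponential one in `w = log Z ≥ 1`
  have hfac : ∀ (M y : ℝ) (j : ℕ), 0 ≤ M → y ≤ M * Z ^ j → y ≤ Real.exp ((M + j) * w) := by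
    intro M y j hM hy
    refine hy.trans ?_
    have hZj : Z ^ j = Real.exp (j * w) := by rw [Real.exp_nat_mul, hw, Real.exp_log hZ0]
    rw [add_mul, Real.exp_add, hZj]
    gcongr
    calc M ≤ Real.exp M := by linarith [Real.add_one_le_exp M]
      _ ≤ _ := Real.exp_le_exp.2 (le_mul_of_one_le_right hM hw1)
  have hwX : ∀ c : ℝ, 0 ≤ c → Real.exp (c * w) ≤ Real.exp (c * (X * w)) := fun c hc =>
    Real.exp_le_exp.2 (mul_le_mul_of_nonneg_left (le_mul_of_one_le_left (by linarith) hX) hc)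
  have hXZ : X ≤ Z := by linarith
  have hX2 : X ^ 2 ≤ Z ^ 2 := by gcongr
  have hZ2 : 1 ≤ Z ^ 2 := one_le_pow₀ hZ1
  have f1 : (l + 1 : ℝ) ≤ Real.exp (c₁ * (X * w)) := by
    refine (hfac (K + 1) _ 2 (by linarith) ?_).trans (by
      push_cast; exact hwX _ (by positivity))
    nlinarith
  have f2 : (s : ℝ) ≤ Real.exp ((3 + 1) * (X * w)) := by
    refine (hfac 3 _ 1 (by norm_num) ?_).trans (by push_cast; exact hwX _ (by positivity))
    rw [pow_one]; linarith
  have f3 : (r + 1 : ℝ) ≤ Real.exp ((K + 1 + 1) * (X * w)) := by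
    refine (hfac (K + 1) _ 1 (by linarith) ?_).trans (by push_cast; exact hwX _ (by positivity))
    rw [pow_one]; nlinarith
  have f4 : ((l * (d * d) + 1 : ℝ)) ^ r ≤ Real.exp (c₂ * K * (X * w)) := by
    have h1 : (l * (d * d) + 1 : ℝ) ≤ Real.exp (c₂ * w) := by
      refine (hfac (K * (d * d) + 1) _ 2 (by positivity) ?_).trans (by push_cast; exact le_rfl)
      have : (l : ℝ) * (d * d) ≤ K * Z ^ 2 * (d * d) := by
        gcongr
        exact hl.trans (by gcongr)
      nlinarith
    calc _ ≤ Real.exp (c₂ * w) ^ r := by gcongr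
      _ = Real.exp (c₂ * w * r) := by rw [← Real.exp_nat_mul]; congr 1; ring
      _ ≤ _ := Real.exp_le_exp.2 (by
        calc c₂ * w * r ≤ c₂ * w * (K * X) := by gcongr
          _ = _ := by ring)
  have f5 : ((d : ℝ) ^ s) ≤ Real.exp (3 * d * (X * w)) := by
    calc (d : ℝ) ^ s ≤ Real.exp d ^ s := by
          gcongr; linarith [Real.add_one_le_exp (d : ℝ)]
      _ = Real.exp (s * d) := by rw [← Real.exp_nat_mul]
      _ ≤ _ := Real.exp_le_exp.2 (by
        calc (s : ℝ) * d ≤ 3 * X * d := by gcongr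
          _ ≤ 3 * X * d * w := le_mul_of_one_le_right (by positivity) hw1
          _ = _ := by ring)
  push_cast
  rw [one_mul]
  calc (l + 1 : ℝ) * (s * ((l + 1) * ((r + 1) * (l * (d * d) + 1) ^ r) * d ^ s * d ^ s))
      ≤ Real.exp (c₁ * (X * w)) * (Real.exp ((3 + 1) * (X * w)) * (Real.exp (c₁ * (X * w)) *
        (Real.exp ((K + 1 + 1) * (X * w)) * Real.exp (c₂ * K * (X * w))) *
          Real.exp (3 * d * (X * w)) * Real.exp (3 * d * (X * w)))) := by gcongr
    _ = _ := by
      simp only [← Real.exp_add]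
      congr 1
      ring

/-- If `X = O(L ^ (7 / 8))` then `X * log X` is eventually below any multiple of `L`. -/
theorem exists_mul_log_le {a C : ℝ} (ha : 0 < a) (hC : 0 < C) : ∃ L₀ : ℝ, ∀ L X : ℝ, L₀ ≤ L →
    0 < X → X ^ 8 * a ≤ L ^ 7 → C * X * Real.log (2 + X) ≤ L := by
  have h1 : ∀ᶠ L : ℝ in Filter.atTop, ‖Real.log L ^ 8‖ ≤ (a / (C * 8) ^ 8) * ‖L‖ :=
    (Real.isLittleO_pow_log_id_atTop (n := 8)).bound (by positivity)
  obtain ⟨L₀, hL₀⟩ := Filter.eventually_atTop.1 h1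
  refine ⟨max L₀ (3 + 1 / a), fun L X hL hX0 hX => ?_⟩
  have hLa : 3 + 1 / a ≤ L := (le_max_right _ _).trans hL
  have ha' : 0 < 1 / a := by positivity
  have hL3 : 3 ≤ L := by linarith
  have h2 := hL₀ L ((le_max_left _ _).trans hL)
  have hlog : 0 ≤ Real.log L := Real.log_nonneg (by linarith)
  rw [Real.norm_of_nonneg (by positivity), Real.norm_of_nonneg (by linarith)] at h2
  have hXL : X ^ 8 ≤ L ^ 8 := by
    have h3 : L ^ 7 * (1 / a) ≤ L ^ 7 * L := by gcongr; linarith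
    have h4 : X ^ 8 ≤ L ^ 7 * (1 / a) := by
      rw [mul_one_div, le_div_iff₀ ha]; exact hX
    linarith [pow_succ L 7]
  have hXL' : X ≤ L := le_of_pow_le_pow_left₀ (by norm_num) (by linarith) hXL
  have hlogX : Real.log (2 + X) ≤ 8 * Real.log L := by
    rw [show (8 : ℝ) * Real.log L = Real.log (L ^ 8) by rw [Real.log_pow]; norm_num]
    refine Real.log_le_log (by linarith) ?_
    have h5 : L ^ 2 ≤ L ^ 8 := pow_le_pow_right₀ (by linarith) (by norm_num)
    nlinarith
  refine le_of_pow_le_pow_left₀ (n := 8) (by norm_num) (by linarith) ?_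
  calc (C * X * Real.log (2 + X)) ^ 8 ≤ (C * X * (8 * Real.log L)) ^ 8 := by
        have : 0 ≤ Real.log (2 + X) := Real.log_nonneg (by linarith)
        gcongr
    _ = X ^ 8 * ((C * 8) ^ 8 * Real.log L ^ 8) := by ring
    _ ≤ X ^ 8 * ((C * 8) ^ 8 * (a / (C * 8) ^ 8 * L)) := by gcongr
    _ = X ^ 8 * a * L := by field_simp
    _ ≤ L ^ 7 * L := by gcongr
    _ = L ^ 8 := by ring

set_option maxHeartbeats 1000000 in
/-- The choice of the window size `s`, the degree `l` and the truncation energy `t` in terms of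
`L = log n` and `X`. The exponent in `δ` dominates since
`l * √(ε / L) ≈ X ^ 2 * √(ε / L) = L`. -/
theorem exists_parameters (d p : ℕ) {a : ℝ} (ha : 0 < a) : ∃ C L₀ : ℝ, 0 < C ∧ 0 ≤ L₀ ∧
    ∀ (n : ℕ) (ε X : ℝ), L₀ ≤ Real.log n → 0 < ε → ε ≤ 1 → a ≤ Real.log n * ε ^ 2 → 0 < X →
      X ^ 4 * ε = Real.log n ^ 3 →
      ∃ (s l r D : ℕ) (t η δ : ℝ), 2 ≤ s ∧ 12 ≤ t ∧ l < s * (r + 1) ∧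
        D = (l + 1) * (s * ((l + 1) * ((r + 1) * (l * (d * d) + 1) ^ r) * (1 * d ^ s) * d ^ s)) ∧
        η = 2 * (n * Real.exp ((6 - t) / 6)) ∧ 4 * η < ε ∧
        δ = 2 * Real.exp (-(l * √(ε / 2 / (2 * t + s + 1)))) ∧ D * δ ^ 2 ≤ 1 / 4 ∧
        (D : ℝ) ≤ Real.exp (C * X * Real.log (2 + X)) ∧
        4 * n * (√(η / ε) + 2 * √D * δ) ≤ 1 / (n : ℝ) ^ p := by
  set τ : ℝ := 12 * p + 30 with hτ
  set C₁ : ℝ := 1 + 1 / a with hC₁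
  set Q : ℝ := p + 3 with hQ
  -- `2 * t + s + 1 ≤ b * L`
  set b : ℝ := 2 * τ + 3 * C₁ + 1 with hb
  set c : ℝ := 2 * Q ^ 2 * b with hc
  have ha' : 0 < 1 / a := by positivity
  have hC₁0 : 1 ≤ C₁ := by linarith
  have hp0 : (0 : ℝ) ≤ p := by positivity
  have hb0 : 0 < b := by positivity
  have hQ0 : 0 < Q := by positivity
  have hc0 : 0 < c := by positivity
  have hc1 : 1 ≤ c := by
    have h1 : 1 ≤ b := by rw [hb, hτ]; linarith
    have h2 : 1 ≤ Q ^ 2 := one_le_pow₀ (by rw [hQ]; linarith)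
    have h3 : 1 * 1 ≤ Q ^ 2 * b := mul_le_mul h2 h1 zero_le_one (by positivity)
    linarith
  obtain ⟨C, hC, hD⟩ := exists_rank_le_exp d (K := c + 2) (by linarith)
  obtain ⟨L₁, hL₁⟩ := exists_mul_log_le ha hC
  refine ⟨C, max L₁ (32 + 400 / a), hC, le_max_of_le_right (by positivity), ?_⟩
  intro n ε X hL hε hε1 haL hX0 hX
  set L := Real.log n with hLdef
  have hLa : 32 + 400 / a ≤ L := (le_max_right _ _).trans hL
  have ha'' : 0 < 400 / a := by positivity
  have hL32 : 32 ≤ L := by linarith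
  have hn0 : (0 : ℝ) < n := by
    rcases Nat.eq_zero_or_pos n with h0 | h0
    · rw [hLdef, h0] at hL32; norm_num at hL32
    · exact_mod_cast h0
  have hexpL : Real.exp L = n := Real.exp_log hn0
  have hLn : L ≤ n := by rw [← hexpL]; linarith [Real.add_one_le_exp L]
  have hn32 : (32 : ℝ) ≤ n := hL32.trans hLn
  have hexpk : ∀ k : ℕ, Real.exp (-(k * L)) = 1 / (n : ℝ) ^ k := fun k => by
    rw [Real.exp_neg, Real.exp_nat_mul, hexpL, one_div]
  have hX4 : L ^ 3 ≤ X ^ 4 := by rw [← hX]; exact mul_le_of_le_one_right (by positivity) hε1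
  have hX1 : 1 ≤ X := by
    refine le_of_pow_le_pow_left₀ (n := 4) (by norm_num) hX0.le ?_
    rw [one_pow]
    exact (one_le_pow₀ (by linarith)).trans hX4
  have hX8 : X ^ 8 * a ≤ L ^ 7 := by
    calc X ^ 8 * a ≤ X ^ 8 * (L * ε ^ 2) := by gcongr
      _ = (X ^ 4 * ε) ^ 2 * L := by ring
      _ = L ^ 7 := by rw [hX]; ring
  have hXL : X ≤ C₁ * L := by
    refine le_of_pow_le_pow_left₀ (n := 8) (by norm_num) (by positivity) ?_
    have h1 : X ^ 8 ≤ L ^ 7 * (1 / a) := by rw [mul_one_div, le_div_iff₀ ha]; exact hX8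
    have h2 : C₁ ≤ C₁ ^ 8 := le_self_pow₀ hC₁0 (by norm_num)
    calc X ^ 8 ≤ L ^ 7 * (1 / a) := h1
      _ ≤ L ^ 8 * C₁ ^ 8 := by
        gcongr
        · exact le_trans (by linarith) le_rfl
        · norm_num
        · linarith
      _ = _ := by ring
  have hεinv : 1 / ε ≤ n / a := by
    rw [div_le_div_iff₀ hε ha]
    calc 1 * a ≤ L * ε ^ 2 := by rwa [one_mul]
      _ ≤ n * ε := mul_le_mul hLn (pow_le_of_le_one hε.le hε1 two_ne_zero) (by positivity) hn0.le
  set s := ⌈X⌉₊ + 1 with hs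
  set l := ⌈c * X ^ 2⌉₊ with hl
  set t := τ * L with ht
  have hs2 : 2 ≤ s := by
    have : 0 < ⌈X⌉₊ := Nat.ceil_pos.2 hX0
    omega
  have hs3 : (s : ℝ) ≤ 3 * X := by
    have := (Nat.ceil_lt_add_one hX0.le).le
    rw [hs]; push_cast; linarith
  have hsX : X ≤ s := by
    have := Nat.le_ceil X
    rw [hs]; push_cast; linarith
  have hlX : c * X ^ 2 ≤ l := Nat.le_ceil _
  have hlK : (l : ℝ) ≤ (c + 2) * X ^ 2 := by
    have := (Nat.ceil_lt_add_one (show 0 ≤ c * X ^ 2 by positivity)).le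
    linarith [one_le_pow₀ (n := 2) hX1]
  have hr : ((l / s : ℕ) : ℝ) ≤ (c + 2) * X := by
    refine Nat.cast_div_le.trans ?_
    rw [div_le_iff₀ (by linarith)]
    calc (l : ℝ) ≤ (c + 2) * X * X := hlK.trans_eq (by ring)
      _ ≤ _ := by gcongr
  obtain ⟨D, hDdef⟩ : ∃ D : ℕ, D = (l + 1) * (s * ((l + 1) * ((l / s + 1)
    * (l * (d * d) + 1) ^ (l / s)) * (1 * d ^ s) * d ^ s)) := ⟨_, rfl⟩
  have hDexp : (D : ℝ) ≤ Real.exp (C * X * Real.log (2 + X)) := by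
    rw [hDdef]; exact hD X l s (l / s) hX1 hlK hs3 hr
  have hDn : (D : ℝ) ≤ n := by
    rw [← hexpL]
    exact hDexp.trans (Real.exp_le_exp.2 (hL₁ L X ((le_max_left _ _).trans hL) hX0 hX8))
  have hη : (6 - t) / 6 = 1 + -((2 * p + 5 : ℕ) * L) := by
    rw [ht, hτ]; push_cast; ring
  have hδ : Real.exp (-(l * √(ε / 2 / (2 * t + s + 1)))) ≤ 1 / (n : ℝ) ^ (p + 3) := by
    rw [← hexpk, Real.exp_le_exp, neg_le_neg_iff]
    have h0 : 0 < 2 * t + s + 1 := by positivity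
    have h1 : 2 * t + s + 1 ≤ b * L := by
      rw [hb, ht]; linarith
    have h2 : Q * L / l ≤ √(ε / 2 / (2 * t + s + 1)) := by
      refine Real.le_sqrt_of_sq_le ?_
      have hl0 : (0 : ℝ) < l := lt_of_lt_of_le (by positivity) hlX
      rw [div_pow, div_div, div_le_div_iff₀ (by positivity) (by positivity)]
      calc (Q * L) ^ 2 * (2 * (2 * t + s + 1)) ≤ (Q * L) ^ 2 * (2 * (b * L)) := by gcongr
        _ = c * L ^ 3 := by rw [hc]; ring
        _ ≤ c ^ 2 * L ^ 3 := by
          gcongr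
          exact le_self_pow₀ hc1 two_ne_zero
        _ = ε * (c * X ^ 2) ^ 2 := by rw [← hX]; ring
        _ ≤ ε * l ^ 2 := by gcongr
    have hl0 : (0 : ℝ) < l := lt_of_lt_of_le (by positivity) hlX
    rw [div_le_iff₀ hl0] at h2
    push_cast
    linarith
  set η := 2 * (n * Real.exp ((6 - t) / 6)) with hηdef
  set δ := 2 * Real.exp (-(l * √(ε / 2 / (2 * t + s + 1)))) with hδdef
  have hδ0 : 0 ≤ δ := by positivity
  have hηε : η / ε ≤ (1 / (8 * (n : ℝ) ^ (p + 1))) ^ 2 := by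
    have h1 : η = 2 * (n * (Real.exp 1 * (1 / (n : ℝ) ^ (2 * p + 5)))) := by
      rw [hηdef, hη, Real.exp_add, hexpk]
    have h2 : Real.exp 1 ≤ 3 := by linarith [Real.exp_one_lt_d9]
    have h3 : 400 / a ≤ n := by linarith
    calc η / ε = η * (1 / ε) := by ring
      _ ≤ 2 * (n * (3 * (1 / (n : ℝ) ^ (2 * p + 5)))) * (n / a) := by
        rw [h1]; gcongr
      _ = (400 / a) * (6 / 400 * (n * n * (1 / (n : ℝ) ^ (2 * p + 5)))) := by ring
      _ ≤ n * (6 / 400 * (n * n * (1 / (n : ℝ) ^ (2 * p + 5)))) := by gcongr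
      _ = 6 / 400 * (1 / (n : ℝ) ^ (p + 1)) ^ 2 := by
        field_simp
        ring
      _ ≤ 1 / 64 * (1 / (n : ℝ) ^ (p + 1)) ^ 2 :=
        mul_le_mul_of_nonneg_right (by norm_num) (by positivity)
      _ = _ := by ring
  have hn1 : (1 : ℝ) ≤ n := by linarith
  have hsq : √(η / ε) ≤ 1 / (8 * (n : ℝ) ^ (p + 1)) :=
    Real.sqrt_le_iff.2 ⟨by positivity, hηε⟩
  have hsD : √(D : ℝ) ≤ n := by
    refine Real.sqrt_le_iff.2 ⟨hn0.le, hDn.trans (le_self_pow₀ hn1 two_ne_zero)⟩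
  have hδ2 : δ ≤ 2 * (1 / (n : ℝ) ^ (p + 3)) := by rw [hδdef]; gcongr
  refine ⟨s, l, l / s, D, t, η, δ, hs2, ?_, Nat.lt_mul_div_succ l (by omega), hDdef, rfl, ?_, rfl,
    ?_, hDexp, ?_⟩
  · calc (12 : ℝ) ≤ 30 * 1 := by norm_num
      _ ≤ τ * L := mul_le_mul (by linarith) (by linarith) zero_le_one (by linarith)
  · have h1 : 1 / (8 * (n : ℝ) ^ (p + 1)) ≤ 1 / 8 := by
      rw [one_div_le_one_div (by positivity) (by norm_num)]
      linarith [one_le_pow₀ (n := p + 1) hn1]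
    have h2 : (1 / (8 * (n : ℝ) ^ (p + 1))) ^ 2 ≤ (1 / 8) ^ 2 := by gcongr
    have h3 := hηε.trans h2
    rw [div_le_iff₀ hε] at h3
    linarith
  · calc D * δ ^ 2 ≤ n * (2 * (1 / (n : ℝ) ^ (p + 3))) ^ 2 := by gcongr
      _ = 4 * (1 / (n : ℝ) ^ (2 * p + 5)) := by field_simp; ring
      _ ≤ 4 * (1 / n) := by
        gcongr
        exact le_self_pow₀ hn1 (by omega)
      _ ≤ 4 * (1 / 32) := by gcongr
      _ ≤ 1 / 4 := by norm_num
  · calc 4 * n * (√(η / ε) + 2 * √D * δ)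
        ≤ 4 * n * (1 / (8 * (n : ℝ) ^ (p + 1)) + 2 * n * (2 * (1 / (n : ℝ) ^ (p + 3)))) := by
          gcongr
      _ = (1 / 2 + 16 / n) * (1 / (n : ℝ) ^ p) := by field_simp; ring
      _ ≤ (1 / 2 + 16 / 32) * (1 / (n : ℝ) ^ p) := by gcongr
      _ = _ := by norm_num

end Parameters

/-! ### Existence of the approximation -/

section Final
variable {n d : ℕ}

theorem norm_normalize_sub_le {E : Type*} [NormedAddCommGroup E] [NormedSpace ℂ E] {ψ Γ : E}
    (hΓ : ‖Γ‖ = 1) (hψ : ψ ≠ 0) :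
    ‖((‖ψ‖⁻¹ : ℝ) : ℂ) • ψ‖ = 1 ∧ ‖((‖ψ‖⁻¹ : ℝ) : ℂ) • ψ - Γ‖ ≤ 2 * ‖ψ - Γ‖ := by
  have h0 : ‖ψ‖ ≠ 0 := norm_ne_zero_iff.2 hψ
  refine ⟨by rw [norm_smul, Complex.norm_real, norm_inv, norm_norm, inv_mul_cancel₀ h0], ?_⟩
  have h1 : ((‖ψ‖⁻¹ : ℝ) : ℂ) • ψ - ψ = ((‖ψ‖⁻¹ - 1 : ℝ) : ℂ) • ψ := by
    rw [Complex.ofReal_sub, sub_smul, Complex.ofReal_one, one_smul]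
  have h2 : ‖((‖ψ‖⁻¹ : ℝ) : ℂ) • ψ - ψ‖ ≤ ‖ψ - Γ‖ := by
    rw [h1, norm_smul, Complex.norm_real, Real.norm_eq_abs]
    calc |‖ψ‖⁻¹ - 1| * ‖ψ‖ = |(‖ψ‖⁻¹ - 1) * ‖ψ‖| := by rw [abs_mul, abs_norm]
      _ = |‖Γ‖ - ‖ψ‖| := by rw [sub_mul, inv_mul_cancel₀ h0, one_mul, hΓ]
      _ ≤ ‖Γ - ψ‖ := abs_norm_sub_norm_le _ _
      _ = _ := norm_sub_rev _ _
  calc _ = ‖(((‖ψ‖⁻¹ : ℝ) : ℂ) • ψ - ψ) + (ψ - Γ)‖ := by congr 1; abel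
    _ ≤ _ := (norm_add_le _ _).trans (by linarith)

/-- Below any fixed length of the chain, the bond dimension `d ^ n` of an exact representation is
admissible. -/
theorem pow_le_exp_of_log_lt (hn : 2 ≤ n) {ε X L₀ : ℝ} (hL : Real.log n < L₀)
    (hε1 : ε ≤ 1) (hX0 : 0 < X) (hX : X ^ 4 * ε = Real.log n ^ 3) :
    ((d ^ n : ℕ) : ℝ) ≤ Real.exp (4 * d * Real.exp L₀ * X * Real.log (2 + X)) := by
  have hn0 : (0 : ℝ) < n := by exact_mod_cast (by omega : 0 < n)
  have hnL : (n : ℝ) ≤ Real.exp L₀ := (Real.log_le_iff_le_exp hn0).1 hL.le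
  have hlog2 : (1 : ℝ) / 2 ≤ Real.log 2 := by linarith [Real.log_two_gt_d9]
  have hlogn : Real.log 2 ≤ Real.log n := Real.log_le_log (by norm_num) (by exact_mod_cast hn)
  have hX2 : 1 / 2 ≤ X := by
    refine le_of_pow_le_pow_left₀ (n := 4) (by norm_num) hX0.le ?_
    have h1 : (0.69 : ℝ) ≤ Real.log n := by linarith [Real.log_two_gt_d9]
    calc (1 / 2 : ℝ) ^ 4 ≤ 0.69 ^ 3 := by norm_num
      _ ≤ Real.log n ^ 3 := by gcongr
      _ = X ^ 4 * ε := hX.symm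
      _ ≤ X ^ 4 := mul_le_of_le_one_right (by positivity) hε1
  have hlogX : 1 / 2 ≤ Real.log (2 + X) :=
    hlog2.trans (Real.log_le_log (by norm_num) (by linarith))
  push_cast
  calc (d : ℝ) ^ n ≤ Real.exp d ^ n := by
        gcongr
        linarith [Real.add_one_le_exp (d : ℝ)]
    _ = Real.exp (4 * d * n * (1 / 2) * (1 / 2)) := by
      rw [← Real.exp_nat_mul]; congr 1; ring
    _ ≤ _ := by
      apply Real.exp_le_exp.2
      gcongr

end Final

theorem mainTheorem6 (d p : ℕ) (a : ℝ) (ha : 0 < a) :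
    ∃ (C : ℝ) (k : ℕ), 0 < C ∧
      ∀ (n : ℕ), 2 ≤ n →
      ∀ (h : Fin (n - 1) → Matrix (Fin d × Fin d) (Fin d × Fin d) ℂ),
        (∀ i, (h i).PosSemidef ∧ (1 - h i).PosSemidef) →
      ∀ (Γ : SpinChain n d) (E₀ E₁ ε X : ℝ),
        IsGappedGroundState (chainHamiltonian h) Γ E₀ E₁ →
        ε = E₁ - E₀ →
        a / ε ^ 2 ≤ Real.log n →
        X = Real.log n ^ (3 / 4 : ℝ) / ε ^ (1 / 4 : ℝ) →
      ∃ (B : ℕ) (ψ : SpinChain n d),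
        (B : ℝ) ≤ Real.exp (C * X * Real.log (2 + X) ^ k) ∧
        IsMatrixProductState B ψ ∧
        ‖ψ‖ = 1 ∧
        ‖ψ - Γ‖ ≤ 1 / (n : ℝ) ^ p := by
  obtain ⟨C, L₀, hC, hL₀, hpar⟩ := exists_parameters d p ha
  refine ⟨C + 4 * d * Real.exp L₀, 1, by positivity, ?_⟩
  intro n hn h hh Γ E₀ E₁ ε X hΓ hε haε hX
  rw [chainHamiltonian_eq] at hΓ
  have hd : 0 < d := by have := hΓ.two_le; omega
  have hε0 : 0 < ε := by rw [hε]; linarith [hΓ.lt]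
  have hε1 : ε ≤ 1 := by rw [hε]; linarith [hΓ.le_add_one hn hh]
  have hlogn : 0 < Real.log n := Real.log_pos (by exact_mod_cast (by omega : 1 < n))
  have hX4 := pow_four_mul_eq hlogn.le hε0 hX
  have hX0 : 0 < X := by rw [hX]; positivity
  have hlogX : 0 ≤ Real.log (2 + X) := Real.log_nonneg (by linarith)
  rw [div_le_iff₀ (by positivity)] at haε
  simp only [pow_one]
  rcases lt_or_ge (Real.log n) L₀ with hL | hL
  · refine ⟨d ^ n, Γ, ?_, isMatrixProductState_of_schmidtLE hd fun c => ?_, hΓ.norm_eq_one, ?_⟩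
    · refine (pow_le_exp_of_log_lt hn hL hε1 hX0 hX4).trans (Real.exp_le_exp.2 ?_)
      gcongr
      linarith
    · rcases le_total c n with hc | hc
      · exact (schmidtLE_pow hd c Γ).mono (Nat.pow_le_pow_right hd hc)
      · exact (schmidtLE_one_of_le hc Γ).mono (Nat.one_le_pow _ _ hd)
    · rw [sub_self, norm_zero]; positivity
  · obtain ⟨s, l, r, D, t, η, δ, hs, ht, hlsr, hD, hη, hηε, hδ, hDδ, hDexp, herr⟩ :=
      hpar n ε X hL hε0 hε1 haε hX0 hX4
    have hH := (sum_chainTerm_nonneg hh (Finset.range (n - 1))).isSelfAdjoint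
    have hD1 : 1 ≤ D := by
      rw [hD]
      have : 0 < s := by omega
      exact Nat.succ_le_of_lt (by positivity)
    have hδ0 : 0 ≤ δ := by rw [hδ]; positivity
    obtain ⟨ψ, hψ, hψΓ⟩ := exists_matrixProductState_approx (Γ := Γ) hD1
      (δ := √(η / ε) + 2 * √D * δ) (fun c hc1 hcn => by
        obtain ⟨k, rfl⟩ : ∃ k, c = k + 1 := ⟨c - 1, by omega⟩
        exact exists_schmidtLE_near_ground hd hh hΓ.norm_eq_one hΓ.apply_eq
          (hΓ.algebraMap_le hH) hε0 hε1 (fun x hx => by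
            rw [show E₀ + ε = E₁ by rw [hε]; ring]
            exact hΓ.le_energy hH hx) (by omega) hs ht hlsr hD hη hηε hδ hDδ) (by positivity)
    have hn1 : (1 : ℝ) ≤ (n : ℝ) ^ p := one_le_pow₀ (by exact_mod_cast (by omega : 1 ≤ n))
    have herr' : 2 * ‖ψ - Γ‖ ≤ 1 / (n : ℝ) ^ p := by linarith
    have hψ0 : ψ ≠ 0 := by
      rintro rfl
      rw [zero_sub, norm_neg, hΓ.norm_eq_one] at herr'
      have : 1 / (n : ℝ) ^ p ≤ 1 := by rw [div_le_one (by positivity)]; exact hn1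
      linarith
    obtain ⟨h1, h2⟩ := norm_normalize_sub_le hΓ.norm_eq_one hψ0
    refine ⟨D, ((‖ψ‖⁻¹ : ℝ) : ℂ) • ψ, ?_, isMatrixProductState_of_schmidtLE hd fun c =>
      (hψ c).smul _, h1, h2.trans herr'⟩
    refine hDexp.trans (Real.exp_le_exp.2 ?_)
    gcongr
    have : 0 ≤ 4 * d * Real.exp L₀ := by positivity
    linarith
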